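/- Partitions are written $\lambda=(\lambda_1\ge\lambda_2\ge\cdots)=(1^{m_1}2^{m_2}\cdots)$, so that $m_i$ is the multiplicity of the part $i$; $|\lambda|$ is the size of $\lambda$. Put $b(\lambda)=\sum_{i\ge1}(i-1)\lambda_i$ and $\operatorname{sg}(\lambda)=(-1)^{b(\lambda)}$. Write $\lambda\binom{a_1,a_2,\dots}{b_1,b_2,\dots}$ for the partition obtained from $\lambda$ by replacing the parts $a_1,a_2,\dots$ with $b_1,b_2,\dots$, deleting zeros and rearranging. For partitions $\nu\subsetneq\mu$, let $\operatorname{ht}(\mu/\nu)$ be the index of the last row that meets the skew diagram $\mu/\nu$ minus the index of the first such row; thus for a border strip (a nonempty skew diagram that is connected through common edges of cells and contains no $2\times2$ square) it is the number of nonempty rows minus one, and for $i>j$ with $m_i\ge1$, $\operatorname{ht}\bigl(\lambda/\lambda\binom{i}{j}\bigr)=\sum_{j<a<i}m_a$. Let $K_{\mu,\lambda}(t)\in\mathbb{Z}[t]$ be the Kostka–Foulkes polynomials, defined by $s_\mu=\sum_\lambda K_{\mu,\lambda}(t)P_\lambda(t)$, where $s_\mu$ are the Schur functions and $P_\lambda(t)$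 the Hall–Littlewood $P$-functions. **Theorem.** Let $\lambda=(1^{m_1}2^{m_2}\cdots)$ be the Jordan type of a nilpotent element of a Lie algebra of type $B$, $C$ or $D$, that is, of $\mathfrak{so}_{2n+1}(\mathbb{C})$, $\mathfrak{sp}_{2n}(\mathbb{C})$ or $\mathfrak{so}_{2n}(\mathbb{C})$ for some $n$. Let $k\ge1$ and let $\nu$ be a partition with $|\nu|=|\lambda|-2k$. Then $$\begin{aligned} &\operatorname{sg}(\lambda)\sum_{\substack{|\mu|=|\lambda|\\ \mu/\nu\text{ a border strip}}}(-1)^{\operatorname{ht}(\mu/\nu)}K_{\mu,\lambda}(-1)\\ ={}&\sum_{i\ge k,\ m_i\ge2}\operatorname{sg}\!\left(\lambda\tbinom{i,i}{i-k,i-k}\right)2\left\lfloor\frac{m_i}{2}\right\rfloor K_{\nu,\lambda\binom{i,i}{i-k,i-k}}(-1)\\ &+\sum_{i\ge2k,\ m_i\text{ odd}}\operatorname{sg}\!\left(\lambda\tbinom{i}{i-2k}\right)(-1)^{\operatorname{ht}\left(\lambda/\lambda\binom{i}{i-2k}\right)}K_{\nu,\lambda\binom{i}{i-2k}}(-1)\\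 &+\sum_{\substack{0<i-j<2k\le i+j\\ m_i,\,m_j\text{ odd}}}\operatorname{sg}\!\left(\lambda\tbinom{i,j}{\frac{i+j}{2}-k,\frac{i+j}{2}-k}\right)(-1)^{\operatorname{ht}\left(\lambda/\lambda\binom{i}{j}\right)}\,2\,K_{\nu,\lambda\binom{i,j}{\frac{i+j}{2}-k,\frac{i+j}{2}-k}}(-1). \end{aligned}$$ In the last sum, $i$ and $j$ range over positive integers; $i-j$ is automatically even, because all parts of odd multiplicity of such a $\lambda$ have the same parity. -/

import Mathlib

/-! Partitions are represented by Young diagrams in English notation, with rows and columns numbered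
from `0`: for a partition `lam`, `lam.rowLen i` is its part number `i + 1`, `lam.rowLens` is the list
of its nonzero parts, `lam.colLen j` is the part number `j + 1` of the transposed partition, and
`lam.card` is its size. -/

namespace HallLittlewood

open scoped Polynomial

/-! ### Combinatorics of partitions -/

/-- The multiplicity `m_i` of the part `i` in the partition `lam`. -/
def mult (lam : YoungDiagram) (i : ℕ) : ℕ := lam.rowLens.count i

/-- The set of (nonzero) parts of `lam`, without multiplicities. -/
def partSet (lam : YoungDiagram) : Finset ℕ := lam.rowLens.toFinset

/-- The weighted size `b(lam) = ∑_{i ≥ 1} (i - 1) lam_i`. -/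
def weightedSize (lam : YoungDiagram) : ℕ :=
  ∑ i ∈ Finset.range (lam.colLen 0), i * lam.rowLen i

/-- The sign `(-1) ^ b(lam)` of a partition. -/
def sg (lam : YoungDiagram) : ℤ := (-1) ^ weightedSize lam

/-- The partition obtained from `lam` by removing the parts in the multiset `A`, inserting those in
`B`, and rearranging. Zeros in `B` give empty rows, that is, no parts. -/
def replaceParts (lam : YoungDiagram) (A B : Multiset ℕ) : YoungDiagram :=
  YoungDiagram.ofRowLens (((lam.rowLens : Multiset ℕ) - A + B).sort (· ≥ ·))
    (Multiset.pairwise_sort _ _).sortedGE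

/-- The height of a nonempty skew shape `mu / nu`: the number of the last row that it meets minus the
number of the first one. -/
noncomputable def height (mu nu : YoungDiagram) : ℕ :=
  sSup {i | nu.rowLen i < mu.rowLen i} - sInf {i | nu.rowLen i < mu.rowLen i}

/-- `mu / nu` is a border strip: `nu` is contained in `mu`, the cells of `mu / nu` are (nonempty and)
connected through common edges, and they contain no `2 × 2` square. The Hasse diagram of `ℕ × ℕ` is
the grid graph: two cells are adjacent when they have a common edge. -/
def IsBorderStrip (mu nu : YoungDiagram) : Prop :=
  nu ≤ mu ∧
  ((SimpleGraph.hasse (ℕ × ℕ)).induce {c | c ∈ mu ∧ c ∉ nu}).Connected ∧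
  ¬ ∃ i j : ℕ, ∀ a ∈ ({i, i + 1} : Set ℕ), ∀ b ∈ ({j, j + 1} : Set ℕ),
    (a, b) ∈ mu ∧ (a, b) ∉ nu

theorem finite_card_eq (n : ℕ) : {mu : YoungDiagram | mu.card = n}.Finite := by
  refine Set.Finite.of_finite_image (f := YoungDiagram.cells) ?_ ?_
  · refine Set.Finite.subset
      (Finset.finite_toSet (Finset.range n ×ˢ Finset.range n).powerset) ?_
    rintro _ ⟨mu, hmu, rfl⟩
    simp only [Set.mem_ofPred_eq] at hmu
    simp only [Finset.coe_powerset, Set.mem_preimage, Set.mem_powerset_iff, Finset.coe_subset]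
    rintro ⟨i, j⟩ hc
    rw [YoungDiagram.mem_cells] at hc
    have h1 := YoungDiagram.mem_iff_lt_colLen.1 hc
    have h2 := YoungDiagram.mem_iff_lt_rowLen.1 hc
    rw [YoungDiagram.colLen_eq_card] at h1
    rw [YoungDiagram.rowLen_eq_card] at h2
    have h3 : (mu.col j).card ≤ mu.card := Finset.card_le_card (Finset.filter_subset _ _)
    have h4 : (mu.row i).card ≤ mu.card := Finset.card_le_card (Finset.filter_subset _ _)
    simp only [Finset.mem_product, Finset.mem_range]
    omega
  · intro a _ b _ h
    exact YoungDiagram.ext h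

/-- The finite set of all partitions of `n`. -/
noncomputable def partitionsOf (n : ℕ) : Finset YoungDiagram := (finite_card_eq n).toFinset

/-! ### Schur polynomials, Hall–Littlewood polynomials and Kostka–Foulkes polynomials -/

/-- The field of fractions of `ℤ[t][x_1, …, x_n]`. -/
abbrev RatFun (n : ℕ) : Type := FractionRing (MvPolynomial (Fin n) ℤ[X])

/-- The variable `x_i`. -/
noncomputable def xvar {n : ℕ} (i : Fin n) : RatFun n :=
  algebraMap (MvPolynomial (Fin n) ℤ[X]) (RatFun n) (MvPolynomial.X i)

/-- An element of `ℤ[t]`, regarded as a constant. -/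
noncomputable def const (n : ℕ) (c : ℤ[X]) : RatFun n :=
  algebraMap (MvPolynomial (Fin n) ℤ[X]) (RatFun n) (MvPolynomial.C c)

/-- The Schur polynomial
`s_mu(x_1, …, x_n) = det (x_i ^ (mu_j + n - j)) / det (x_i ^ (n - j))`
of a partition `mu` with at most `n` parts. -/
noncomputable def schurPoly (n : ℕ) (mu : YoungDiagram) : RatFun n :=
  (Matrix.of fun i j : Fin n => xvar i ^ (mu.rowLen j + (n - 1 - (j : ℕ)))).det /
    (Matrix.of fun i j : Fin n => xvar i ^ (n - 1 - (j : ℕ))).det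

/-- The distinct rearrangements of `(lam_1, …, lam_n)`. -/
def rearrangements (n : ℕ) (lam : YoungDiagram) : Finset (Fin n → ℕ) :=
  Finset.univ.image fun w : Equiv.Perm (Fin n) => fun i => lam.rowLen (w i)

/-- The Hall–Littlewood polynomial
`P_lam(x_1, …, x_n; t) =
  ∑_{w ∈ S_n / S_n^lam} w (x^lam ∏_{lam_i > lam_j} (x_i - t x_j) / (x_i - x_j))`
of a partition `lam` with at most `n` parts. The cosets of the stabilizer of `(lam_1, …, lam_n)` are
the distinct rearrangements of this vector. -/
noncomputable def hallLittlewoodP (n : ℕ) (lam : YoungDiagram) : RatFun n :=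
  ∑ a ∈ rearrangements n lam,
    (∏ i, xvar i ^ a i) *
      ∏ p : Fin n × Fin n with a p.2 < a p.1,
        (xvar p.1 - const n Polynomial.X * xvar p.2) / (xvar p.1 - xvar p.2)

/-- `K` is the family of coefficients, indexed by the partitions `lam` of the size of `mu`, in the
expansion `s_mu = ∑_lam K lam • P_lam(t)` of symmetric functions over `ℤ[t]`. An identity between
homogeneous symmetric functions of degree `m` is an identity in `n` variables for all `n ≥ m`. -/
def IsSchurExpansion (mu : YoungDiagram) (K : YoungDiagram →₀ ℤ[X]) : Prop :=
  (∀ lam ∈ K.support, lam.card = mu.card) ∧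
  ∀ n : ℕ, mu.card ≤ n →
    schurPoly n mu = K.sum fun lam c => const n c * hallLittlewoodP n lam

/-- The Kostka–Foulkes polynomial `K_{mu, lam}(t) ∈ ℤ[t]`: the coefficient of `P_lam(t)` in the
(existing and unique) expansion of `s_mu`. -/
noncomputable def kostkaFoulkes (mu lam : YoungDiagram) : ℤ[X] :=
  Classical.epsilon (IsSchurExpansion mu) lam

/-! ### Jordan types in classical Lie algebras -/

/-- The square matrix `A` is nilpotent and `lam` is the partition formed by the sizes of its Jordan
blocks: for each `j`, the number `lam.colLen j` of blocks of size greater than `j` is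
`dim ker A ^ (j + 1) - dim ker A ^ j`. -/
def HasJordanType {ι : Type*} [Fintype ι] [DecidableEq ι] (A : Matrix ι ι ℂ)
    (lam : YoungDiagram) : Prop :=
  IsNilpotent A ∧
  ∀ j : ℕ, Module.finrank ℂ (LinearMap.ker (Matrix.toLin' (A ^ (j + 1)))) =
    Module.finrank ℂ (LinearMap.ker (Matrix.toLin' (A ^ j))) + lam.colLen j

/-- `lam` is the Jordan type of a nilpotent element of a Lie algebra of type `B`, `C` or `D`, that
is, of `so_{2n+1}(ℂ)`, `sp_{2n}(ℂ)` or `so_{2n}(ℂ)` for some `n`. -/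
def IsClassicalJordanType (lam : YoungDiagram) : Prop :=
  (∃ n : ℕ, ∃ A ∈ LieAlgebra.Orthogonal.so (Fin (2 * n + 1)) ℂ, HasJordanType A lam) ∨
  (∃ n : ℕ, ∃ A ∈ LieAlgebra.Symplectic.sp (Fin n) ℂ, HasJordanType A lam) ∨
  (∃ n : ℕ, ∃ A ∈ LieAlgebra.Orthogonal.so (Fin (2 * n)) ℂ, HasJordanType A lam)

end HallLittlewood

/-!
At `t = -1` the Hall–Littlewood functions are governed by a Clifford-like algebra, on which the
power sum `p_{2k}` acts by a derivation; the three sums are what this derivation does to the ordered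
product that belongs to `lam`.

Let `K_{β, α}` be the coefficient of `x^α` in `det (x_i ^ β_j) ∏_{i < j} (1 - t x_j / x_i)⁻¹`,
expanded for `|x_1| ≫ |x_2| ≫ ⋯` (`kos`). With `δ = (n - 1, …, 1, 0)`, the functionals that
send `g` to the coefficient of `x^(lam + δ)` in `g ∏ (1 - t x_j / x_i)⁻¹` are dual to the
Hall–Littlewood polynomials multiplied by the Vandermonde product (`cf_toSer_hlNum`), and they separate alternating polynomials (`eq_zero_of_alternating`).
Hence the Kostka–Foulkes polynomials exist as in their definition, and
`K_{mu, lam}(t) = K_{mu + δ, lam + δ}` (`kostkaFoulkes_eq_kos`).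

Three properties of `K_{β, α}` are used. Multiplication by the power sum `p_r` gives
`∑_j K_{β + r e_j, α} = ∑_i K_{β, α - r e_i}` (`sum_kos_add_single`), and for `β = nu + δ` the left
hand side is the signed sum over border strips (`sum_isBorderStrip`). So the left hand side of the
theorem is obtained by lowering one part of `lam` by `2k` in all ways; the result has to be
expressed by partitions again. Exchanging two adjacent entries of `α` gives a straightening relation
(`kos_straighten`). Finally `K_{β, α}` vanishes if the last entry of `α` is negative and `β ≥ 0`.

At `t = -1` the straightening relation is a relation between words. On the functions of words that
satisfy it, let `B a` append the letter `a`. The relation says that the anticommutator `{B a, B b}`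
is `-{B (a + 1), B (b - 1)}`. Therefore `{B a, B b}` is `0` if `a + b` is odd and `± 2 B c ^ 2` if
`a + b = 2 c`, and the squares `B c ^ 2` are central (`IsCliffordFamily.commute_sq`). The commutator
with the operator that lowers one letter by `2k` is a derivation with `B a ↦ B (a - 2k)`. Applied to
the product of the `B a` over the parts `a` of `lam`, in which equal parts pair off into central
factors, it gives three kinds of terms (`IsCliffordFamily.deriv_wordProd`):
* a pair `B c ^ 2` becomes `{B c, B (c - 2k)} = ± 2 B (c - k) ^ 2`;
* an unpaired `B i` becomes `B (i - 2k)`, which anticommutes up to a central term with the unpaired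
  `B j` on its way to its place, each contributing a sign;
* such a central term arises from each `j` between `i - 2k` and `i`, namely `± 2 B c ^ 2` with `c`
  the midpoint of `i - 2k` and `j`.

For this all unpaired parts must have the same parity, which holds for the Jordan types in question
because the rank of a skew-symmetric matrix is even (`IsClassicalJordanType.mod_two_eq`). The number
of variables is chosen such that the empty rows pair off as well. It remains to compare signs: the
sign `sg` is computed by `b(lam) = ∑ min (lam_i, lam_j)` over pairs of rows (`sg_eq_pairMin`), and
the height counts the parts that a lowered part passes (`height_eq_card_filter`).
-/

namespace HallLittlewood

open scoped Polynomial

/-! ### Formal Laurent series in `x_1, …, x_n` -/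

/-- Formal series in `x_1^{±1}, …, x_n^{±1}`, expanded in the region `|x_1| ≫ |x_2| ≫ ⋯`. The
Hahn series exponent of the monomial `x^v` is `-v`, so that `x_j / x_i` is infinitesimal for
`i < j`. -/
abbrev LaurentSer (n : ℕ) (R : Type*) [CommRing R] : Type _ := HahnSeries (Lex (Fin n → ℤ)) R

section Basic

variable {n : ℕ} {R : Type*} [CommRing R]

/-- The coefficient of `x^v`. -/
def cf (F : LaurentSer n R) (v : Fin n → ℤ) : R := F.coeff (toLex (-v))

/-- The monomial `x^v`. -/
noncomputable def mono (v : Fin n → ℤ) : LaurentSer n R := HahnSeries.single (toLex (-v)) 1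

theorem cf_ext {F G : LaurentSer n R} (h : ∀ v, cf F v = cf G v) : F = G := by
  ext v
  have := h (-(ofLex v))
  simpa [cf] using this

@[simp] theorem cf_zero (v : Fin n → ℤ) : cf (0 : LaurentSer n R) v = 0 := rfl

@[simp] theorem cf_add (F G : LaurentSer n R) (v : Fin n → ℤ) : cf (F + G) v = cf F v + cf G v :=
  rfl

@[simp] theorem cf_sub (F G : LaurentSer n R) (v : Fin n → ℤ) : cf (F - G) v = cf F v - cf G v :=
  rfl

@[simp] theorem cf_neg (F : LaurentSer n R) (v : Fin n → ℤ) : cf (-F) v = -cf F v := rfl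

@[simp] theorem cf_C_mul (r : R) (F : LaurentSer n R) (v : Fin n → ℤ) :
    cf (HahnSeries.C r * F) v = r * cf F v := by
  simp [cf]

/-- Taking the coefficient of `x^v` is additive. -/
noncomputable def cfHom (v : Fin n → ℤ) : LaurentSer n R →+ R where
  toFun F := cf F v
  map_zero' := rfl
  map_add' _ _ := rfl

theorem cf_sum {ι : Type*} (s : Finset ι) (f : ι → LaurentSer n R) (v : Fin n → ℤ) :
    cf (∑ i ∈ s, f i) v = ∑ i ∈ s, cf (f i) v :=
  map_sum (cfHom v) f s

theorem cf_zsmul (z : ℤ) (F : LaurentSer n R) (v : Fin n → ℤ) : cf (z • F) v = z • cf F v :=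
  map_zsmul (cfHom v) z F

theorem cf_mono (u v : Fin n → ℤ) : cf (mono u : LaurentSer n R) v = if v = u then 1 else 0 := by
  classical
  simp only [cf, mono, HahnSeries.coeff_single]
  congr 1
  simp

theorem cf_one (v : Fin n → ℤ) : cf (1 : LaurentSer n R) v = if v = 0 then 1 else 0 := by
  rw [← cf_mono]
  simp [mono]

@[simp] theorem mono_zero : (mono 0 : LaurentSer n R) = 1 := by simp [mono]

theorem mono_mul (u v : Fin n → ℤ) : (mono u * mono v : LaurentSer n R) = mono (u + v) := by
  rw [mono, mono, HahnSeries.single_mul_single, one_mul, mono, ← toLex_add, neg_add]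

theorem mono_pow (u : Fin n → ℤ) (k : ℕ) : (mono u ^ k : LaurentSer n R) = mono (k • u) := by
  induction k with
  | zero => simp
  | succ k ih => rw [pow_succ, ih, mono_mul, succ_nsmul]

theorem prod_mono {ι : Type*} (s : Finset ι) (f : ι → Fin n → ℤ) :
    (∏ i ∈ s, mono (f i) : LaurentSer n R) = mono (∑ i ∈ s, f i) := by
  classical
  induction s using Finset.induction_on with
  | empty => simp
  | insert a s ha ih => rw [Finset.prod_insert ha, Finset.sum_insert ha, ih, mono_mul]

theorem cf_mono_mul (u : Fin n → ℤ) (F : LaurentSer n R) (v : Fin n → ℤ) :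
    cf (mono u * F) v = cf F (v - u) := by
  have h : (toLex (-v) : Lex (Fin n → ℤ)) = toLex (-(v - u)) + toLex (-u) := by
    rw [← toLex_add]; congr 1; abel
  rw [cf, mono, h, HahnSeries.coeff_single_mul_add, one_mul, cf]

theorem cf_mul_finsum (F G : LaurentSer n R) (v : Fin n → ℤ) :
    cf (F * G) v = ∑ᶠ u, cf F u * cf G (v - u) := by
  classical
  rw [cf, HahnSeries.coeff_mul]
  let e : Lex (Fin n → ℤ) × Lex (Fin n → ℤ) → (Fin n → ℤ) := fun p => -(ofLex p.1)
  set A := Finset.antidiagonal F.isPWO_support G.isPWO_support (toLex (-v)) with hA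
  have hinj : Set.InjOn e A := by
    rintro ⟨a, b⟩ hp ⟨a', b'⟩ hq h
    simp only [hA, Finset.mem_coe, Finset.mem_antidiagonal] at hp hq
    have h1 : a = a' := by simpa [e] using h
    subst h1
    have : a + b = a + b' := hp.2.2.trans hq.2.2.symm
    simpa using this
  rw [finsum_eq_sum_of_support_subset (s := A.image e), Finset.sum_image hinj]
  · refine Finset.sum_congr rfl ?_
    rintro ⟨a, b⟩ hp
    simp only [hA, Finset.mem_antidiagonal] at hp
    have hb : b = toLex (-v) - a := by rw [← hp.2.2]; abel
    simp only [cf, e, neg_neg, hb]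
    congr 2
    rw [← toLex_ofLex a, ← toLex_sub]
    congr 1
    simp only [ofLex_toLex]
    abel
  · intro u hu
    simp only [Function.mem_support] at hu
    simp only [Finset.coe_image, Set.mem_image, Finset.mem_coe, hA, Finset.mem_antidiagonal]
    refine ⟨(toLex (-u), toLex (-(v - u))), ⟨left_ne_zero_of_mul hu, right_ne_zero_of_mul hu, ?_⟩,
      ?_⟩
    · rw [← toLex_add]; congr 1; abel
    · simp [e]

theorem exists_of_cf_mul_ne_zero {F G : LaurentSer n R} {v : Fin n → ℤ} (h : cf (F * G) v ≠ 0) :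
    ∃ u, cf F u ≠ 0 ∧ cf G (v - u) ≠ 0 := by
  obtain ⟨u, hu⟩ : ∃ u, cf F u * cf G (v - u) ≠ 0 := by
    by_contra! h0
    exact h (by rw [cf_mul_finsum]; exact finsum_eq_zero_of_forall_eq_zero h0)
  exact ⟨u, left_ne_zero_of_mul hu, right_ne_zero_of_mul hu⟩

/-- Every exponent `v` of `F` satisfies `l v ≥ p`. -/
def SuppGE (l : (Fin n → ℤ) →+ ℤ) (p : ℤ) (F : LaurentSer n R) : Prop :=
  ∀ v, cf F v ≠ 0 → p ≤ l v

theorem SuppGE.mul {l : (Fin n → ℤ) →+ ℤ} {p q : ℤ} {F G : LaurentSer n R} (hF : SuppGE l p F)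
    (hG : SuppGE l q G) : SuppGE l (p + q) (F * G) := by
  intro v hv
  obtain ⟨u, h1, h2⟩ := exists_of_cf_mul_ne_zero hv
  have h3 := hF _ h1
  have h4 := hG _ h2
  rw [map_sub] at h4
  linarith

theorem SuppGE.add {l : (Fin n → ℤ) →+ ℤ} {p : ℤ} {F G : LaurentSer n R} (hF : SuppGE l p F)
    (hG : SuppGE l p G) : SuppGE l p (F + G) := by
  intro v hv
  by_contra h
  have h1 : cf F v = 0 := by by_contra h1; exact h (hF v h1)
  have h2 : cf G v = 0 := by by_contra h1; exact h (hG v h1)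
  exact hv (by simp [h1, h2])

theorem SuppGE.neg {l : (Fin n → ℤ) →+ ℤ} {p : ℤ} {F : LaurentSer n R} (hF : SuppGE l p F) :
    SuppGE l p (-F) := fun v hv => hF v (by simpa using hv)

theorem SuppGE.sub {l : (Fin n → ℤ) →+ ℤ} {p : ℤ} {F G : LaurentSer n R} (hF : SuppGE l p F)
    (hG : SuppGE l p G) : SuppGE l p (F - G) := by
  rw [sub_eq_add_neg]; exact hF.add hG.neg

theorem SuppGE.mono_le {l : (Fin n → ℤ) →+ ℤ} {p q : ℤ} {F : LaurentSer n R} (hF : SuppGE l p F)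
    (h : q ≤ p) : SuppGE l q F := fun v hv => h.trans (hF v hv)

theorem SuppGE.C_mul {l : (Fin n → ℤ) →+ ℤ} {p : ℤ} {F : LaurentSer n R} (hF : SuppGE l p F)
    (r : R) : SuppGE l p (HahnSeries.C r * F) := fun v hv =>
  hF v (right_ne_zero_of_mul (cf_C_mul r F v ▸ hv))

theorem suppGE_one (l : (Fin n → ℤ) →+ ℤ) : SuppGE l 0 (1 : LaurentSer n R) := by
  intro v hv
  rw [cf_one] at hv
  have : v = 0 := by by_contra h; simp [h] at hv
  simp [this]

theorem suppGE_mono (l : (Fin n → ℤ) →+ ℤ) (u : Fin n → ℤ) :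
    SuppGE l (l u) (mono u : LaurentSer n R) := by
  intro v hv
  rw [cf_mono] at hv
  have : v = u := by by_contra h; simp [h] at hv
  simp [this]

theorem suppGE_sum {ι : Type*} {l : (Fin n → ℤ) →+ ℤ} {p : ℤ} {s : Finset ι}
    {f : ι → LaurentSer n R} (h : ∀ i ∈ s, SuppGE l p (f i)) : SuppGE l p (∑ i ∈ s, f i) := by
  classical
  induction s using Finset.induction_on with
  | empty => intro v hv; simp at hv
  | insert a s ha ih =>
    rw [Finset.sum_insert ha]
    exact (h a (by simp)).add (ih fun i hi => h i (by simp [hi]))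

theorem suppGE_prod {ι : Type*} {l : (Fin n → ℤ) →+ ℤ} {s : Finset ι}
    {f : ι → LaurentSer n R} (h : ∀ i ∈ s, SuppGE l 0 (f i)) : SuppGE l 0 (∏ i ∈ s, f i) := by
  classical
  induction s using Finset.induction_on with
  | empty => simpa using suppGE_one l
  | insert a s ha ih =>
    rw [Finset.prod_insert ha]
    simpa using (h a (by simp)).mul (ih fun i hi => h i (by simp [hi]))

/-- The series `F` is `1` plus terms whose exponents `v` satisfy `l v ≥ 1`. -/
def OneMod (l : (Fin n → ℤ) →+ ℤ) (F : LaurentSer n R) : Prop := SuppGE l 1 (F - 1)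

theorem OneMod.mul {l : (Fin n → ℤ) →+ ℤ} {F G : LaurentSer n R} (hF : OneMod l F)
    (hG : OneMod l G) : OneMod l (F * G) := by
  have : F * G - 1 = (F - 1) * (G - 1) + (F - 1) + (G - 1) := by ring
  rw [OneMod, this]
  exact (SuppGE.add (((SuppGE.mul hF hG).mono_le (by norm_num)).add hF) hG)

theorem oneMod_prod {ι : Type*} {l : (Fin n → ℤ) →+ ℤ} {s : Finset ι}
    {f : ι → LaurentSer n R} (h : ∀ i ∈ s, OneMod l (f i)) : OneMod l (∏ i ∈ s, f i) := by
  classical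
  induction s using Finset.induction_on with
  | empty => intro v hv; simp at hv
  | insert a s ha ih =>
    rw [Finset.prod_insert ha]
    exact (h a (by simp)).mul (ih fun i hi => h i (by simp [hi]))

/-- If `F` is `1` plus terms of positive level, then multiplication by `F` does not change a
coefficient of `A` at which no term of `A` of smaller level contributes. -/
theorem OneMod.cf_mul {l : (Fin n → ℤ) →+ ℤ} {F A : LaurentSer n R} {v : Fin n → ℤ}
    (hF : OneMod l F) (hA : SuppGE l (l v) A) : cf (A * F) v = cf A v := by
  have h : A * F = A + A * (F - 1) := by ring
  rw [h, cf_add, add_eq_left]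
  by_contra h
  have := (hA.mul hF) v h
  linarith

/-- The coefficients of `F'` are those of `F` with exponents permuted by `s`. -/
def PermRel (s : Equiv.Perm (Fin n)) (F F' : LaurentSer n R) : Prop :=
  ∀ v, cf F' (v ∘ s) = cf F v

/-- Precomposition with a permutation, as a permutation of the exponents. -/
def compPerm (s : Equiv.Perm (Fin n)) : (Fin n → ℤ) ≃ (Fin n → ℤ) where
  toFun v := v ∘ s
  invFun v := v ∘ s.symm
  left_inv v := by funext i; simp
  right_inv v := by funext i; simp

theorem PermRel.mul {s : Equiv.Perm (Fin n)} {F F' G G' : LaurentSer n R} (hF : PermRel s F F')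
    (hG : PermRel s G G') : PermRel s (F * G) (F' * G') := by
  intro v
  rw [cf_mul_finsum, cf_mul_finsum, ← finsum_comp_equiv (compPerm s)]
  refine finsum_congr fun u => ?_
  rw [← hF u, ← hG (v - u)]
  rfl

theorem permRel_one (s : Equiv.Perm (Fin n)) : PermRel s (1 : LaurentSer n R) 1 := by
  intro v
  have : v ∘ s = 0 ↔ v = 0 := by
    constructor
    · intro h; funext i; simpa using congrFun h (s.symm i)
    · rintro rfl; rfl
  rw [cf_one, cf_one]
  simp [this]

theorem permRel_prod {ι : Type*} {s : Equiv.Perm (Fin n)} {A : Finset ι}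
    {f g : ι → LaurentSer n R} (h : ∀ i ∈ A, PermRel s (f i) (g i)) :
    PermRel s (∏ i ∈ A, f i) (∏ i ∈ A, g i) := by
  classical
  induction A using Finset.induction_on with
  | empty => simpa using permRel_one s
  | insert a A ha ih =>
    rw [Finset.prod_insert ha, Finset.prod_insert ha]
    exact (h a (by simp)).mul (ih fun i hi => h i (by simp [hi]))

end Basic

/-! ### The coefficients of Schur functions in the Hall–Littlewood basis -/

section Kostant

variable {n : ℕ} {R : Type*} [CommRing R]

/-- The exponent `e_j - e_i` of `x_j / x_i`. -/
def root (i j : Fin n) : Fin n → ℤ := Pi.single j 1 - Pi.single i 1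

theorem toLex_neg_root_pos {i j : Fin n} (h : i < j) : 0 < toLex (-(root i j)) := by
  refine ⟨i, fun a ha => ?_, ?_⟩
  · have h1 : a ≠ i := ha.ne
    have h2 : a ≠ j := (ha.trans h).ne
    change 0 = (-(root i j)) a
    simp [root, h1, h2]
  · change 0 < (-(root i j)) i
    simp [root, h.ne]

theorem root_comp_perm (i j : Fin n) (s : Equiv.Perm (Fin n)) :
    root i j ∘ s = root (s.symm i) (s.symm j) := by
  funext x
  simp [root, Pi.single_apply, Equiv.eq_symm_apply]

/-- The geometric series `∑ t^k (x_j / x_i)^k`, for `i < j`. For other pairs, where the series does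
not exist in the chosen expansion, the value is `1`. -/
noncomputable def geo (t : R) (i j : Fin n) : LaurentSer n R :=
  if h : i < j then
    HahnSeries.embDomainRingHom (multiplesHom _ (toLex (-(root i j))))
      (nsmul_left_strictMono (toLex_neg_root_pos h)).injective
      (fun _ _ => (nsmul_left_strictMono (toLex_neg_root_pos h)).le_iff_le)
      (HahnSeries.toPowerSeries.symm (PowerSeries.mk fun k => t ^ k))
  else 1

theorem cf_geo_nsmul (t : R) {i j : Fin n} (h : i < j) (k : ℕ) :
    cf (geo t i j) (k • root i j) = t ^ k := by
  rw [geo, dif_pos h, cf]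
  have : toLex (-(k • root i j)) = multiplesHom _ (toLex (-(root i j))) k := by
    rw [multiplesHom_apply, ← smul_neg]; rfl
  rw [this]
  refine (HahnSeries.embDomain_coeff (f := ⟨⟨_, _⟩, _⟩)).trans ?_
  simp

theorem exists_of_cf_geo_ne_zero {t : R} {i j : Fin n} (h : i < j) {v : Fin n → ℤ}
    (hv : cf (geo t i j) v ≠ 0) : ∃ k : ℕ, v = k • root i j := by
  by_contra! h0
  refine hv ?_
  rw [geo, dif_pos h, cf]
  refine HahnSeries.embDomain_of_notMem_range (f := ⟨⟨_, _⟩, _⟩) ?_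
  rintro ⟨k, hk⟩
  refine h0 k ?_
  change k • toLex (-(root i j)) = toLex (-v) at hk
  have h1 : k • (-(root i j)) = -v := hk
  rw [smul_neg, neg_inj] at h1
  exact h1.symm

theorem mul_geo (t : R) {i j : Fin n} (h : i < j) :
    (1 - HahnSeries.C t * mono (root i j)) * geo t i j = 1 := by
  have hps : (1 - PowerSeries.C t * PowerSeries.X) * (PowerSeries.mk fun k => t ^ k) = 1 := by
    ext k
    rw [sub_mul, one_mul, mul_assoc, map_sub, PowerSeries.coeff_C_mul, PowerSeries.coeff_mk]
    cases k with
    | zero => simp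
    | succ k => simp [PowerSeries.coeff_succ_X_mul, pow_succ', PowerSeries.coeff_one]
  rw [geo, dif_pos h]
  set f := HahnSeries.embDomainRingHom (R := R) (multiplesHom _ (toLex (-(root i j))))
      (nsmul_left_strictMono (toLex_neg_root_pos h)).injective
      (fun _ _ => (nsmul_left_strictMono (toLex_neg_root_pos h)).le_iff_le) with hf
  have h1 : f (HahnSeries.toPowerSeries.symm (PowerSeries.C t * PowerSeries.X)) =
      HahnSeries.C t * mono (root i j) := by
    have e1 : HahnSeries.toPowerSeries.symm (PowerSeries.C t * PowerSeries.X) =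
        HahnSeries.single 1 t := by
      ext k
      rw [HahnSeries.coeff_toPowerSeries_symm, PowerSeries.coeff_C_mul, PowerSeries.coeff_X,
        HahnSeries.coeff_single]
      split_ifs <;> simp
    rw [e1, hf]
    refine (HahnSeries.embDomain_single (f := ⟨⟨_, _⟩, _⟩)).trans ?_
    rw [HahnSeries.C_apply, mono, HahnSeries.single_mul_single]
    simp
  rw [← h1, ← map_one f, ← map_one HahnSeries.toPowerSeries.symm, ← map_sub, ← map_sub, ← map_mul,
    ← map_mul, hps]

theorem suppGE_geo (t : R) {i j : Fin n} (h : i < j) {l : (Fin n → ℤ) →+ ℤ}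
    (hl : 0 ≤ l (root i j)) : SuppGE l 0 (geo t i j) := by
  intro v hv
  obtain ⟨k, rfl⟩ := exists_of_cf_geo_ne_zero h hv
  rw [map_nsmul]
  exact nsmul_nonneg hl k

theorem oneMod_geo (t : R) {i j : Fin n} (h : i < j) {l : (Fin n → ℤ) →+ ℤ}
    (hl : 1 ≤ l (root i j)) : OneMod l (geo t i j) := by
  have h1 : geo t i j - 1 = HahnSeries.C t * (mono (root i j) * geo t i j) := by
    have := mul_geo t h
    linear_combination this
  rw [OneMod, h1]
  refine SuppGE.C_mul (SuppGE.mono_le ?_ hl) t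
  simpa using (suppGE_mono l (root i j)).mul (suppGE_geo t h (by omega))

theorem permRel_geo (t : R) {i j : Fin n} {s : Equiv.Perm (Fin n)} (h : i < j)
    (h' : s.symm i < s.symm j) : PermRel s (geo t i j) (geo t (s.symm i) (s.symm j)) := by
  intro v
  by_cases hv : ∃ k : ℕ, v = k • root i j
  · obtain ⟨k, rfl⟩ := hv
    have : (k • root i j) ∘ s = k • root (s.symm i) (s.symm j) := by
      rw [← root_comp_perm]; rfl
    rw [this, cf_geo_nsmul t h', cf_geo_nsmul t h]
  · have h1 : cf (geo t i j) v = 0 := by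
      by_contra h0; exact hv (exists_of_cf_geo_ne_zero h h0)
    rw [h1]
    by_contra h0
    obtain ⟨k, hk⟩ := exists_of_cf_geo_ne_zero h' h0
    refine hv ⟨k, (compPerm s).injective ?_⟩
    change v ∘ s = (k • root i j) ∘ s
    rw [hk, ← root_comp_perm]; rfl

/-- The set of pairs `i < j`. -/
def posPairs (n : ℕ) : Finset (Fin n × Fin n) := {p | p.1 < p.2}

@[simp] theorem mem_posPairs {p : Fin n × Fin n} : p ∈ posPairs n ↔ p.1 < p.2 := by
  simp [posPairs]

/-- The product of all `1 / (1 - t x_j / x_i)` with `i < j`. -/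
noncomputable def kostantSeries (n : ℕ) (t : R) : LaurentSer n R :=
  ∏ p ∈ posPairs n, geo t p.1 p.2

/-- The alternant `det (x_i ^ β_j)`. -/
noncomputable def alt (β : Fin n → ℤ) : LaurentSer n R :=
  (Matrix.of fun i j : Fin n => (mono (Pi.single i (β j)) : LaurentSer n R)).det

theorem alt_eq_sum (β : Fin n → ℤ) :
    (alt β : LaurentSer n R) =
      ∑ σ : Equiv.Perm (Fin n), (Equiv.Perm.sign σ : ℤ) • mono (β ∘ σ) := by
  rw [alt, ← Matrix.det_transpose, Matrix.det_apply]
  refine Finset.sum_congr rfl fun σ _ => ?_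
  rw [Units.smul_def]
  congr 1
  simp only [Matrix.transpose_apply, Matrix.of_apply]
  rw [prod_mono]
  congr 1
  funext x
  simp [Finset.sum_apply, Pi.single_apply]

theorem alt_comp_perm (β : Fin n → ℤ) (s : Equiv.Perm (Fin n)) :
    (alt (β ∘ s) : LaurentSer n R) = (Equiv.Perm.sign s : ℤ) • alt β := by
  rw [alt, alt]
  have := Matrix.det_permute' s
    (Matrix.of fun i j : Fin n => (mono (Pi.single i (β j)) : LaurentSer n R))
  rw [zsmul_eq_mul]
  exact_mod_cast this

theorem cf_alt_comp_perm (β v : Fin n → ℤ) (s : Equiv.Perm (Fin n)) :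
    cf (alt β : LaurentSer n R) (v ∘ s) = (Equiv.Perm.sign s : ℤ) • cf (alt β) v := by
  rw [alt_eq_sum, cf_sum, cf_sum, Finset.smul_sum, ← Equiv.sum_comp (Equiv.mulRight s)]
  refine Finset.sum_congr rfl fun σ _ => ?_
  rw [cf_zsmul, cf_zsmul, smul_smul, cf_mono, cf_mono]
  have h1 : v ∘ s = β ∘ (Equiv.mulRight s) σ ↔ v = β ∘ σ := by
    constructor
    · intro h; funext i; simpa using congrFun h (s.symm i)
    · rintro rfl; rfl
  rw [if_congr h1 rfl rfl, Equiv.coe_mulRight, map_mul, Units.val_mul, mul_comm]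

theorem exists_of_cf_alt_ne_zero {β v : Fin n → ℤ} (h : cf (alt β : LaurentSer n R) v ≠ 0) :
    ∃ σ : Equiv.Perm (Fin n), v = β ∘ σ := by
  by_contra! h0
  refine h ?_
  rw [alt_eq_sum, cf_sum]
  refine Finset.sum_eq_zero fun σ _ => ?_
  rw [cf_zsmul, cf_mono, if_neg (h0 σ), smul_zero]

/-- The coefficient of `x^α` in `det (x_i ^ β_j) ∏_{i < j} (1 - t x_j / x_i)⁻¹`. With
`δ = (n - 1, …, 1, 0)`, this is `K_{μ, λ}(t)` for `β = μ + δ` and `α = λ + δ`. -/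
noncomputable def kos (t : R) (β α : Fin n → ℤ) : R := cf (alt β * kostantSeries n t) α

theorem kos_comp_perm (t : R) (β α : Fin n → ℤ) (s : Equiv.Perm (Fin n)) :
    kos t (β ∘ s) α = (Equiv.Perm.sign s : ℤ) • kos t β α := by
  rw [kos, alt_comp_perm, smul_mul_assoc, cf_zsmul, kos]

theorem kos_eq_zero_of_eq (t : R) {β : Fin n → ℤ} {i j : Fin n} (hij : i ≠ j) (h : β i = β j)
    (α : Fin n → ℤ) : kos t β α = 0 := by
  have : (alt β : LaurentSer n R) = 0 :=
    Matrix.det_zero_of_column_eq hij (fun k => by simp [h])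
  simp [kos, this]

/-- Multiplying by the power sum `p_r` raises one of the exponents `β_j`, or equivalently lowers
one of the exponents `α_i` at which the coefficient is taken. -/
theorem sum_kos_add_single (t : R) (β α : Fin n → ℤ) (r : ℤ) :
    ∑ j, kos t (β + Pi.single j r) α = ∑ i, kos t β (α - Pi.single i r) := by
  have h : (∑ j, alt (β + Pi.single j r) : LaurentSer n R) =
      ∑ i, mono (Pi.single i r) * alt β := by
    simp only [alt_eq_sum, Finset.mul_sum]
    rw [Finset.sum_comm, Finset.sum_comm (s := Finset.univ (α := Fin n))]
    refine Finset.sum_congr rfl fun σ _ => ?_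
    rw [← Equiv.sum_comp σ]
    refine Finset.sum_congr rfl fun i _ => ?_
    rw [mul_smul_comm, mono_mul]
    congr 2
    funext x
    simp [Pi.single_apply, add_comm]
  have h2 : ∀ i : Fin n, kos t β (α - Pi.single i r) =
      cf (mono (Pi.single i r) * alt β * kostantSeries n t) α := fun i => by
    rw [mul_assoc, cf_mono_mul, kos]
  rw [Finset.sum_congr rfl fun i _ => h2 i]
  simp only [kos, ← cf_sum, ← Finset.sum_mul, h]

/-- The straightening relation for adjacent exponents `i`, `j = i + 1`: the series
`∏ 1 / (1 - t x_b / x_a)` without the factor for `x_j / x_i` is invariant under exchanging `x_i` and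
`x_j`. -/
theorem kos_straighten (t : R) (β α : Fin n → ℤ) {i j : Fin n} (hij : (i : ℕ) + 1 = j) :
    kos t β α - t * kos t β (α - root i j) +
      (kos t β (α ∘ Equiv.swap i j) - t * kos t β (α ∘ Equiv.swap i j - root i j)) = 0 := by
  set s := Equiv.swap i j with hs
  have hlt : i < j := by rw [Fin.lt_def]; omega
  set A := (posPairs n).erase (i, j) with hA
  set G : LaurentSer n R := ∏ p ∈ A, geo t p.1 p.2 with hG
  have hss : s.symm = s := Equiv.symm_swap i j
  have hs_lt : ∀ p ∈ A, s p.1 < s p.2 := by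
    -- The simple transposition `s` inverts only the pair `(i, j)`.
    rintro ⟨a, b⟩ hp
    simp only [hA, Finset.mem_erase, mem_posPairs, ne_eq, Prod.mk.injEq] at hp
    simp only [hs, Equiv.swap_apply_def, Fin.lt_def, Fin.ext_iff] at hp ⊢
    rw [Fin.lt_def] at hlt
    split_ifs <;> omega
  have hsA : ∀ p ∈ A, (s p.1, s p.2) ∈ A := by
    rintro ⟨a, b⟩ hp
    have h1 := hs_lt _ hp
    simp only [hA, Finset.mem_erase, mem_posPairs, ne_eq, Prod.mk.injEq] at hp ⊢
    refine ⟨fun h => ?_, h1⟩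
    have ha : a = j := by
      rw [← Equiv.symm_apply_apply s a, h.1, hss, hs, Equiv.swap_apply_left]
    have hb : b = i := by
      rw [← Equiv.symm_apply_apply s b, h.2, hss, hs, Equiv.swap_apply_right]
    subst ha hb
    exact absurd hp.2 hlt.asymm
  have hGG : PermRel s G G := by
    have h1 : PermRel s (∏ p ∈ A, geo t p.1 p.2) (∏ p ∈ A, geo t (s.symm p.1) (s.symm p.2)) :=
      permRel_prod fun p hp => permRel_geo t (mem_posPairs.1 (Finset.mem_of_mem_erase hp))
        (by rw [hss]; exact hs_lt p hp)
    have h2 : ∏ p ∈ A, geo t (s.symm p.1) (s.symm p.2) = (G : LaurentSer n R) := by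
      rw [hss]
      refine Finset.prod_bij' (fun p _ => (s p.1, s p.2)) (fun p _ => (s p.1, s p.2)) hsA hsA
        ?_ ?_ ?_ <;> intros <;> simp [hs]
    rwa [h2] at h1
  have halt : PermRel s (alt β : LaurentSer n R) (-alt β) := by
    intro v
    rw [cf_neg, cf_alt_comp_perm, hs, Equiv.Perm.sign_swap hlt.ne]
    simp
  have hprod := halt.mul hGG
  have hK : ∀ a, cf (alt β * G) a = kos t β a - t * kos t β (a - root i j) := by
    intro a
    have hG' : kostantSeries n t = geo t i j * G :=
      (Finset.mul_prod_erase (posPairs n) (fun p => geo t p.1 p.2)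
        (mem_posPairs.2 hlt : (i, j) ∈ posPairs n)).symm
    have : alt β * G = alt β * kostantSeries n t -
        HahnSeries.C t * (mono (root i j) * (alt β * kostantSeries n t)) := by
      rw [hG']
      linear_combination (-(alt β * G)) * mul_geo t hlt
    rw [this, cf_sub, cf_C_mul, cf_mono_mul, kos, kos]
  rw [← hK, ← hK]
  have := hprod α
  rw [neg_mul, cf_neg] at this
  rw [← this]; ring

theorem suppGE_kostantSeries (t : R) {l : (Fin n → ℤ) →+ ℤ}
    (hl : ∀ i j : Fin n, i < j → 0 ≤ l (root i j)) : SuppGE l 0 (kostantSeries n t) :=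
  suppGE_prod fun _ hp => suppGE_geo t (mem_posPairs.1 hp) (hl _ _ (mem_posPairs.1 hp))

theorem suppGE_alt {l : (Fin n → ℤ) →+ ℤ} {p : ℤ} {β : Fin n → ℤ}
    (h : ∀ σ : Equiv.Perm (Fin n), p ≤ l (β ∘ σ)) : SuppGE l p (alt β : LaurentSer n R) := by
  intro v hv
  obtain ⟨σ, rfl⟩ := exists_of_cf_alt_ne_zero hv
  exact h σ

/-- The coordinate functional. -/
def coordHom (i : Fin n) : (Fin n → ℤ) →+ ℤ := Pi.evalAddMonoidHom (fun _ => ℤ) i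

@[simp] theorem coordHom_apply (i : Fin n) (v : Fin n → ℤ) : coordHom i v = v i := rfl

/-- The pairing with a vector. -/
def pairHom (w : Fin n → ℤ) : (Fin n → ℤ) →+ ℤ :=
  ∑ i, (AddMonoidHom.mulLeft (w i)).comp (coordHom i)

@[simp] theorem pairHom_apply (w v : Fin n → ℤ) : pairHom w v = ∑ i, w i * v i := by
  simp [pairHom, AddMonoidHom.finsetSum_apply]

theorem pairHom_root (w : Fin n → ℤ) (i j : Fin n) : pairHom w (root i j) = w j - w i := by
  simp [root, Pi.single_apply, mul_sub, Finset.sum_sub_distrib]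

/-- An exponent of the last variable in the alternant is some `β_j ≥ 0`, and the Kostant series
contains this variable only with nonnegative exponents. -/
theorem kos_eq_zero_of_last_neg (t : R) {β α : Fin n → ℤ} (hβ : ∀ i, 0 ≤ β i) {i : Fin n}
    (hi : ∀ j, j ≤ i) (hα : α i < 0) : kos t β α = 0 := by
  by_contra h
  have h1 : SuppGE (coordHom i) 0 (alt β : LaurentSer n R) := suppGE_alt fun σ => hβ _
  have h2 : SuppGE (coordHom i) 0 (kostantSeries n t) := suppGE_kostantSeries t fun a b hab => by
    have : a ≠ i := (hab.trans_le (hi b)).ne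
    simp only [root, coordHom_apply, Pi.sub_apply, Pi.single_apply, this.symm, if_false]
    split_ifs <;> simp
  have := (h1.mul h2) α h
  simp only [coordHom_apply] at this
  omega

theorem kos_eq_zero_of_sum_ne (t : R) {β α : Fin n → ℤ} (h : ∑ i, β i ≠ ∑ i, α i) :
    kos t β α = 0 := by
  by_contra h0
  have key : ∀ c : ℤ, c * ∑ i, β i ≤ c * ∑ i, α i := by
    intro c
    have h1 : SuppGE (pairHom fun _ => c) (c * ∑ i, β i) (alt β : LaurentSer n R) :=
      suppGE_alt fun σ => by
        rw [pairHom_apply, ← Finset.mul_sum]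
        simp [Equiv.sum_comp σ β]
    have h2 : SuppGE (pairHom fun _ => c) 0 (kostantSeries n t) :=
      suppGE_kostantSeries t fun a b _ => by rw [pairHom_root]; simp
    have := (h1.mul h2) α h0
    simpa [← Finset.mul_sum] using this
  have h1 := key 1
  have h2 := key (-1)
  exact h (by linarith)

end Kostant

/-! ### Independence of the number of variables -/

section Stability

variable {n : ℕ} {R : Type*} [CommRing R]

/-- Extension of an exponent vector by a zero. -/
def extendZero (n : ℕ) : Lex (Fin n → ℤ) →+ Lex (Fin (n + 1) → ℤ) where
  toFun v := toLex (Fin.snoc (α := fun _ => ℤ) (ofLex v) 0)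
  map_zero' := by
    change Fin.snoc (α := fun _ => ℤ) 0 0 = (0 : Fin (n + 1) → ℤ)
    funext i
    induction i using Fin.lastCases <;> simp
  map_add' u v := by
    change Fin.snoc (α := fun _ => ℤ) (ofLex u + ofLex v) 0 =
      Fin.snoc (α := fun _ => ℤ) (ofLex u) 0 + Fin.snoc (α := fun _ => ℤ) (ofLex v) 0
    funext i
    induction i using Fin.lastCases <;> simp

theorem extendZero_strictMono (n : ℕ) : StrictMono (extendZero n) := by
  rintro u v ⟨i, h1, h2⟩
  refine ⟨i.castSucc, fun j hj => ?_, ?_⟩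
  · change (Fin.snoc (α := fun _ => ℤ) (ofLex u) 0 : Fin (n + 1) → ℤ) j =
      (Fin.snoc (α := fun _ => ℤ) (ofLex v) 0 : Fin (n + 1) → ℤ) j
    induction j using Fin.lastCases with
    | last => simp
    | cast j => simpa using h1 j (by simpa using hj)
  · change (Fin.snoc (α := fun _ => ℤ) (ofLex u) 0 : Fin (n + 1) → ℤ) i.castSucc <
      (Fin.snoc (α := fun _ => ℤ) (ofLex v) 0 : Fin (n + 1) → ℤ) i.castSucc
    simpa using h2

/-- Series in `n` variables as series in `n + 1` variables. -/
noncomputable def emb : LaurentSer n R →+* LaurentSer (n + 1) R :=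
  HahnSeries.embDomainRingHom (extendZero n) (extendZero_strictMono n).injective
    (fun _ _ => (extendZero_strictMono n).le_iff_le)

theorem cf_emb (F : LaurentSer n R) {v : Fin (n + 1) → ℤ} (hv : v (Fin.last n) = 0) :
    cf (emb F) v = cf F (v ∘ Fin.castSucc) := by
  rw [cf, emb, cf]
  have : toLex (-v) = extendZero n (toLex (-(v ∘ Fin.castSucc))) := by
    change -v = Fin.snoc (α := fun _ => ℤ) (-(v ∘ Fin.castSucc)) 0
    funext i
    induction i using Fin.lastCases <;> simp [hv]
  rw [this]
  exact HahnSeries.embDomain_coeff (f := ⟨⟨_, _⟩, _⟩)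

theorem cf_emb_of_ne (F : LaurentSer n R) {v : Fin (n + 1) → ℤ} (hv : v (Fin.last n) ≠ 0) :
    cf (emb F) v = 0 := by
  rw [cf, emb]
  refine HahnSeries.embDomain_of_notMem_range (f := ⟨⟨_, _⟩, _⟩) ?_
  rintro ⟨u, hu⟩
  have h1 : Fin.snoc (α := fun _ => ℤ) (ofLex u) 0 = -v := hu
  have := congrFun h1 (Fin.last n)
  simp at this
  exact hv this

theorem emb_mono (u : Fin (n + 1) → ℤ) (hu : u (Fin.last n) = 0) :
    emb (mono (u ∘ Fin.castSucc) : LaurentSer n R) = mono u := by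
  refine cf_ext fun v => ?_
  rw [cf_mono]
  by_cases hv : v (Fin.last n) = 0
  · rw [cf_emb _ hv, cf_mono]
    congr 1
    rw [eq_iff_iff]
    constructor
    · intro h
      funext i
      induction i using Fin.lastCases with
      | last => rw [hv, hu]
      | cast i => exact congrFun h i
    · rintro rfl; rfl
  · rw [cf_emb_of_ne _ hv, if_neg]
    rintro rfl
    exact hv hu

theorem emb_C (r : R) : emb (HahnSeries.C r : LaurentSer n R) = HahnSeries.C r :=
  HahnSeries.embDomainRingHom_C

theorem emb_geo (t : R) (i j : Fin n) : emb (geo t i j) = geo t i.castSucc j.castSucc := by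
  by_cases h : i < j
  · have h' : i.castSucc < j.castSucc := by simpa using h
    have hr : emb (mono (root i j) : LaurentSer n R) = mono (root i.castSucc j.castSucc) := by
      rw [← emb_mono]
      · congr 2
        funext x
        simp [root, Pi.single_apply]
      · simp [root, (Fin.castSucc_lt_last i).ne', (Fin.castSucc_lt_last j).ne']
    have h1 := congrArg emb (mul_geo t h)
    rw [map_mul, map_sub, map_one, map_mul, emb_C, hr] at h1
    have h2 := mul_geo t h'
    linear_combination emb (geo t i j) * (-h2) + geo t i.castSucc j.castSucc * h1
  · have h' : ¬ i.castSucc < j.castSucc := by simpa using h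
    rw [geo, dif_neg h, geo, dif_neg h', map_one]

theorem kostantSeries_eq_prod (n : ℕ) (t : R) :
    kostantSeries n t = ∏ i, ∏ j, geo t i j := by
  rw [← Fintype.prod_prod_type', kostantSeries]
  refine Finset.prod_subset (Finset.subset_univ _) fun p _ hp => ?_
  rw [mem_posPairs] at hp
  rw [geo, dif_neg hp]

theorem exists_kostantSeries_succ (n : ℕ) (t : R) : ∃ U : LaurentSer (n + 1) R,
    OneMod (coordHom (Fin.last n)) U ∧ kostantSeries (n + 1) t = emb (kostantSeries n t) * U := by
  refine ⟨∏ i : Fin n, geo t i.castSucc (Fin.last n), oneMod_prod fun i _ =>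
    oneMod_geo t (Fin.castSucc_lt_last i) ?_, ?_⟩
  · simp [root, (Fin.castSucc_lt_last i).ne']
  · rw [kostantSeries_eq_prod, kostantSeries_eq_prod, Fin.prod_univ_castSucc]
    have h : ∏ j, geo t (Fin.last n) j = (1 : LaurentSer (n + 1) R) :=
      Finset.prod_eq_one fun j _ => by rw [geo, dif_neg (not_lt.2 (Fin.le_last j))]
    rw [h, mul_one, map_prod, ← Finset.prod_mul_distrib]
    refine Finset.prod_congr rfl fun i _ => ?_
    rw [Fin.prod_univ_castSucc, map_prod]
    simp only [emb_geo]

theorem suppGE_det {m : ℕ} {l : (Fin n → ℤ) →+ ℤ} {M : Matrix (Fin m) (Fin m) (LaurentSer n R)}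
    (h : ∀ i j, SuppGE l 0 (M i j)) : SuppGE l 0 M.det := by
  rw [Matrix.det_apply]
  refine suppGE_sum fun σ _ => ?_
  intro v hv
  rw [Units.smul_def, cf_zsmul] at hv
  exact suppGE_prod (fun i _ => h (σ i) i) v (right_ne_zero_of_smul hv)

/-- Modulo terms divisible by the last variable, the alternant of a vector ending in `0` is the
alternant in one variable less: expand the determinant along its last row. -/
theorem exists_alt_succ {β : Fin (n + 1) → ℤ} (h0 : β (Fin.last n) = 0)
    (h1 : ∀ i : Fin n, 1 ≤ β i.castSucc) : ∃ E : LaurentSer (n + 1) R,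
    SuppGE (coordHom (Fin.last n)) 1 E ∧ alt β = E + emb (alt (β ∘ Fin.castSucc)) := by
  rw [alt, Matrix.det_succ_row _ (Fin.last n), Fin.sum_univ_castSucc]
  refine ⟨_, ?_, congrArg₂ _ rfl ?_⟩
  · refine suppGE_sum fun j _ => ?_
    have e1 : SuppGE (coordHom (Fin.last n)) 1 (Matrix.of (fun i j : Fin (n + 1) =>
        (mono (Pi.single i (β j)) : LaurentSer (n + 1) R)) (Fin.last n) j.castSucc) :=
      (suppGE_mono _ _).mono_le (by simpa using h1 j)
    have e2 : SuppGE (coordHom (Fin.last n)) 0 ((Matrix.of fun i j : Fin (n + 1) =>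
        (mono (Pi.single i (β j)) : LaurentSer (n + 1) R)).submatrix
          (Fin.last n).succAbove j.castSucc.succAbove).det :=
      suppGE_det fun a b => (suppGE_mono _ _).mono_le (by
        simp [(Fin.castSucc_lt_last a).ne])
    have e3 := e1.mul e2
    rw [mul_assoc]
    rcases neg_one_pow_eq_or (LaurentSer (n + 1) R) ((Fin.last n : ℕ) + (j.castSucc : ℕ)) with h | h
    · rw [h, one_mul]; simpa using e3
    · rw [h, neg_one_mul]; simpa using e3.neg
  · rw [alt, RingHom.map_det]
    have : ((-1 : LaurentSer (n + 1) R)) ^ ((Fin.last n : ℕ) + (Fin.last n : ℕ)) = 1 :=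
      Even.neg_one_pow ⟨_, rfl⟩
    rw [this, one_mul, Matrix.of_apply, h0, Pi.single_zero, mono_zero, one_mul]
    congr 1
    ext1 i j
    simp only [Matrix.submatrix_apply, Matrix.of_apply, Fin.succAbove_last, RingHom.mapMatrix_apply,
      Matrix.map_apply, Function.comp_apply]
    rw [← emb_mono _ (by simp [(Fin.castSucc_lt_last i).ne'])]
    congr 2
    funext x
    simp [Pi.single_apply]

theorem kos_succ (t : R) {β α : Fin (n + 1) → ℤ} (h0 : β (Fin.last n) = 0)
    (h1 : ∀ i : Fin n, 1 ≤ β i.castSucc) (hα : α (Fin.last n) = 0) :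
    kos t β α = kos t (β ∘ Fin.castSucc) (α ∘ Fin.castSucc) := by
  obtain ⟨E, hE, hEβ⟩ := exists_alt_succ (R := R) h0 h1
  obtain ⟨U, hU, hUK⟩ := exists_kostantSeries_succ (R := R) n t
  have hemb : ∀ F : LaurentSer n R, SuppGE (coordHom (Fin.last n)) 0 (emb F) := by
    intro F v hv
    by_contra h
    exact hv (cf_emb_of_ne F (by intro h'; exact h h'.ge))
  have hUs : SuppGE (coordHom (Fin.last n)) 0 U := by
    have := (SuppGE.mono_le hU (zero_le_one)).add (suppGE_one _)
    simpa using this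
  have e : alt β * kostantSeries (n + 1) t =
      E * (emb (kostantSeries n t) * U) + emb (alt (β ∘ Fin.castSucc) * kostantSeries n t) * U := by
    rw [hEβ, hUK, map_mul]; ring
  rw [kos, e, cf_add, hU.cf_mul (by rw [coordHom_apply, hα]; exact hemb _), cf_emb _ hα,
    kos, add_eq_right]
  by_contra h
  have := hE.mul ((hemb _).mul hUs) α h
  simp [hα] at this

/-- Multiplying the alternant by a power of `x_1 ⋯ x_n` shifts all exponents. -/
theorem kos_add_const (t : R) (β α : Fin n → ℤ) (c : ℤ) :
    kos t (fun i => β i + c) (fun i => α i + c) = kos t β α := by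
  have : (alt (fun i => β i + c) : LaurentSer n R) = mono (fun _ => c) * alt β := by
    rw [alt_eq_sum, alt_eq_sum, Finset.mul_sum]
    refine Finset.sum_congr rfl fun σ _ => ?_
    rw [mul_smul_comm, mono_mul]
    congr 2
    funext i
    simp [add_comm]
  rw [kos, this, mul_assoc, cf_mono_mul, kos]
  congr 1
  funext i
  simp

/-- The row lengths of `lam`, as a vector of length `n`, plus `δ = (n - 1, …, 1, 0)`. -/
def shifted (n : ℕ) (lam : YoungDiagram) (i : Fin n) : ℤ :=
  (lam.rowLen i : ℤ) + ((n - 1 - (i : ℕ) : ℕ) : ℤ)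

theorem rowLen_eq_zero_of_colLen_le {lam : YoungDiagram} {i : ℕ} (h : lam.colLen 0 ≤ i) :
    lam.rowLen i = 0 := by
  by_contra h0
  have : (i, 0) ∈ lam := YoungDiagram.mem_iff_lt_rowLen.2 (Nat.pos_of_ne_zero h0)
  exact absurd (YoungDiagram.mem_iff_lt_colLen.1 this) (not_lt.2 h)

theorem colLen_zero_le_card (lam : YoungDiagram) : lam.colLen 0 ≤ lam.card := by
  rw [YoungDiagram.colLen_eq_card]
  exact Finset.card_le_card (Finset.filter_subset _ _)

theorem kos_shifted_succ (t : R) {mu lam : YoungDiagram} (hmu : mu.colLen 0 ≤ n)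
    (hlam : lam.colLen 0 ≤ n) :
    kos t (shifted (n + 1) mu) (shifted (n + 1) lam) = kos t (shifted n mu) (shifted n lam) := by
  have h : ∀ nu : YoungDiagram, shifted (n + 1) nu ∘ Fin.castSucc = fun i =>
      shifted n nu i + 1 := by
    intro nu
    funext i
    have := i.2
    simp only [Function.comp_apply, shifted, Fin.val_castSucc]
    omega
  rw [kos_succ, h, h, kos_add_const]
  · simp [shifted, rowLen_eq_zero_of_colLen_le hmu]
  · intro i
    have := congrFun (h mu) i
    rw [Function.comp_apply] at this
    rw [this, shifted]
    omega
  · simp [shifted, rowLen_eq_zero_of_colLen_le hlam]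

theorem kos_shifted_stable (t : R) {mu lam : YoungDiagram} {m : ℕ} (hmu : mu.colLen 0 ≤ m)
    (hlam : lam.colLen 0 ≤ m) (hn : m ≤ n) :
    kos t (shifted n mu) (shifted n lam) = kos t (shifted m mu) (shifted m lam) := by
  induction n, hn using Nat.le_induction with
  | base => rfl
  | succ n hn ih => rw [kos_shifted_succ t (hmu.trans hn) (hlam.trans hn), ih]

end Stability

/-! ### Clearing denominators in Schur and Hall–Littlewood polynomials -/

section Polynomials

variable {n : ℕ}

/-- The inclusion of polynomials into rational functions. -/
noncomputable abbrev toRat (n : ℕ) : MvPolynomial (Fin n) ℤ[X] →+* RatFun n :=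
  algebraMap (MvPolynomial (Fin n) ℤ[X]) (RatFun n)

/-- The inclusion of polynomials into formal series. -/
noncomputable def toSer (n : ℕ) : MvPolynomial (Fin n) ℤ[X] →+* LaurentSer n ℤ[X] :=
  MvPolynomial.eval₂Hom HahnSeries.C fun i => mono (Pi.single i 1)

theorem toRat_injective (n : ℕ) : Function.Injective (toRat n) :=
  IsFractionRing.injective _ _

/-- The numerator `det (x_i ^ (mu_j + n - j))` of a Schur polynomial. -/
noncomputable def schurNum (n : ℕ) (mu : YoungDiagram) : MvPolynomial (Fin n) ℤ[X] :=
  (Matrix.of fun i j : Fin n => MvPolynomial.X i ^ (mu.rowLen j + (n - 1 - (j : ℕ)))).det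

/-- The Vandermonde product `∏_{i < j} (x_i - x_j)`. -/
noncomputable def vdm (n : ℕ) : MvPolynomial (Fin n) ℤ[X] :=
  ∏ p ∈ posPairs n, (MvPolynomial.X p.1 - MvPolynomial.X p.2)

/-- For `p = (i, j)` with `i < j`, the factor contributed by the variables `x_i` and `x_j` to the
term of the exponent vector `a` in the product of the Vandermonde product with a Hall–Littlewood
polynomial. -/
noncomputable def hlFactor (a : Fin n → ℕ) (p : Fin n × Fin n) : MvPolynomial (Fin n) ℤ[X] :=
  if a p.2 < a p.1 then MvPolynomial.X p.1 - MvPolynomial.C Polynomial.X * MvPolynomial.X p.2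
  else if a p.1 < a p.2 then
    MvPolynomial.C Polynomial.X * MvPolynomial.X p.1 - MvPolynomial.X p.2
  else MvPolynomial.X p.1 - MvPolynomial.X p.2

/-- The product of the Vandermonde product with a Hall–Littlewood polynomial. -/
noncomputable def hlNum (n : ℕ) (lam : YoungDiagram) : MvPolynomial (Fin n) ℤ[X] :=
  ∑ a ∈ rearrangements n lam, (∏ i, MvPolynomial.X i ^ a i) * ∏ p ∈ posPairs n, hlFactor a p

theorem det_vandermonde_rev {R : Type*} [CommRing R] (x : Fin n → R) :
    (Matrix.of fun i j : Fin n => x i ^ (n - 1 - (j : ℕ))).det =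
      ∏ p ∈ posPairs n, (x p.1 - x p.2) := by
  rw [← Matrix.det_submatrix_equiv_self Fin.revPerm]
  have h : (Matrix.of fun i j : Fin n => x i ^ (n - 1 - (j : ℕ))).submatrix
      Fin.revPerm Fin.revPerm =
      Matrix.vandermonde fun i => x (Fin.rev i) := by
    ext i j
    have := j.2
    simp only [Matrix.submatrix_apply, Matrix.of_apply, Matrix.vandermonde_apply,
      Fin.revPerm_apply, Fin.val_rev]
    congr 1
    omega
  rw [h, Matrix.det_vandermonde, Finset.prod_sigma']
  refine Finset.prod_bij' (fun q _ => (Fin.rev q.2, Fin.rev q.1))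
    (fun p _ => ⟨Fin.rev p.2, Fin.rev p.1⟩) ?_ ?_ ?_ ?_ ?_
  · rintro ⟨i, j⟩ hq
    simpa using hq
  · rintro ⟨i, j⟩ hq
    simpa using hq
  · rintro ⟨i, j⟩ _; simp
  · rintro ⟨i, j⟩ _; simp
  · rintro ⟨i, j⟩ _; simp

theorem xvar_eq (i : Fin n) : xvar i = toRat n (MvPolynomial.X i) := rfl

theorem const_eq (c : ℤ[X]) : const n c = toRat n (MvPolynomial.C c) := rfl

theorem xvar_sub_ne_zero {i j : Fin n} (h : i ≠ j) : (xvar i - xvar j : RatFun n) ≠ 0 := by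
  rw [sub_ne_zero]
  intro h'
  exact h (MvPolynomial.X_injective (toRat_injective n h'))

theorem vdm_ne_zero (n : ℕ) : toRat n (vdm n) ≠ 0 := by
  rw [vdm, map_prod, Finset.prod_ne_zero_iff]
  intro p hp
  rw [map_sub]
  exact xvar_sub_ne_zero (mem_posPairs.1 hp).ne

theorem vdm_eq_det (n : ℕ) : toRat n (vdm n) =
    (Matrix.of fun i j : Fin n => (xvar i : RatFun n) ^ (n - 1 - (j : ℕ))).det := by
  rw [det_vandermonde_rev, vdm, map_prod]
  simp only [map_sub, xvar_eq]

theorem vdm_mul_schurPoly (n : ℕ) (mu : YoungDiagram) :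
    toRat n (vdm n) * schurPoly n mu = toRat n (schurNum n mu) := by
  have h := vdm_ne_zero n
  rw [schurPoly, ← vdm_eq_det, mul_div_cancel₀ _ h, schurNum, RingHom.map_det]
  congr 1
  ext i j
  simp [xvar_eq]

/-- A product over ordered pairs of distinct indices, as a product over the pairs `i < j`. -/
theorem prod_pairs_eq {M : Type*} [CommMonoid M] (P : Fin n × Fin n → Prop) [DecidablePred P]
    (hP : ∀ i, ¬ P (i, i)) (f : Fin n × Fin n → M) :
    ∏ p with P p, f p =
      ∏ p ∈ posPairs n, ((if P p then f p else 1) * if P p.swap then f p.swap else 1) := by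
  have h1 : ∏ p ∈ posPairs n, (if P p.swap then f p.swap else 1) =
      ∏ p with p.2 < p.1, if P p then f p else 1 :=
    Finset.prod_bij' (fun p _ => p.swap) (fun p _ => p.swap) (by simp) (by simp) (by simp)
      (by simp) (by simp)
  rw [Finset.prod_mul_distrib, h1, Finset.prod_filter, ← Finset.prod_union]
  · refine (Finset.prod_subset (Finset.subset_univ _) ?_).symm
    rintro ⟨i, j⟩ _ hp
    simp only [Finset.mem_union, mem_posPairs, Finset.mem_filter, Finset.mem_univ, true_and,
      not_or, not_lt] at hp
    have : i = j := le_antisymm hp.2 hp.1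
    subst this
    rw [if_neg (hP i)]
  · rw [Finset.disjoint_left]
    intro p hp hp'
    simp only [mem_posPairs, Finset.mem_filter, Finset.mem_univ, true_and] at hp hp'
    exact hp.asymm hp'

theorem vdm_mul_hallLittlewoodP (n : ℕ) (lam : YoungDiagram) :
    toRat n (vdm n) * hallLittlewoodP n lam = toRat n (hlNum n lam) := by
  rw [hallLittlewoodP, hlNum, map_sum, Finset.mul_sum]
  refine Finset.sum_congr rfl fun a _ => ?_
  rw [map_mul, map_prod, mul_left_comm]
  congr 1
  · simp [xvar_eq]
  rw [prod_pairs_eq (fun p : Fin n × Fin n => a p.2 < a p.1) (fun i => lt_irrefl _), map_prod, vdm,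
    map_prod, ← Finset.prod_mul_distrib]
  refine Finset.prod_congr rfl fun p hp => ?_
  have h1 := xvar_sub_ne_zero (mem_posPairs.1 hp).ne
  have h2 := xvar_sub_ne_zero (mem_posPairs.1 hp).ne'
  simp only [Prod.fst_swap, Prod.snd_swap, hlFactor, map_sub, ← xvar_eq]
  rcases lt_trichotomy (a p.1) (a p.2) with h | h | h
  · rw [if_neg h.asymm, if_pos h, if_neg h.asymm, if_pos h, map_sub, map_mul, ← const_eq,
      ← xvar_eq, ← xvar_eq]
    field_simp
    ring
  · simp [h, ← xvar_eq]
  · rw [if_pos h, if_neg h.asymm, if_pos h, map_sub, map_mul, ← const_eq, ← xvar_eq, ← xvar_eq]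
    field_simp

theorem sum_identity_iff (n : ℕ) (mu : YoungDiagram) (K : YoungDiagram →₀ ℤ[X]) :
    (schurPoly n mu = K.sum fun lam c => const n c * hallLittlewoodP n lam) ↔
      schurNum n mu = K.sum fun lam c => MvPolynomial.C c * hlNum n lam := by
  rw [← (toRat_injective n).eq_iff, ← vdm_mul_schurPoly, Finsupp.sum, Finsupp.sum, map_sum]
  have : ∑ lam ∈ K.support, toRat n (MvPolynomial.C (K lam) * hlNum n lam) =
      toRat n (vdm n) * ∑ lam ∈ K.support, const n (K lam) * hallLittlewoodP n lam := by
    rw [Finset.mul_sum]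
    refine Finset.sum_congr rfl fun lam _ => ?_
    rw [map_mul, ← vdm_mul_hallLittlewoodP, const_eq]
    ring
  rw [this, mul_right_inj' (vdm_ne_zero n)]

theorem rename_schurNum (σ : Equiv.Perm (Fin n)) (mu : YoungDiagram) :
    MvPolynomial.rename σ (schurNum n mu) = (Equiv.Perm.sign σ : ℤ) • schurNum n mu := by
  rw [schurNum, zsmul_eq_mul, AlgHom.map_det]
  refine Eq.trans ?_ (Matrix.det_permute σ _)
  congr 1
  ext i j
  simp

theorem rename_vdm (σ : Equiv.Perm (Fin n)) :
    MvPolynomial.rename σ (vdm n) = (Equiv.Perm.sign σ : ℤ) • vdm n := by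
  rw [vdm, ← det_vandermonde_rev, zsmul_eq_mul, AlgHom.map_det]
  refine Eq.trans ?_ (Matrix.det_permute σ _)
  congr 1
  ext i j
  simp

/-- The action of a permutation of the variables on rational functions. It serves to see that
Hall–Littlewood polynomials are symmetric before denominators are cleared. -/
noncomputable def permRat (σ : Equiv.Perm (Fin n)) : RatFun n ≃+* RatFun n :=
  IsFractionRing.ringEquivOfRingEquiv (MvPolynomial.renameEquiv ℤ[X] σ).toRingEquiv

theorem permRat_toRat (σ : Equiv.Perm (Fin n)) (f : MvPolynomial (Fin n) ℤ[X]) :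
    permRat σ (toRat n f) = toRat n (MvPolynomial.rename σ f) :=
  IsFractionRing.ringEquivOfRingEquiv_algebraMap _ _

theorem comp_perm_mem_rearrangements {lam : YoungDiagram} {a : Fin n → ℕ}
    (h : a ∈ rearrangements n lam) (σ : Equiv.Perm (Fin n)) : a ∘ σ ∈ rearrangements n lam := by
  simp only [rearrangements, Finset.mem_image, Finset.mem_univ, true_and] at h ⊢
  obtain ⟨w, rfl⟩ := h
  exact ⟨w * σ, rfl⟩

theorem permRat_hallLittlewoodP (σ : Equiv.Perm (Fin n)) (lam : YoungDiagram) :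
    permRat σ (hallLittlewoodP n lam) = hallLittlewoodP n lam := by
  have hx : ∀ i, permRat σ (xvar i) = xvar (σ i) := fun i => by
    rw [xvar_eq, permRat_toRat, MvPolynomial.rename_X]; rfl
  have hc : ∀ c, permRat σ (const n c) = const n c := fun c => by
    rw [const_eq, permRat_toRat, MvPolynomial.rename_C]
  rw [hallLittlewoodP, map_sum]
  refine Finset.sum_bij' (fun a _ => a ∘ σ.symm) (fun a _ => a ∘ σ)
    (fun a ha => comp_perm_mem_rearrangements ha _) (fun a ha => comp_perm_mem_rearrangements ha _)
    (fun a _ => by funext i; simp) (fun a _ => by funext i; simp) fun a _ => ?_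
  rw [map_mul, map_prod, map_prod]
  congr 1
  · rw [← Equiv.prod_comp σ fun i => xvar i ^ (a ∘ σ.symm) i]
    simp [hx]
  · refine Finset.prod_bij' (fun p _ => (σ p.1, σ p.2)) (fun p _ => (σ.symm p.1, σ.symm p.2))
      (by simp) (by simp) (by simp) (by simp) fun p _ => ?_
    simp [hx, hc]

theorem rename_hlNum (σ : Equiv.Perm (Fin n)) (lam : YoungDiagram) :
    MvPolynomial.rename σ (hlNum n lam) = (Equiv.Perm.sign σ : ℤ) • hlNum n lam := by
  apply toRat_injective n
  rw [← permRat_toRat, ← vdm_mul_hallLittlewoodP, map_mul, permRat_hallLittlewoodP, permRat_toRat,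
    rename_vdm, map_zsmul, map_zsmul, smul_mul_assoc, vdm_mul_hallLittlewoodP]

end Polynomials

/-! ### Biorthogonality and the formula for the Kostka–Foulkes polynomials -/

section Biorthogonality

variable {n : ℕ}

/-- The vector `δ = (n - 1, …, 1, 0)`. -/
def stair (n : ℕ) (i : Fin n) : ℤ := ((n - 1 - (i : ℕ) : ℕ) : ℤ)

theorem stair_lt {i j : Fin n} (h : i < j) : stair n j < stair n i := by
  have := j.2
  rw [Fin.lt_def] at h
  simp only [stair]
  omega

theorem sum_posPairs_single (n : ℕ) :
    ∑ p ∈ posPairs n, (Pi.single p.1 1 : Fin n → ℤ) = stair n := by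
  funext i
  rw [Finset.sum_apply]
  have h : ∀ p ∈ posPairs n, (Pi.single p.1 1 : Fin n → ℤ) i = if p.1 = i then 1 else 0 := by
    intro p _
    simp [Pi.single_apply, eq_comm]
  rw [Finset.sum_congr rfl h, Finset.sum_boole, stair]
  have h2 : (posPairs n).filter (fun p => p.1 = i) = (Finset.Ioi i).image fun j => (i, j) := by
    ext ⟨a, b⟩
    simp only [Finset.mem_filter, mem_posPairs, Finset.mem_image, Finset.mem_Ioi, Prod.mk.injEq]
    constructor
    · rintro ⟨h1, rfl⟩; exact ⟨b, h1, rfl, rfl⟩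
    · rintro ⟨j, h1, rfl, rfl⟩; exact ⟨h1, rfl⟩
  rw [h2, Finset.card_image_of_injective _ (Prod.mk_right_injective i), Fin.card_Ioi]

/-- The factor `hlFactor a p` times the geometric series of `p`, divided by the leading variable. -/
noncomputable def hlRatio (a : Fin n → ℕ) (p : Fin n × Fin n) : LaurentSer n ℤ[X] :=
  if a p.2 < a p.1 then 1
  else if a p.1 < a p.2 then
    (HahnSeries.C (Polynomial.X : ℤ[X]) - mono (root p.1 p.2)) * geo Polynomial.X p.1 p.2
  else (1 - mono (root p.1 p.2)) * geo Polynomial.X p.1 p.2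

theorem toSer_hlFactor_mul_geo (a : Fin n → ℕ) {p : Fin n × Fin n} (hp : p ∈ posPairs n) :
    toSer n (hlFactor a p) * geo Polynomial.X p.1 p.2 = mono (Pi.single p.1 1) * hlRatio a p := by
  have hX : ∀ i, toSer n (MvPolynomial.X i) = mono (Pi.single i 1) := fun i => by simp [toSer]
  have hC : ∀ c, toSer n (MvPolynomial.C c) = HahnSeries.C c := fun c => by simp [toSer]
  have hm : (mono (Pi.single p.2 1) : LaurentSer n ℤ[X]) =
      mono (Pi.single p.1 1) * mono (root p.1 p.2) := by
    rw [mono_mul, root]; congr 1; abel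
  have hg := mul_geo (R := ℤ[X]) Polynomial.X (mem_posPairs.1 hp)
  rw [hlFactor, hlRatio]
  split_ifs
  · rw [map_sub, map_mul, hX, hX, hC, hm]
    linear_combination mono (Pi.single p.1 1) * hg
  · rw [map_sub, map_mul, hX, hX, hC, hm]
    ring
  · rw [map_sub, hX, hX, hm]
    ring

theorem toSer_hlNum_mul_kostantSeries (lam : YoungDiagram) :
    toSer n (hlNum n lam) * kostantSeries n Polynomial.X =
      ∑ a ∈ rearrangements n lam,
        mono (stair n) * (mono (fun i => (a i : ℤ)) * ∏ p ∈ posPairs n, hlRatio a p) := by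
  rw [hlNum, map_sum, Finset.sum_mul]
  refine Finset.sum_congr rfl fun a _ => ?_
  rw [map_mul, map_prod, map_prod, mul_assoc, kostantSeries, ← Finset.prod_mul_distrib,
    Finset.prod_congr rfl fun p hp => toSer_hlFactor_mul_geo a hp, Finset.prod_mul_distrib,
    prod_mono, sum_posPairs_single]
  have : ∏ i, toSer n (MvPolynomial.X i ^ a i) = mono fun i => (a i : ℤ) := by
    have h : ∀ i, toSer n (MvPolynomial.X i ^ a i) = mono (Pi.single i (a i : ℤ)) := fun i => by
      rw [map_pow, toSer, MvPolynomial.eval₂Hom_X', mono_pow, ← Pi.single_smul]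
      simp
    rw [Finset.prod_congr rfl fun i _ => h i, prod_mono]
    congr 1
    funext j
    simp [Finset.sum_apply, Pi.single_apply]
  rw [this]
  ring

theorem suppGE_hlRatio {a : Fin n → ℕ} {p : Fin n × Fin n} (hp : p ∈ posPairs n)
    {l : (Fin n → ℤ) →+ ℤ} (hl : a p.1 ≤ a p.2 → 0 ≤ l (root p.1 p.2)) :
    SuppGE l 0 (hlRatio a p) := by
  have hm : 0 ≤ l (root p.1 p.2) → SuppGE l 0 (mono (root p.1 p.2) : LaurentSer n ℤ[X]) :=
    fun h => (suppGE_mono l _).mono_le h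
  have hC : SuppGE l 0 (HahnSeries.C Polynomial.X : LaurentSer n ℤ[X]) := by
    simpa using (suppGE_one (R := ℤ[X]) l).C_mul Polynomial.X
  rw [hlRatio]
  split_ifs with h1 h2
  · exact suppGE_one l
  · have h := hl h2.le
    simpa using (hC.sub (hm h)).mul (suppGE_geo _ (mem_posPairs.1 hp) h)
  · have h := hl (not_lt.1 h1)
    simpa using ((suppGE_one l).sub (hm h)).mul (suppGE_geo _ (mem_posPairs.1 hp) h)

theorem oneMod_hlRatio {a : Fin n → ℕ} {p : Fin n × Fin n} (hp : p ∈ posPairs n)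
    (ha : a p.2 ≤ a p.1) {l : (Fin n → ℤ) →+ ℤ} (hl : 1 ≤ l (root p.1 p.2)) :
    OneMod l (hlRatio a p) := by
  rw [hlRatio]
  split_ifs with h1 h2
  · intro v hv; simp at hv
  · exact absurd ha (not_le.2 h2)
  · refine OneMod.mul ?_ (oneMod_geo _ (mem_posPairs.1 hp) hl)
    rw [OneMod, sub_sub_cancel_left]
    exact ((suppGE_mono l _).mono_le hl).neg

/-- A term of the Hall–Littlewood polynomial contributes to the coefficient of a partition only
if its exponent vector is that partition. An exponent `v = lam - a` of the product is a nonnegative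
combination of vectors `e_j - e_i` with `i < j` and `a_i ≤ a_j`. Therefore `⟨a, v⟩ ≥ 0` and
`⟨lam, v⟩ ≤ 0`, whence `|lam - a|² ≤ 0`. -/
theorem cf_prod_hlRatio (a b : Fin n → ℕ) (hb : Antitone b) :
    cf (∏ p ∈ posPairs n, hlRatio a p) (fun i => (b i : ℤ) - a i) = if a = b then 1 else 0 := by
  split_ifs with hab
  · subst hab
    -- In this case every factor is `1` plus terms with positive exponents of some `x_j / x_i`.
    have h : OneMod (pairHom fun i : Fin n => ((i : ℕ) : ℤ)) (∏ p ∈ posPairs n, hlRatio a p) :=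
      oneMod_prod fun p hp => by
        have hp' := mem_posPairs.1 hp
        refine oneMod_hlRatio hp (hb hp'.le) ?_
        rw [pairHom_root]
        rw [Fin.lt_def] at hp'
        omega
    rw [← one_mul (∏ p ∈ posPairs n, hlRatio a p), h.cf_mul, cf_one, if_pos]
    · funext i; simp
    · exact (suppGE_one _).mono_le (by simp)
  · by_contra h0
    have h1 : SuppGE (pairHom fun i => (a i : ℤ)) 0 (∏ p ∈ posPairs n, hlRatio a p) :=
      suppGE_prod fun p hp => suppGE_hlRatio hp fun h => by
        rw [pairHom_root]; exact sub_nonneg.2 (by exact_mod_cast h)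
    have h2 : SuppGE (pairHom fun i => -(b i : ℤ)) 0 (∏ p ∈ posPairs n, hlRatio a p) :=
      suppGE_prod fun p hp => suppGE_hlRatio hp fun _ => by
        have := hb (mem_posPairs.1 hp).le
        rw [pairHom_root]; omega
    have h3 := h1 _ h0
    have h4 := h2 _ h0
    rw [pairHom_apply] at h3 h4
    have h5 : ∑ i, ((b i : ℤ) - a i) ^ 2 ≤ 0 := by
      have : ∑ i, ((b i : ℤ) - a i) ^ 2 =
          -(∑ i, (a i : ℤ) * ((b i : ℤ) - a i) + ∑ i, -(b i : ℤ) * ((b i : ℤ) - a i)) := by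
        rw [← Finset.sum_add_distrib, ← Finset.sum_neg_distrib]
        exact Finset.sum_congr rfl fun i _ => by ring
      rw [this]; linarith
    have h6 := (Finset.sum_eq_zero_iff_of_nonneg fun i _ => sq_nonneg ((b i : ℤ) - a i)).1
      (le_antisymm h5 (Finset.sum_nonneg fun i _ => sq_nonneg _))
    refine hab (funext fun i => ?_)
    have := pow_eq_zero_iff (two_ne_zero) |>.1 (h6 i (Finset.mem_univ i))
    omega

theorem rowLen_antitone (lam : YoungDiagram) : Antitone lam.rowLen :=
  fun i j h => lam.rowLen_anti i j h

theorem young_ext {lam mu : YoungDiagram} (h : ∀ i, lam.rowLen i = mu.rowLen i) : lam = mu := by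
  ext ⟨i, j⟩
  rw [YoungDiagram.mem_cells, YoungDiagram.mem_cells, YoungDiagram.mem_iff_lt_rowLen,
    YoungDiagram.mem_iff_lt_rowLen, h]

theorem young_ext_of_colLen_le {lam mu : YoungDiagram} (hlam : lam.colLen 0 ≤ n)
    (hmu : mu.colLen 0 ≤ n) (h : ∀ i : Fin n, lam.rowLen i = mu.rowLen i) : lam = mu := by
  refine young_ext fun i => ?_
  by_cases hi : i < n
  · exact h ⟨i, hi⟩
  · rw [rowLen_eq_zero_of_colLen_le (hlam.trans (not_lt.1 hi)),
      rowLen_eq_zero_of_colLen_le (hmu.trans (not_lt.1 hi))]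

theorem mem_rearrangements_iff_eq {lam rho : YoungDiagram} (hlam : lam.colLen 0 ≤ n)
    (hrho : rho.colLen 0 ≤ n) :
    (fun i : Fin n => lam.rowLen i) ∈ rearrangements n rho ↔ rho = lam := by
  simp only [rearrangements, Finset.mem_image, Finset.mem_univ, true_and]
  constructor
  · rintro ⟨w, hw⟩
    refine young_ext_of_colLen_le hrho hlam fun i => ?_
    let f : Fin n → ℕᵒᵈ := fun i => OrderDual.toDual (rho.rowLen i)
    have h1 : Monotone (f ∘ w) := by
      intro i j hij
      have h2 := congrFun hw i
      have h3 := congrFun hw j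
      change rho.rowLen (w j) ≤ rho.rowLen (w i)
      rw [h2, h3]
      exact rowLen_antitone lam hij
    have h2 : Monotone (f ∘ (1 : Equiv.Perm (Fin n))) := fun i j hij =>
      rowLen_antitone rho hij
    have h3 := congrFun (Tuple.unique_monotone h2 h1) i
    exact (OrderDual.toDual.injective h3).trans (congrFun hw i)
  · rintro rfl
    exact ⟨1, rfl⟩

open Classical in
/-- Biorthogonality: the functionals that take the coefficient of `x^(lam + δ)` in the product with
the Kostant series form the dual basis of the Hall–Littlewood polynomials times the Vandermonde
product. -/
theorem cf_toSer_hlNum {lam rho : YoungDiagram} (hlam : lam.colLen 0 ≤ n)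
    (hrho : rho.colLen 0 ≤ n) :
    cf (toSer n (hlNum n rho) * kostantSeries n Polynomial.X) (shifted n lam) =
      if rho = lam then 1 else 0 := by
  rw [toSer_hlNum_mul_kostantSeries, cf_sum]
  have h : ∀ a ∈ rearrangements n rho, cf (mono (stair n) *
      (mono (fun i => (a i : ℤ)) * ∏ p ∈ posPairs n, hlRatio a p)) (shifted n lam) =
      if a = (fun i : Fin n => lam.rowLen i) then 1 else 0 := by
    intro a _
    rw [cf_mono_mul, cf_mono_mul, ← cf_prod_hlRatio a _ fun i j h => rowLen_antitone lam h]
    congr 1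
    funext i
    simp [shifted, stair]
  rw [Finset.sum_congr rfl h, Finset.sum_ite_eq' (rearrangements n rho)]
  simp only [mem_rearrangements_iff_eq hlam hrho]

theorem toSer_schurNum (mu : YoungDiagram) : toSer n (schurNum n mu) = alt (shifted n mu) := by
  rw [schurNum, RingHom.map_det, alt]
  congr 1
  ext1 i j
  simp only [RingHom.mapMatrix_apply, Matrix.map_apply, Matrix.of_apply]
  rw [map_pow, toSer, MvPolynomial.eval₂Hom_X', mono_pow, ← Pi.single_smul]
  congr 2
  simp [shifted]

theorem cf_toSer (f : MvPolynomial (Fin n) ℤ[X]) (v : Fin n → ℤ) :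
    cf (toSer n f) v =
      ∑ m ∈ f.support, if v = (fun i => (m i : ℤ)) then f.coeff m else 0 := by
  conv_lhs => rw [f.as_sum]
  rw [map_sum, cf_sum]
  refine Finset.sum_congr rfl fun m _ => ?_
  have h : toSer n (MvPolynomial.monomial m (f.coeff m)) =
      HahnSeries.C (f.coeff m) * mono (fun i => (m i : ℤ)) := by
    rw [toSer, MvPolynomial.eval₂Hom_monomial, Finsupp.prod_fintype _ _ (by simp)]
    simp only [mono_pow, prod_mono]
    congr 2
    funext j
    simp [Finset.sum_apply, Pi.single_apply]
  rw [h, cf_C_mul, cf_mono]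
  split_ifs <;> simp

theorem cf_toSer_natCast (f : MvPolynomial (Fin n) ℤ[X]) (m : Fin n →₀ ℕ) :
    cf (toSer n f) (fun i => (m i : ℤ)) = f.coeff m := by
  rw [cf_toSer]
  have h : ∀ m' : Fin n →₀ ℕ, ((fun i => (m i : ℤ)) = fun i => (m' i : ℤ)) ↔ m = m' := by
    intro m'
    constructor
    · intro h; ext i; exact_mod_cast congrFun h i
    · rintro rfl; rfl
  simp only [h]
  rw [Finset.sum_ite_eq]
  split_ifs with h'
  · rfl
  · exact (MvPolynomial.notMem_support_iff.1 h').symm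

theorem exists_of_cf_toSer_ne_zero {f : MvPolynomial (Fin n) ℤ[X]} {v : Fin n → ℤ}
    (h : cf (toSer n f) v ≠ 0) : ∃ m ∈ f.support, v = fun i => (m i : ℤ) := by
  rw [cf_toSer] at h
  obtain ⟨m, hm, h⟩ := Finset.exists_ne_zero_of_sum_ne_zero h
  exact ⟨m, hm, by by_contra h'; exact h (if_neg h')⟩

theorem exists_young (f : Fin n → ℕ) (hf : Antitone f) :
    ∃ lam : YoungDiagram, lam.colLen 0 ≤ n ∧ ∀ i : Fin n, lam.rowLen i = f i := by
  have hs : (List.ofFn f).SortedGE := by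
    rw [List.sortedGE_ofFn_iff]
    exact hf
  refine ⟨YoungDiagram.ofRowLens _ hs, ?_, fun i => ?_⟩
  · by_contra! h
    have h1 := YoungDiagram.mem_iff_lt_colLen.2 h
    rw [YoungDiagram.mem_ofRowLens] at h1
    obtain ⟨h2, _⟩ := h1
    simp at h2
  · have := YoungDiagram.rowLen_ofRowLens (hw := hs) ⟨i, by simp⟩
    simpa using this

/-- An alternating polynomial on which all the functionals of the partitions vanish is zero. -/
theorem eq_zero_of_alternating {g : MvPolynomial (Fin n) ℤ[X]}
    (hg : ∀ σ : Equiv.Perm (Fin n), MvPolynomial.rename σ g = (Equiv.Perm.sign σ : ℤ) • g)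
    (h : ∀ lam : YoungDiagram, lam.colLen 0 ≤ n →
      cf (toSer n g * kostantSeries n Polynomial.X) (shifted n lam) = 0) : g = 0 := by
  by_contra h0
  -- Among the exponents of `g`, one that maximizes the pairing with `δ` is strictly decreasing.
  obtain ⟨m, hm, hmax⟩ := Finset.exists_max_image g.support
    (fun m => ∑ i, stair n i * (m i : ℤ)) (Finset.nonempty_of_ne_empty (by simpa using h0))
  have hcoeff : ∀ i j : Fin n, i ≠ j →
      g.coeff (m.mapDomain (Equiv.swap i j)) = -g.coeff m := by
    intro i j hij
    have := MvPolynomial.coeff_rename_mapDomain (Equiv.swap i j) (Equiv.swap i j).injective g m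
    rw [hg, Equiv.Perm.sign_swap hij] at this
    simp only [Units.val_neg, Units.val_one, neg_smul, one_smul, MvPolynomial.coeff_neg] at this
    rw [← this, neg_neg]
  have hm0 : g.coeff m ≠ 0 := MvPolynomial.mem_support_iff.1 hm
  have hanti : StrictAnti m := by
    intro i j hij
    by_contra! hle
    have hswap : ∀ x, m.mapDomain (Equiv.swap i j) x = m (Equiv.swap i j x) := by
      intro x
      have := Finsupp.mapDomain_apply (Equiv.swap i j).injective m (Equiv.swap i j x)
      rwa [Equiv.swap_apply_self] at this
    have h1 : m.mapDomain (Equiv.swap i j) ∈ g.support := by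
      rw [MvPolynomial.mem_support_iff, hcoeff i j hij.ne, neg_ne_zero]
      exact hm0
    have h2 := hmax _ h1
    simp only [hswap] at h2
    have h3 : ∑ x, stair n x * (m (Equiv.swap i j x) : ℤ) - ∑ x, stair n x * (m x : ℤ) =
        (stair n i - stair n j) * ((m j : ℤ) - m i) := by
      rw [← Finset.sum_sub_distrib, Fintype.sum_eq_add (M := ℤ) i j hij.ne]
      · rw [Equiv.swap_apply_left, Equiv.swap_apply_right]; ring
      · rintro x ⟨hx1, hx2⟩
        rw [Equiv.swap_apply_of_ne_of_ne hx1 hx2, sub_self]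
    have h4 := stair_lt hij
    rcases hle.eq_or_lt with h5 | h5
    · have h6 := hcoeff i j hij.ne
      have h7 : m.mapDomain (Equiv.swap i j) = m := by
        ext x
        rw [hswap, Equiv.swap_apply_def]
        split_ifs with e1 e2
        · rw [e1, h5]
        · rw [e2, h5]
        · rfl
      rw [h7] at h6
      exact hm0 (self_eq_neg.1 h6)
    · have : (0 : ℤ) < (stair n i - stair n j) * ((m j : ℤ) - m i) :=
        mul_pos (by omega) (by omega)
      omega
  have hge : ∀ i : Fin n, n - 1 - (i : ℕ) ≤ m i := by
    intro i
    rw [← Fin.card_Ioi, ← Finset.card_range (m i)]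
    exact Finset.card_le_card_of_injOn m (fun j hj => by simpa using hanti (by simpa using hj))
      hanti.injective.injOn
  -- Hence it is `lam + δ` for a partition `lam`, whose functional has the value `g.coeff m` at `g`.
  obtain ⟨lam, hlam, hrow⟩ := exists_young (fun i => m i - (n - 1 - (i : ℕ))) (by
    intro i j hij
    have h1 : (j : ℕ) - i ≤ m i - m j := by
      have e : (Finset.Ioc i j).card ≤ (Finset.Ico (m j) (m i)).card :=
        Finset.card_le_card_of_injOn m (fun x hx => by
          simp only [Finset.coe_Ioc, Set.mem_Ioc] at hx
          simpa using ⟨hanti.antitone hx.2, hanti hx.1⟩) hanti.injective.injOn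
      simpa using e
    have h2 := hge j
    have h3 := hge i
    have h4 := hanti.antitone hij
    have h5 := j.2
    rw [Fin.le_def] at hij
    change m j - (n - 1 - (j : ℕ)) ≤ m i - (n - 1 - (i : ℕ))
    omega)
  have hsh : shifted n lam = fun i => (m i : ℤ) := by
    funext i
    have := hge i
    rw [shifted, hrow]
    omega
  have hK : OneMod (pairHom fun i => -stair n i) (kostantSeries n (Polynomial.X : ℤ[X])) :=
    oneMod_prod fun p hp => oneMod_geo _ (mem_posPairs.1 hp) (by
      have := stair_lt (mem_posPairs.1 hp)
      rw [pairHom_root]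
      omega)
  have h1 := h lam hlam
  rw [hsh, hK.cf_mul, cf_toSer_natCast] at h1
  · exact hm0 h1
  · intro v hv
    obtain ⟨m', hm', rfl⟩ := exists_of_cf_toSer_ne_zero hv
    have := hmax m' hm'
    simp only [pairHom_apply, neg_mul, Finset.sum_neg_distrib]
    linarith

theorem mem_partitionsOf {N : ℕ} {mu : YoungDiagram} : mu ∈ partitionsOf N ↔ mu.card = N := by
  simp [partitionsOf]

theorem card_eq_sum_rowLen {lam : YoungDiagram} (h : lam.colLen 0 ≤ n) :
    lam.card = ∑ i : Fin n, lam.rowLen i := by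
  rw [YoungDiagram.card, Fin.sum_univ_eq_sum_range fun i => lam.rowLen i,
    Finset.card_eq_sum_card_fiberwise (f := Prod.fst) (t := Finset.range n)]
  · refine Finset.sum_congr rfl fun i _ => ?_
    rw [YoungDiagram.rowLen_eq_card]
    rfl
  · rintro ⟨i, j⟩ hc
    have h1 : (i, 0) ∈ lam := lam.up_left_mem le_rfl (Nat.zero_le j) (by simpa using hc)
    have h2 := YoungDiagram.mem_iff_lt_colLen.1 h1
    simpa using h2.trans_le h

/-- The coefficients of the Schur function of `mu` in the Hall–Littlewood basis, computed in as many
variables as `mu` has cells. -/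
noncomputable def schurCoeffs (mu : YoungDiagram) : YoungDiagram →₀ ℤ[X] := by
  classical
  exact Finsupp.onFinset (partitionsOf mu.card)
    (fun lam => if lam.card = mu.card then
      kos Polynomial.X (shifted mu.card mu) (shifted mu.card lam) else 0)
    (fun lam h => by
      rw [mem_partitionsOf]
      by_contra h'
      exact h (if_neg h'))

theorem schurCoeffs_apply (mu lam : YoungDiagram) : schurCoeffs mu lam =
    if lam.card = mu.card then
      kos Polynomial.X (shifted mu.card mu) (shifted mu.card lam) else 0 := by
  classical
  rw [schurCoeffs, Finsupp.onFinset_apply]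

theorem cf_toSer_sum (K : YoungDiagram →₀ ℤ[X]) (hK : ∀ rho ∈ K.support, rho.colLen 0 ≤ n)
    {lam : YoungDiagram} (hlam : lam.colLen 0 ≤ n) :
    cf (toSer n (K.sum fun lam c => MvPolynomial.C c * hlNum n lam) *
      kostantSeries n Polynomial.X) (shifted n lam) = K lam := by
  classical
  rw [Finsupp.sum, map_sum, Finset.sum_mul, cf_sum]
  have h : ∀ rho ∈ K.support, cf (toSer n (MvPolynomial.C (K rho) * hlNum n rho) *
      kostantSeries n Polynomial.X) (shifted n lam) = if rho = lam then K rho else 0 := by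
    intro rho hr
    have hC : toSer n (MvPolynomial.C (K rho)) = HahnSeries.C (K rho) := by simp [toSer]
    rw [map_mul, hC, mul_assoc, cf_C_mul, cf_toSer_hlNum hlam (hK rho hr)]
    simp
  rw [Finset.sum_congr rfl h, Finset.sum_ite_eq']
  split_ifs with h'
  · rfl
  · exact (Finsupp.notMem_support_iff.1 h').symm

/-- The expansion exists: the difference of both sides is alternating and all functionals vanish on
it, for every number of variables because `kos` does not depend on this number. -/
theorem isSchurExpansion_schurCoeffs (mu : YoungDiagram) :
    IsSchurExpansion mu (schurCoeffs mu) := by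
  have hsupp : ∀ lam ∈ (schurCoeffs mu).support, lam.card = mu.card := by
    intro lam h
    by_contra h'
    rw [Finsupp.mem_support_iff, schurCoeffs_apply, if_neg h'] at h
    exact h rfl
  refine ⟨hsupp, fun n hn => ?_⟩
  rw [sum_identity_iff, ← sub_eq_zero]
  refine eq_zero_of_alternating (fun σ => ?_) fun lam hlam => ?_
  · rw [map_sub, rename_schurNum, smul_sub]
    congr 1
    rw [Finsupp.sum, map_sum, Finset.smul_sum]
    refine Finset.sum_congr rfl fun lam _ => ?_
    rw [map_mul, MvPolynomial.rename_C, rename_hlNum, mul_smul_comm]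
  · have hmu := (colLen_zero_le_card mu).trans hn
    rw [map_sub, sub_mul, cf_sub, cf_toSer_sum _ (fun rho hr => ?_) hlam, toSer_schurNum, ← kos,
      schurCoeffs_apply, sub_eq_zero]
    · split_ifs with h
      · exact kos_shifted_stable _ (colLen_zero_le_card mu) (h ▸ colLen_zero_le_card lam) hn
      · refine kos_eq_zero_of_sum_ne _ fun h' => h ?_
        simp only [shifted, Finset.sum_add_distrib, add_left_inj] at h'
        rw [card_eq_sum_rowLen hlam, card_eq_sum_rowLen hmu]
        exact_mod_cast h'.symm
    · exact (colLen_zero_le_card rho).trans ((hsupp rho hr).trans_le hn)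

/-- The Kostka–Foulkes polynomial is a coefficient of the alternant of `mu + δ` times the Kostant
series. -/
theorem kostkaFoulkes_eq_kos {mu lam : YoungDiagram} (h : lam.card = mu.card) (hn : mu.card ≤ n) :
    kostkaFoulkes mu lam = kos Polynomial.X (shifted n mu) (shifted n lam) := by
  have hK : IsSchurExpansion mu (Classical.epsilon (IsSchurExpansion mu)) :=
    Classical.epsilon_spec ⟨_, isSchurExpansion_schurCoeffs mu⟩
  have hlam : lam.colLen 0 ≤ n := (colLen_zero_le_card lam).trans (h.trans_le hn)
  rw [kostkaFoulkes, kos, ← toSer_schurNum, (sum_identity_iff n mu _).1 (hK.2 n hn),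
    cf_toSer_sum _ (fun rho hr => ?_) hlam]
  exact (colLen_zero_le_card rho).trans ((hK.1 rho hr).trans_le hn)

end Biorthogonality

/-! ### Border strips and the Murnaghan–Nakayama rule -/

section BorderStrips

/-- The rows that meet `mu / nu` are those from `p` to `q`, and any two consecutive ones among them
overlap in exactly one column. -/
structure IsStripBetween (mu nu : YoungDiagram) (p q : ℕ) : Prop where
  le : p ≤ q
  eq_of_lt : ∀ i, i < p → mu.rowLen i = nu.rowLen i
  eq_of_gt : ∀ i, q < i → mu.rowLen i = nu.rowLen i
  lt : nu.rowLen p < mu.rowLen p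
  succ : ∀ i, p ≤ i → i < q → mu.rowLen (i + 1) = nu.rowLen i + 1

theorem young_le_iff {nu mu : YoungDiagram} : nu ≤ mu ↔ ∀ i, nu.rowLen i ≤ mu.rowLen i := by
  constructor
  · intro h i
    by_contra! h'
    have h1 : (i, mu.rowLen i) ∈ nu := YoungDiagram.mem_iff_lt_rowLen.2 h'
    have h2 : (i, mu.rowLen i) ∈ mu := h h1
    exact absurd (YoungDiagram.mem_iff_lt_rowLen.1 h2) (lt_irrefl _)
  · rintro h ⟨i, j⟩ hc
    have h1 : (i, j) ∈ nu := hc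
    have h2 : (i, j) ∈ mu :=
      YoungDiagram.mem_iff_lt_rowLen.2 ((YoungDiagram.mem_iff_lt_rowLen.1 h1).trans_le (h i))
    exact h2

theorem IsStripBetween.lt_iff {mu nu : YoungDiagram} {p q : ℕ} (h : IsStripBetween mu nu p q)
    (i : ℕ) : nu.rowLen i < mu.rowLen i ↔ p ≤ i ∧ i ≤ q := by
  constructor
  · intro hi
    constructor
    · by_contra! h'
      have := h.eq_of_lt i h'
      omega
    · by_contra! h'
      have := h.eq_of_gt i h'
      omega
  · rintro ⟨h1, h2⟩
    rcases h1.eq_or_lt with rfl | h1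
    · exact h.lt
    · obtain ⟨k, rfl⟩ : ∃ k, i = k + 1 := ⟨i - 1, by omega⟩
      have h3 := h.succ k (by omega) (by omega)
      have h4 := nu.rowLen_anti k (k + 1) (by omega)
      omega

theorem IsStripBetween.rowLen_le {mu nu : YoungDiagram} {p q : ℕ} (h : IsStripBetween mu nu p q)
    (i : ℕ) : nu.rowLen i ≤ mu.rowLen i := by
  by_cases hi : p ≤ i ∧ i ≤ q
  · exact ((h.lt_iff i).2 hi).le
  · rcases not_and_or.1 hi with h1 | h1
    · exact (h.eq_of_lt i (not_le.1 h1)).ge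
    · exact (h.eq_of_gt i (not_le.1 h1)).ge

theorem IsStripBetween.height_eq {mu nu : YoungDiagram} {p q : ℕ} (h : IsStripBetween mu nu p q) :
    height mu nu = q - p := by
  have : {i | nu.rowLen i < mu.rowLen i} = Set.Icc p q := by
    ext i
    exact h.lt_iff i
  rw [height, this, csSup_Icc h.le, csInf_Icc h.le]

theorem mem_skew_iff {mu nu : YoungDiagram} {i j : ℕ} :
    ((i, j) ∈ mu ∧ (i, j) ∉ nu) ↔ nu.rowLen i ≤ j ∧ j < mu.rowLen i := by
  rw [YoungDiagram.mem_iff_lt_rowLen, YoungDiagram.mem_iff_lt_rowLen, not_lt, and_comm]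

theorem IsBorderStrip.exists_stripBetween {mu nu : YoungDiagram} (h : IsBorderStrip mu nu) :
    ∃ p q, IsStripBetween mu nu p q := by
  classical
  obtain ⟨hle, hconn, hsq⟩ := h
  rw [young_le_iff] at hle
  set T := (Finset.range (mu.colLen 0)).filter fun i => nu.rowLen i < mu.rowLen i with hT
  have hmemT : ∀ i, i ∈ T ↔ nu.rowLen i < mu.rowLen i := by
    intro i
    simp only [hT, Finset.mem_filter, Finset.mem_range, and_iff_right_iff_imp]
    intro hi
    by_contra! h'
    rw [rowLen_eq_zero_of_colLen_le h'] at hi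
    omega
  obtain ⟨⟨⟨a, b⟩, hab⟩⟩ := hconn.nonempty
  have hne : T.Nonempty := ⟨a, (hmemT a).2 (by have := mem_skew_iff.1 hab; omega)⟩
  have hpT := T.min'_mem hne
  have hqT := T.max'_mem hne
  refine ⟨T.min' hne, T.max' hne, T.min'_le_max' hne, fun i hi => ?_, fun i hi => ?_,
    (hmemT _).1 hpT, fun i hpi hiq => ?_⟩
  · by_contra h'
    have h1 := T.min'_le i ((hmemT i).2 (lt_of_le_of_ne (hle i) (Ne.symm h')))
    omega
  · by_contra h'
    have h1 := T.le_max' i ((hmemT i).2 (lt_of_le_of_ne (hle i) (Ne.symm h')))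
    omega
  · set p := T.min' hne
    set q := T.max' hne
    have hp := (hmemT p).1 hpT
    have hq := (hmemT q).1 hqT
    refine le_antisymm ?_ ?_
    · by_contra! hlt
      refine hsq ⟨i, nu.rowLen i, ?_⟩
      have h1 := nu.rowLen_anti i (i + 1) (by omega)
      have h2 := mu.rowLen_anti i (i + 1) (by omega)
      rintro x (rfl | rfl) y (rfl | rfl) <;> rw [mem_skew_iff] <;> constructor <;> omega
    -- Connectedness forces an edge between the rows up to `i` and the rows below.
    · obtain ⟨w⟩ := hconn.preconnected
        ⟨(p, nu.rowLen p), mem_skew_iff.2 ⟨le_rfl, hp⟩⟩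
        ⟨(q, nu.rowLen q), mem_skew_iff.2 ⟨le_rfl, hq⟩⟩
      obtain ⟨d, -, hd1, hd2⟩ := w.exists_boundary_dart {c | c.1.1 ≤ i} hpi (by simpa using hiq)
      have hadj := d.adj
      rcases hfst : d.fst with ⟨⟨x, y⟩, hxy⟩
      rcases hsnd : d.snd with ⟨⟨x', y'⟩, hxy'⟩
      rw [hfst, hsnd] at hadj
      simp only [hfst, hsnd, Set.mem_ofPred_eq, not_le] at hd1 hd2
      simp only [SimpleGraph.comap_adj, Function.Embedding.subtype_apply, SimpleGraph.hasse_adj,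
        Prod.covBy_iff, Nat.covBy_iff_add_one_eq] at hadj
      have h1 := mem_skew_iff.1 hxy
      have h2 := mem_skew_iff.1 hxy'
      have h3 : x = i := by omega
      have h4 : x' = i + 1 := by omega
      have h5 : y = y' := by omega
      subst h3 h4 h5
      omega

theorem IsStripBetween.isBorderStrip {mu nu : YoungDiagram} {p q : ℕ}
    (h : IsStripBetween mu nu p q) : IsBorderStrip mu nu := by
  have hcell : ∀ {i}, p ≤ i → i ≤ q → (i, nu.rowLen i) ∈ {c | c ∈ mu ∧ c ∉ nu} := fun h1 h2 =>
    mem_skew_iff.2 ⟨le_rfl, (h.lt_iff _).2 ⟨h1, h2⟩⟩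
  set G := (SimpleGraph.hasse (ℕ × ℕ)).induce {c | c ∈ mu ∧ c ∉ nu} with hG
  -- Every cell is connected with the first cell of its row.
  have hrow : ∀ i j (hc : (i, j) ∈ {c | c ∈ mu ∧ c ∉ nu})
      (hc' : (i, nu.rowLen i) ∈ {c | c ∈ mu ∧ c ∉ nu}), G.Reachable ⟨_, hc⟩ ⟨_, hc'⟩ := by
    intro i j hc hc'
    have h1 := mem_skew_iff.1 hc
    obtain ⟨d, rfl⟩ := Nat.exists_eq_add_of_le h1.1
    induction d with
    | zero => exact SimpleGraph.Reachable.refl _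
    | succ d ih =>
      have hd : (i, nu.rowLen i + d) ∈ {c | c ∈ mu ∧ c ∉ nu} :=
        mem_skew_iff.2 ⟨by omega, by omega⟩
      refine SimpleGraph.Reachable.trans (SimpleGraph.Adj.reachable ?_) (ih hd (mem_skew_iff.1 hd))
      simp only [hG, SimpleGraph.comap_adj, Function.Embedding.subtype_apply,
        SimpleGraph.hasse_adj, Prod.covBy_iff, Nat.covBy_iff_add_one_eq]
      right; right
      exact ⟨by omega, trivial⟩
  -- The first cells of two consecutive rows are connected.
  have hdown : ∀ d i (h1 : p ≤ i) (h2 : i + d = q),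
      G.Reachable ⟨_, hcell h1 (by omega)⟩ ⟨_, hcell h.le le_rfl⟩ := by
    intro d
    induction d with
    | zero =>
      rintro i h1 h2
      obtain rfl : i = q := by omega
      exact SimpleGraph.Reachable.refl _
    | succ d ih =>
      intro i h1 h2
      have h3 := h.succ i h1 (by omega)
      have h4 := nu.rowLen_anti i (i + 1) (by omega)
      have hc : (i + 1, nu.rowLen i) ∈ {c | c ∈ mu ∧ c ∉ nu} :=
        mem_skew_iff.2 ⟨by omega, by omega⟩
      refine SimpleGraph.Reachable.trans (SimpleGraph.Adj.reachable ?_)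
        ((hrow _ _ hc (hcell (by omega) (by omega))).trans (ih (i + 1) (by omega) (by omega)))
      simp only [hG, SimpleGraph.comap_adj, Function.Embedding.subtype_apply,
        SimpleGraph.hasse_adj, Prod.covBy_iff, Nat.covBy_iff_add_one_eq]
      left; left
      exact ⟨trivial, trivial⟩
  refine ⟨young_le_iff.2 h.rowLen_le, ?_, ?_⟩
  · rw [SimpleGraph.connected_iff_exists_forall_reachable]
    refine ⟨⟨_, hcell h.le le_rfl⟩, ?_⟩
    rintro ⟨⟨i, j⟩, hc⟩
    have h1 := mem_skew_iff.1 hc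
    have h2 := (h.lt_iff i).1 (by omega)
    exact ((hrow i j hc (hcell h2.1 h2.2)).trans (hdown (q - i) i h2.1 (by omega))).symm
  · rintro ⟨i, j, hsq⟩
    have h1 := mem_skew_iff.1 (hsq i (by simp) j (by simp))
    have h2 := mem_skew_iff.1 (hsq (i + 1) (by simp) (j + 1) (by simp))
    have h3 := (h.lt_iff i).1 (by omega)
    have h4 := (h.lt_iff (i + 1)).1 (by omega)
    have h5 := h.succ i h3.1 (by omega)
    omega

variable {n : ℕ}

theorem sum_shifted {lam : YoungDiagram} (h : lam.colLen 0 ≤ n) :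
    ∑ i, shifted n lam i = lam.card + ∑ i, stair n i := by
  rw [card_eq_sum_rowLen h]
  simp [shifted, stair, Finset.sum_add_distrib]

/-- In terms of the shifted parts, adding a border strip of size `r` whose last row is `q` means
adding `r` to the part number `q` and sorting. -/
theorem IsStripBetween.shifted_comp_cycleIcc {mu nu : YoungDiagram} {p q : Fin n} {r : ℕ}
    (h : IsStripBetween mu nu p q) (hmu : mu.colLen 0 ≤ n) (hnu : nu.colLen 0 ≤ n)
    (hr : mu.card = nu.card + r) :
    shifted n mu ∘ Fin.cycleIcc p q = shifted n nu + Pi.single q (r : ℤ) := by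
  have hn : NeZero n := ⟨by have := q.2; omega⟩
  have key : ∀ k, k ≠ q → (shifted n mu ∘ Fin.cycleIcc p q) k = shifted n nu k := by
    intro k hk
    rw [Function.comp_apply]
    by_cases h1 : k < p
    · rw [Fin.cycleIcc_of_lt h1, shifted, shifted, h.eq_of_lt k h1]
    by_cases h2 : q < k
    · rw [Fin.cycleIcc_of_gt h2, shifted, shifted, h.eq_of_gt k h2]
    have h3 : k < q := lt_of_le_of_ne (not_lt.1 h2) hk
    have hq := q.2
    have h4 : ((k + 1 : Fin n) : ℕ) = k + 1 := by
      rw [Fin.val_add_one_of_lt' (by rw [Fin.lt_def] at h3; omega)]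
    rw [Fin.cycleIcc_of_ge_of_lt (not_lt.1 h1) h3, shifted, shifted, h4,
      h.succ k (not_lt.1 h1) h3]
    rw [Fin.lt_def] at h3
    omega
  have hsum : ∑ k, (shifted n mu ∘ Fin.cycleIcc p q) k = ∑ k, shifted n nu k + r := by
    simp only [Function.comp_apply]
    rw [Equiv.sum_comp (Fin.cycleIcc p q) (shifted n mu), sum_shifted hmu, sum_shifted hnu, hr]
    push_cast
    ring
  funext k
  by_cases hk : k = q
  · subst hk
    rw [← Finset.add_sum_erase _ _ (Finset.mem_univ k),
      ← Finset.add_sum_erase _ (shifted n nu) (Finset.mem_univ k),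
      Finset.sum_congr rfl fun i hi => key i (Finset.ne_of_mem_erase hi)] at hsum
    rw [Pi.add_apply, Pi.single_eq_same]
    linarith
  · rw [key k hk, Pi.add_apply, Pi.single_eq_of_ne hk, add_zero]

theorem shifted_strictAnti (n : ℕ) (lam : YoungDiagram) : StrictAnti (shifted n lam) := by
  intro i j hij
  have h1 := lam.rowLen_anti i j hij.le
  have h2 := j.2
  rw [Fin.lt_def] at hij
  simp only [shifted]
  omega

theorem shifted_injective {mu mu' : YoungDiagram} (hmu : mu.colLen 0 ≤ n) (hmu' : mu'.colLen 0 ≤ n)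
    (h : shifted n mu = shifted n mu') : mu = mu' :=
  young_ext_of_colLen_le hmu hmu' fun i => by
    have := congrFun h i
    simp only [shifted] at this
    omega

theorem shifted_eq_of_comp_eq {mu mu' : YoungDiagram} {σ τ : Equiv.Perm (Fin n)}
    (h : shifted n mu ∘ σ = shifted n mu' ∘ τ) : shifted n mu = shifted n mu' := by
  have h1 : shifted n mu = shifted n mu' ∘ (τ * σ⁻¹ : Equiv.Perm (Fin n)) := by
    funext i
    have := congrFun h (σ⁻¹ i)
    simpa using this
  let f : Fin n → ℤᵒᵈ := fun i => OrderDual.toDual (shifted n mu' i)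
  have h2 : Monotone (f ∘ (τ * σ⁻¹ : Equiv.Perm (Fin n))) := by
    intro i j hij
    have h3 := congrFun h1 i
    have h4 := congrFun h1 j
    have h5 := (shifted_strictAnti n mu).antitone hij
    rw [h3, h4] at h5
    exact h5
  have h3 : Monotone (f ∘ (1 : Equiv.Perm (Fin n))) := fun i j hij =>
    (shifted_strictAnti n mu').antitone hij
  funext i
  have h4 := congrFun (Tuple.unique_monotone h2 h3) i
  rw [h1]
  exact OrderDual.toDual.injective h4

/-- If adding `r` to the shifted part number `j` does not produce a repetition, then sorting moves
it to some place `p`, and the result comes from a partition `mu` obtained by adding a border strip. -/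
theorem exists_stripBetween {nu : YoungDiagram} (hnu : nu.colLen 0 ≤ n) {r : ℕ} (hr : 1 ≤ r)
    (j : Fin n) (hj : ∀ i : Fin n, i < j → shifted n nu i ≠ shifted n nu j + r) :
    ∃ mu : YoungDiagram, mu.colLen 0 ≤ n ∧ ∃ p : Fin n, IsStripBetween mu nu p j ∧
      mu.rowLen p + j = nu.rowLen j + r + p := by
  classical
  have hj' : ∀ i : ℕ, i < j → nu.rowLen i + j ≠ nu.rowLen j + r + i := by
    intro i hi h
    have := j.2
    refine hj ⟨i, by omega⟩ hi ?_
    simp only [shifted]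
    omega
  have hex : ∃ i : ℕ, nu.rowLen i + j < nu.rowLen j + r + i := ⟨j, by omega⟩
  obtain ⟨p, hp1, hp2, hpj⟩ : ∃ p : ℕ, nu.rowLen p + j < nu.rowLen j + r + p ∧
      (∀ i, i < p → nu.rowLen j + r + i ≤ nu.rowLen i + j) ∧ p ≤ j :=
    ⟨Nat.find hex, Nat.find_spec hex, fun i hi => by simpa using Nat.find_min hex hi,
      Nat.find_min' hex (by omega)⟩
  let f : ℕ → ℕ := fun i => if i < p then nu.rowLen i else if i = p then nu.rowLen j + r + p - j
    else if i ≤ j then nu.rowLen (i - 1) + 1 else nu.rowLen i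
  have hf : Antitone f := antitone_nat_of_succ_le fun i => by
    have h1 := nu.rowLen_anti i (i + 1) (by omega)
    have h2 := nu.rowLen_anti (i - 1) i (by omega)
    have h3 := fun h => hp2 i h
    have h4 := fun h => hj' i h
    simp only [f, Nat.add_sub_cancel]
    split_ifs with c1 c2 c3 c4 c5 c6 c7 c8 c9 c10 c11 c12 <;>
      first
        | omega
        | (obtain rfl : i = p := by omega
           omega)
  obtain ⟨mu, hmu, hrow⟩ := exists_young (fun i : Fin n => f i) fun a b hab => hf hab
  have hrow' : ∀ i, mu.rowLen i = f i := by
    intro i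
    by_cases hi : i < n
    · exact hrow ⟨i, hi⟩
    · rw [rowLen_eq_zero_of_colLen_le (hmu.trans (not_lt.1 hi))]
      have := rowLen_eq_zero_of_colLen_le (hnu.trans (not_lt.1 hi))
      have := j.2
      simp only [f]
      split_ifs <;> omega
  have hpn : p < n := hpj.trans_lt j.2
  refine ⟨mu, hmu, ⟨p, hpn⟩, ⟨hpj, fun i hi => ?_, fun i hi => ?_, ?_, fun i h1 h2 => ?_⟩, ?_⟩
  · rw [hrow']
    exact if_pos hi
  · rw [hrow']
    simp only [f]
    split_ifs <;> omega
  · rw [hrow']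
    simp only [f, lt_irrefl, if_false, if_true]
    omega
  · rw [hrow']
    simp only [f] at h1 ⊢
    rw [if_neg (by omega), if_neg (by omega), if_pos (by omega), Nat.add_sub_cancel]
  · rw [hrow']
    simp only [f, lt_irrefl, if_false, if_true]
    omega

open Classical in
/-- The Murnaghan–Nakayama rule: multiplying a Schur function by a power sum adds border strips.
If `r` is added to the shifted part number `j`, then the alternant vanishes or sorting yields the
partition obtained by adding a border strip with last row `j`. -/
theorem sum_isBorderStrip {nu : YoungDiagram} {r N : ℕ} (hr : 1 ≤ r) (hN : nu.card + r = N)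
    (hn : N ≤ n) {R : Type*} [CommRing R] (t : R) (α : Fin n → ℤ) :
    ∑ mu ∈ partitionsOf N with IsBorderStrip mu nu,
        (-1) ^ height mu nu * kos t (shifted n mu) α =
      ∑ j, kos t (shifted n nu + Pi.single j (r : ℤ)) α := by
  have hnu : nu.colLen 0 ≤ n := (colLen_zero_le_card nu).trans (by omega)
  set S := {mu ∈ partitionsOf N | IsBorderStrip mu nu} with hS
  have hSmu : ∀ mu ∈ S, mu.card = N ∧ mu.colLen 0 ≤ n ∧
      ∃ j : Fin n, ∃ p : Fin n, IsStripBetween mu nu p j := by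
    intro mu hmu
    rw [hS, Finset.mem_filter, mem_partitionsOf] at hmu
    have hc : mu.colLen 0 ≤ n := (colLen_zero_le_card mu).trans (by omega)
    obtain ⟨p, q, hpq⟩ := hmu.2.exists_stripBetween
    have hq : q < n := by
      by_contra! hq
      have h1 := (hpq.lt_iff q).2 ⟨hpq.le, le_rfl⟩
      rw [rowLen_eq_zero_of_colLen_le (hc.trans hq)] at h1
      omega
    exact ⟨hmu.1, hc, ⟨q, hq⟩, ⟨p, hpq.le.trans_lt hq⟩, hpq⟩
  have : Nonempty (Fin n) := ⟨⟨0, by omega⟩⟩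
  choose! hcard hcol j p hstrip using hSmu
  have hcomp : ∀ mu ∈ S, shifted n mu ∘ Fin.cycleIcc (p mu) (j mu) =
      shifted n nu + Pi.single (j mu) (r : ℤ) := fun mu hmu =>
    (hstrip mu hmu).shifted_comp_cycleIcc (hcol mu hmu) hnu (by rw [hcard mu hmu, hN])
  have hterm : ∀ mu ∈ S, (-1) ^ height mu nu * kos t (shifted n mu) α =
      kos t (shifted n nu + Pi.single (j mu) (r : ℤ)) α := by
    intro mu hmu
    rw [← hcomp mu hmu, kos_comp_perm, Fin.sign_cycleIcc_of_le (hstrip mu hmu).le,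
      (hstrip mu hmu).height_eq]
    simp
  rw [Finset.sum_congr rfl hterm]
  -- The shifted parts of `mu` are determined up to order by the last row of the strip.
  have hinj : Set.InjOn j S := by
    intro mu hmu mu' hmu' h
    refine shifted_injective (hcol mu hmu) (hcol mu' hmu') (shifted_eq_of_comp_eq
      (σ := Fin.cycleIcc (p mu) (j mu)) (τ := Fin.cycleIcc (p mu') (j mu')) ?_)
    rw [hcomp mu hmu, hcomp mu' hmu', h]
  rw [← Finset.sum_image (f := fun i => kos t (shifted n nu + (Pi.single i (r : ℤ) : Fin n → ℤ)) α)
    hinj]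
  refine Finset.sum_subset (Finset.subset_univ _) fun i _ hi => ?_
  by_cases hgood : ∀ a : Fin n, a < i → shifted n nu a ≠ shifted n nu i + r
  · exfalso
    obtain ⟨mu, hmu, q, hst, hrow⟩ := exists_stripBetween hnu hr i hgood
    have hcard' : nu.card ≤ mu.card := Finset.card_le_card (young_le_iff.2 hst.rowLen_le)
    obtain ⟨r', hr'⟩ := Nat.exists_eq_add_of_le hcard'
    have h1 := congrFun (hst.shifted_comp_cycleIcc hmu hnu hr') i
    have hn0 : NeZero n := ⟨by have := i.2; omega⟩
    rw [Function.comp_apply, Fin.cycleIcc_of_last hst.le, Pi.add_apply, Pi.single_eq_same] at h1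
    have h2 := i.2
    have h3 := Fin.le_def.1 hst.le
    simp only [shifted] at h1
    have hmuS : mu ∈ S := by
      rw [hS, Finset.mem_filter, mem_partitionsOf]
      exact ⟨by omega, hst.isBorderStrip⟩
    have h4 := (hst.lt_iff (j mu)).1 (((hstrip mu hmuS).lt_iff _).2 ⟨(hstrip mu hmuS).le, le_rfl⟩)
    have h5 := ((hstrip mu hmuS).lt_iff i).1 ((hst.lt_iff _).2 ⟨hst.le, le_rfl⟩)
    exact hi (Finset.mem_image.2 ⟨mu, hmuS, Fin.ext (le_antisymm h4.2 h5.2)⟩)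
  -- Otherwise two of the exponents of the alternant coincide.
  · push Not at hgood
    obtain ⟨a, ha, h⟩ := hgood
    refine kos_eq_zero_of_eq t ha.ne ?_ α
    simp [h, ha.ne]

end BorderStrips

/-! ### Ordered products of generators with Clifford-like relations -/

section Clifford

variable {E : Type*} [Ring E]

/-- The relation satisfied at `t = -1` by the operators `B a` that append a part `a`: the
anticommutator of `B a` and `B b` changes its sign when `a` is raised and `b` is lowered. In the
absence of `2`-torsion this forces the anticommutators with `a + b` odd to vanish. -/
structure IsCliffordFamily (B : ℤ → E) : Prop where
  rel : ∀ a b, B a * B b + B b * B a + (B (a + 1) * B (b - 1) + B (b - 1) * B (a + 1)) = 0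
  torsion : ∀ x : E, x + x = 0 → x = 0

variable {B : ℤ → E}

theorem IsCliffordFamily.shift (h : IsCliffordFamily B) (m : ℕ) (a b : ℤ) :
    B a * B b + B b * B a =
      (-1) ^ m * (B (a + m) * B (b - m) + B (b - m) * B (a + m)) := by
  induction m with
  | zero => simp
  | succ m ih =>
    have h1 := eq_neg_of_add_eq_zero_left (h.rel (a + m) (b - m))
    rw [ih, h1, pow_succ]
    push_cast
    rw [add_assoc, sub_sub]
    noncomm_ring

theorem IsCliffordFamily.anticomm_even (h : IsCliffordFamily B) (a : ℤ) (m : ℕ) :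
    B a * B (a + 2 * m) + B (a + 2 * m) * B a = (-1) ^ m * (2 * B (a + m) ^ 2) := by
  rw [h.shift m, show a + 2 * (m : ℤ) - m = a + m by ring, two_mul, pow_two]

theorem IsCliffordFamily.anticomm_odd (h : IsCliffordFamily B) (a : ℤ) (m : ℕ) :
    B a * B (a + 2 * m + 1) + B (a + 2 * m + 1) * B a = 0 := by
  rw [h.shift m, show a + 2 * (m : ℤ) + 1 - m = a + m + 1 by ring]
  have h1 := h.rel (a + m) (a + m + 1)
  rw [add_sub_cancel_right] at h1
  rw [h.torsion (B (a + m) * B (a + m + 1) + B (a + m + 1) * B (a + m)), mul_zero]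
  rw [← h1]
  abel

theorem commute_neg_one_pow (m : ℕ) (x : E) : Commute ((-1) ^ m) x :=
  (Commute.neg_one_left x).pow_left m

/-- The squares `B c ^ 2` are central. The commutator of `B c ^ 2` and `B d` is the commutator of
`B c` and the anticommutator of `B c` and `B d`, and this is zero or `± 2 B x ^ 2` with `x` the
midpoint of `c` and `d`. -/
theorem IsCliffordFamily.commute_sq (h : IsCliffordFamily B) (c d : ℤ) :
    Commute (B c ^ 2) (B d) := by
  induction hn : (d - c).natAbs using Nat.strong_induction_on generalizing c d with
  | _ n ih =>
    suffices hac : Commute (B c) (B c * B d + B d * B c) by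
      have h1 : B c ^ 2 * B d - B d * B c ^ 2 =
          B c * (B c * B d + B d * B c) - (B c * B d + B d * B c) * B c := by noncomm_ring
      rw [hac.eq, sub_self] at h1
      exact sub_eq_zero.1 h1
    have hmid : ∀ (m : ℕ) (x : ℤ), (c - x).natAbs < n →
        Commute (B c) ((-1) ^ m * (2 * B x ^ 2)) := fun m x hx =>
      (commute_neg_one_pow m _).symm.mul_right
        ((Nat.cast_commute 2 (B c)).symm.mul_right (ih _ hx x c rfl).symm)
    rcases le_total c d with hcd | hcd
    · obtain ⟨k, rfl⟩ := Int.le.dest hcd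
      rcases k.even_or_odd' with ⟨m, rfl | rfl⟩
      · rcases Nat.eq_zero_or_pos m with rfl | hm
        · simp
        · have := h.anticomm_even c m
          push_cast
          rw [this]
          exact hmid m _ (by push_cast at hn; omega)
      · have := h.anticomm_odd c m
        push_cast
        rw [← add_assoc, this]
        exact Commute.zero_right _
    · obtain ⟨k, rfl⟩ := Int.le.dest hcd
      rw [add_comm (_ * _)]
      rcases k.even_or_odd' with ⟨m, rfl | rfl⟩
      · rcases Nat.eq_zero_or_pos m with rfl | hm
        · simp
        · have := h.anticomm_even d m
          push_cast at hmid ⊢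
          rw [this]
          exact hmid m _ (by push_cast at hn; omega)
      · have := h.anticomm_odd d m
        push_cast
        rw [← add_assoc, this]
        exact Commute.zero_right _

/-- The product of the `B a` with `a` in a multiset, in decreasing order of `a`. -/
def wordProd (B : ℤ → E) (m : Multiset ℤ) : E := ((m.sort (· ≥ ·)).map B).prod

@[simp] theorem wordProd_zero : wordProd B 0 = 1 := by simp [wordProd]

theorem wordProd_cons_of_ge {a : ℤ} {m : Multiset ℤ} (h : ∀ x ∈ m, x ≤ a) :
    wordProd B (a ::ₘ m) = B a * wordProd B m := by
  have h1 : (a ::ₘ m).sort (· ≥ ·) = a :: m.sort (· ≥ ·) := Multiset.sort_cons _ _ _ h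
  rw [wordProd, h1, List.map_cons, List.prod_cons, wordProd]

theorem sort_cons_eq_orderedInsert (a : ℤ) (m : Multiset ℤ) :
    (a ::ₘ m).sort (· ≥ ·) = (m.sort (· ≥ ·)).orderedInsert (· ≥ ·) a := by
  refine List.Perm.eq_of_pairwise' (Multiset.pairwise_sort _ _)
    ((Multiset.pairwise_sort m (· ≥ ·)).orderedInsert _ _) ?_
  rw [← Multiset.coe_eq_coe, Multiset.sort_eq]
  have := List.perm_orderedInsert (· ≥ ·) a (m.sort (· ≥ ·))
  rw [Multiset.coe_eq_coe.2 this, ← Multiset.cons_coe, Multiset.sort_eq]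

/-- A pair of equal factors can be pulled out of an ordered product. -/
theorem IsCliffordFamily.wordProd_pair (h : IsCliffordFamily B) (c : ℤ) (m : Multiset ℤ) :
    wordProd B (c ::ₘ c ::ₘ m) = B c ^ 2 * wordProd B m := by
  have key : ∀ l : List ℤ,
      (((l.orderedInsert (· ≥ ·) c).orderedInsert (· ≥ ·) c).map B).prod =
        B c ^ 2 * (l.map B).prod := by
    intro l
    induction l with
    | nil => simp [pow_two]
    | cons x l ih =>
      by_cases hx : c ≥ x
      · simp [List.orderedInsert, hx, pow_two, mul_assoc]
      · simp only [List.orderedInsert, hx, if_false, List.map_cons, List.prod_cons, ih]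
        rw [← mul_assoc, ← (h.commute_sq c x).eq, mul_assoc]
  rw [wordProd, sort_cons_eq_orderedInsert, sort_cons_eq_orderedInsert, key, wordProd]

/-- The sign and the square that arise when `B a` is exchanged with `B j`, for `a < j` of the same
parity. -/
noncomputable def exchangeTerm (B : ℤ → E) (a j : ℤ) : E :=
  (-1) ^ ((j - a) / 2).toNat * (2 * B ((a + j) / 2) ^ 2)

theorem IsCliffordFamily.exchange (h : IsCliffordFamily B) {a j : ℤ} (haj : a ≤ j)
    (hpar : a % 2 = j % 2) : B a * B j = exchangeTerm B a j - B j * B a := by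
  obtain ⟨k, rfl⟩ := Int.le.dest haj
  obtain ⟨m, rfl⟩ : ∃ m, k = 2 * m := ⟨k / 2, by omega⟩
  have h1 := h.anticomm_even a m
  rw [exchangeTerm, show ((a + (2 * m : ℕ) - a) / 2).toNat = m by omega,
    show (a + (a + (2 * m : ℕ))) / 2 = a + m by omega, ← h1]
  push_cast
  abel

theorem IsCliffordFamily.commute_exchangeTerm (h : IsCliffordFamily B) (a j d : ℤ) :
    Commute (exchangeTerm B a j) (B d) :=
  (commute_neg_one_pow _ _).mul_left ((Nat.cast_commute 2 _).mul_left (h.commute_sq _ _))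

theorem insert_val_of_gt {x : ℤ} {s : Finset ℤ} (hx : ∀ y ∈ s, y < x) :
    (insert x s).val = x ::ₘ s.val :=
  Finset.insert_val_of_notMem fun h => lt_irrefl x (hx x h)

theorem wordProd_insert_of_gt {x : ℤ} {s : Finset ℤ} (hx : ∀ y ∈ s, y < x) :
    wordProd B (insert x s).val = B x * wordProd B s.val := by
  rw [insert_val_of_gt hx, wordProd_cons_of_ge fun y hy => (hx y hy).le]

theorem erase_insert_of_gt {x j : ℤ} {s : Finset ℤ} (hx : ∀ y ∈ s, y < x) (hj : j ∈ s) :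
    (insert x s).erase j = insert x (s.erase j) :=
  Finset.erase_insert_of_ne (hx j hj).ne'

/-- Moving `B a` to the right through the strictly decreasing product over `s`, up to its place in
decreasing order. -/
theorem IsCliffordFamily.mul_wordProd (h : IsCliffordFamily B) (a : ℤ) (s : Finset ℤ)
    (hs : ∀ j ∈ s, a % 2 = j % 2) :
    B a * wordProd B s.val =
      (-1) ^ (s.filter fun l => a < l).card * wordProd B (a ::ₘ s.val) +
        ∑ j ∈ s with a < j, (-1) ^ (s.filter fun l => j < l).card *
          (exchangeTerm B a j * wordProd B (s.erase j).val) := by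
  induction s using Finset.induction_on_max with
  | empty => simp [wordProd]
  | insert x s hx ih =>
    have hxs : x ∉ s := fun h => lt_irrefl x (hx x h)
    by_cases hax : a < x
    · have ih' := ih fun j hj => hs j (Finset.mem_insert_of_mem hj)
      have e1 : (insert x s).filter (fun l => a < l) = insert x (s.filter fun l => a < l) := by
        rw [Finset.filter_insert, if_pos hax]
      have hxf : x ∉ s.filter fun l => a < l := fun h => hxs (Finset.mem_filter.1 h).1
      have e2 : (insert x s).filter (fun l => x < l) = ∅ := by
        rw [Finset.filter_eq_empty_iff]
        intro l hl
        rcases Finset.mem_insert.1 hl with rfl | hl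
        · exact lt_irrefl _
        · exact (hx l hl).asymm
      have e3 : wordProd B (a ::ₘ (insert x s).val) = B x * wordProd B (a ::ₘ s.val) := by
        rw [insert_val_of_gt hx, Multiset.cons_swap, wordProd_cons_of_ge]
        intro y hy
        rcases Multiset.mem_cons.1 hy with rfl | hy
        · exact hax.le
        · exact (hx y hy).le
      have e4 : ∀ j ∈ s.filter (fun l => a < l),
          (-1) ^ ((insert x s).filter fun l => j < l).card *
            (exchangeTerm B a j * wordProd B ((insert x s).erase j).val) =
          -(B x * ((-1) ^ (s.filter fun l => j < l).card *
            (exchangeTerm B a j * wordProd B (s.erase j).val))) := by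
        intro j hj
        have hjs := (Finset.mem_filter.1 hj).1
        rw [Finset.filter_insert, if_pos (hx j hjs), Finset.card_insert_of_notMem
          (fun h => hxs (Finset.mem_filter.1 h).1), erase_insert_of_gt hx hjs,
          wordProd_insert_of_gt (fun y hy => hx y (Finset.mem_of_mem_erase hy)), pow_succ,
          ← mul_assoc (B x), ← (commute_neg_one_pow _ (B x)).eq, mul_assoc _ (B x),
          ← mul_assoc (B x), ← (h.commute_exchangeTerm a j x).eq]
        noncomm_ring
      rw [wordProd_insert_of_gt hx, ← mul_assoc, h.exchange hax.le (hs x (by simp)), sub_mul,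
        mul_assoc (B x), ih', e1, Finset.card_insert_of_notMem hxf, Finset.sum_insert hxf, e2, e3,
        Finset.sum_congr rfl e4, Finset.erase_insert hxs, Finset.card_empty, pow_zero, one_mul,
        Finset.sum_neg_distrib, ← Finset.mul_sum, mul_add, ← mul_assoc (B x),
        ← (commute_neg_one_pow _ (B x)).eq, pow_succ]
      noncomm_ring
    · have e1 : (insert x s).filter (fun l => a < l) = ∅ := by
        rw [Finset.filter_eq_empty_iff]
        intro l hl
        rcases Finset.mem_insert.1 hl with rfl | hl
        · exact hax
        · have := hx l hl
          omega
      rw [e1, Finset.card_empty, pow_zero, one_mul, Finset.sum_empty, add_zero,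
        wordProd_cons_of_ge]
      intro y hy
      rcases Finset.mem_insert.1 (show y ∈ insert x s from hy) with rfl | hy
      · omega
      · have := hx y hy
        omega

variable {d : E →+ E} {k : ℕ}

/-- The result of lowering the part `i` of the strict partition `s` by `2 k` and rearranging. -/
noncomputable def lowerTerm (B : ℤ → E) (k : ℕ) (s : Finset ℤ) (i : ℤ) : E :=
  (-1) ^ (s.filter fun l => i - 2 * k < l ∧ l < i).card *
      wordProd B ((i - 2 * k) ::ₘ (s.erase i).val) +
    ∑ j ∈ s with i - 2 * k < j ∧ j < i, (-1) ^ (s.filter fun l => j < l ∧ l < i).card *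
      (exchangeTerm B (i - 2 * k) j * wordProd B ((s.erase i).erase j).val)

theorem IsCliffordFamily.lowerTerm_insert (h : IsCliffordFamily B) (k : ℕ) {x : ℤ} {s : Finset ℤ}
    (hx : ∀ y ∈ s, y < x) {i : ℤ} (hi : i ∈ s) :
    lowerTerm B k (insert x s) i = B x * lowerTerm B k s i := by
  have hix := hx i hi
  have hf : ∀ p : ℤ → Prop, ∀ _ : DecidablePred p,
      (insert x s).filter (fun l => p l ∧ l < i) = s.filter fun l => p l ∧ l < i := by
    intro p _
    rw [Finset.filter_insert, if_neg fun h => hix.asymm h.2]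
  have hx' : ∀ y ∈ s.erase i, y < x := fun y hy => hx y (Finset.mem_of_mem_erase hy)
  rw [lowerTerm, lowerTerm, hf, mul_add]
  congr 1
  · rw [erase_insert_of_gt hx hi, insert_val_of_gt hx', Multiset.cons_swap, wordProd_cons_of_ge,
      ← mul_assoc, ← mul_assoc, (commute_neg_one_pow _ (B x)).eq]
    intro y hy
    rcases Multiset.mem_cons.1 hy with rfl | hy
    · omega
    · exact (hx' y hy).le
  · rw [Finset.mul_sum]
    refine Finset.sum_congr rfl fun j hj => ?_
    obtain ⟨hjs, -, hji⟩ := Finset.mem_filter.1 hj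
    rw [hf, erase_insert_of_gt hx hi, erase_insert_of_gt hx' (Finset.mem_erase.2 ⟨hji.ne, hjs⟩),
      wordProd_insert_of_gt (fun y hy => hx' y (Finset.mem_of_mem_erase hy)),
      ← mul_assoc (B x), ← (commute_neg_one_pow _ (B x)).eq, mul_assoc _ (B x),
      ← mul_assoc (B x), ← (h.commute_exchangeTerm _ j x).eq, mul_assoc _ (B x)]

/-- A derivation that lowers indices by `2 k`, on a strictly decreasing product of generators with
indices of the same parity. -/
theorem IsCliffordFamily.deriv_wordProd_finset (h : IsCliffordFamily B)
    (hd : ∀ x y, d (x * y) = d x * y + x * d y) (hdB : ∀ a, d (B a) = B (a - 2 * k))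
    (s : Finset ℤ) (hs : ∀ i ∈ s, ∀ j ∈ s, i % 2 = j % 2) :
    d (wordProd B s.val) = ∑ i ∈ s, lowerTerm B k s i := by
  induction s using Finset.induction_on_max with
  | empty =>
    have h1 := hd 1 1
    simp only [mul_one, one_mul] at h1
    simpa using h1
  -- Split off the largest factor `B x`: either it is differentiated and then moved into its place,
  -- or it stays in front of the derivative of the rest.
  | insert x s hx ih =>
    have hxs : x ∉ s := fun h => lt_irrefl x (hx x h)
    rw [Finset.sum_insert hxs, Finset.sum_congr rfl fun i hi => h.lowerTerm_insert k hx hi,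
      ← Finset.mul_sum, ← ih fun i hi j hj => hs i (by simp [hi]) j (by simp [hj]),
      wordProd_insert_of_gt hx, hd, hdB, add_left_inj, h.mul_wordProd, lowerTerm,
      Finset.erase_insert hxs]
    · have hf : ∀ y : ℤ, (insert x s).filter (fun l => y < l ∧ l < x) =
          s.filter fun l => y < l := by
        intro y
        ext l
        simp only [Finset.mem_filter, Finset.mem_insert]
        constructor
        · rintro ⟨rfl | h1, h2, h3⟩
          · exact absurd h3 (lt_irrefl _)
          · exact ⟨h1, h2⟩
        · rintro ⟨h1, h2⟩
          exact ⟨Or.inr h1, h2, hx l h1⟩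
      simp only [hf]
    · intro j hj
      have := hs x (by simp) j (by simp [hj])
      omega

/-- The contribution of the pairs of equal parts to a derivation that lowers indices by `2 k`. A
pair is central, and so is its derivative `± 2 B (c - k) ^ 2`. -/
theorem IsCliffordFamily.exists_deriv_wordProd_pairs (h : IsCliffordFamily B)
    (hd : ∀ x y, d (x * y) = d x * y + x * d y) (hdB : ∀ a, d (B a) = B (a - 2 * k))
    (p : Multiset ℤ) :
    ∃ C : E, (∀ b, Commute C (B b)) ∧ (∀ m, wordProd B (p + p + m) = C * wordProd B m) ∧
      ∀ m, d (wordProd B (p + p + m)) =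
        (p.map fun c => (-1) ^ k * (2 * B (c - k) ^ 2) *
          wordProd B (p.erase c + p.erase c + m)).sum + C * d (wordProd B m) := by
  induction p using Multiset.induction_on with
  | empty => exact ⟨1, fun b => Commute.one_left _, by simp, by simp⟩
  | cons c p ih =>
    obtain ⟨C, hC, hCW, hCd⟩ := ih
    have hcons : ∀ (q : Multiset ℤ) (m : Multiset ℤ),
        (c ::ₘ q) + (c ::ₘ q) + m = c ::ₘ c ::ₘ (q + q + m) := by
      intro q m
      simp [Multiset.cons_add, Multiset.add_cons]
    have hsq : d (B c ^ 2) = (-1) ^ k * (2 * B (c - k) ^ 2) := by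
      have h1 := h.anticomm_even (c - 2 * k) k
      rw [sub_add_cancel, show c - 2 * (k : ℤ) + k = c - k by ring] at h1
      rw [pow_two, hd, hdB, h1]
    refine ⟨B c ^ 2 * C, fun b => (h.commute_sq c b).mul_left (hC b), fun m => ?_, fun m => ?_⟩
    · rw [hcons, h.wordProd_pair, hCW, mul_assoc]
    · have hsum : (p.map fun x => (-1) ^ k * (2 * B (x - k) ^ 2) *
          wordProd B ((c ::ₘ p).erase x + (c ::ₘ p).erase x + m)) =
          p.map fun x => B c ^ 2 * ((-1) ^ k * (2 * B (x - k) ^ 2) *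
            wordProd B (p.erase x + p.erase x + m)) := by
        refine Multiset.map_congr rfl fun x hx => ?_
        rw [Multiset.erase_cons_tail_of_mem hx, hcons, h.wordProd_pair, ← mul_assoc,
          ← mul_assoc (B c ^ 2)]
        congr 1
        exact ((commute_neg_one_pow k _).mul_left ((Nat.cast_commute 2 _).mul_left
          ((h.commute_sq _ _).pow_right 2))).eq
      rw [hcons, h.wordProd_pair, hd, hsq, hCd, Multiset.map_cons, Multiset.sum_cons,
        Multiset.erase_cons_head, hsum, Multiset.sum_map_mul_left, mul_add, mul_assoc, ← add_assoc,
        mul_assoc (B c ^ 2)]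

/-- A derivation that lowers indices by `2 k`, on an ordered product in which the indices that occur
an odd number of times have the same parity. -/
theorem IsCliffordFamily.deriv_wordProd (h : IsCliffordFamily B)
    (hd : ∀ x y, d (x * y) = d x * y + x * d y) (hdB : ∀ a, d (B a) = B (a - 2 * k))
    (p : Multiset ℤ) (s : Finset ℤ) (hs : ∀ i ∈ s, ∀ j ∈ s, i % 2 = j % 2) :
    d (wordProd B (p + p + s.val)) =
      (p.map fun c => (-1) ^ k * (2 * wordProd B ((c - k) ::ₘ (c - k) ::ₘ
          (p.erase c + p.erase c + s.val)))).sum +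
        ∑ i ∈ s, ((-1) ^ (s.filter fun l => i - 2 * k < l ∧ l < i).card *
            wordProd B ((i - 2 * k) ::ₘ (p + p + (s.erase i).val)) +
          ∑ j ∈ s with i - 2 * k < j ∧ j < i, (-1) ^ (s.filter fun l => j < l ∧ l < i).card *
            ((-1) ^ ((j - (i - 2 * k)) / 2).toNat *
              (2 * wordProd B (((i - 2 * k + j) / 2) ::ₘ ((i - 2 * k + j) / 2) ::ₘ
                (p + p + ((s.erase i).erase j).val))))) := by
  obtain ⟨C, hC, hCW, hCd⟩ := h.exists_deriv_wordProd_pairs hd hdB p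
  have hCs : ∀ (e : ℕ) (x : E), C * ((-1) ^ e * x) = (-1) ^ e * (C * x) := fun e x => by
    rw [← mul_assoc, ← (commute_neg_one_pow e C).eq, mul_assoc]
  rw [hCd, h.deriv_wordProd_finset hd hdB s hs, Finset.mul_sum]
  congr 1
  · congr 1
    refine Multiset.map_congr rfl fun c _ => ?_
    rw [h.wordProd_pair]
    noncomm_ring
  · refine Finset.sum_congr rfl fun i _ => ?_
    rw [lowerTerm, mul_add, hCs, ← hCW, Multiset.add_cons, Finset.mul_sum]
    congr 1
    refine Finset.sum_congr rfl fun j _ => ?_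
    have hC2 : ∀ b y, C * (2 * B b ^ 2 * y) = 2 * (B b ^ 2 * (C * y)) := fun b y => by
      have h2 := ((Nat.cast_commute 2 C).symm.mul_right ((hC b).pow_right 2)).eq
      rw [Nat.cast_ofNat] at h2
      rw [← mul_assoc, h2]
      simp only [mul_assoc]
    rw [hCs, h.wordProd_pair, hCW, exchangeTerm, mul_assoc ((-1) ^ _ : E), hCs, hC2]

end Clifford

/-! ### Operators on functions of words -/

section Words

/-- The functions `f` of words in `ℤ` that satisfy, at any two adjacent letters, the straightening
relation at `t = -1`. -/
def straightFun : Submodule ℤ (List ℤ → ℤ) where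
  carrier := {f | ∀ u v a b, f (u ++ a :: b :: v) + f (u ++ b :: a :: v) +
    (f (u ++ (a + 1) :: (b - 1) :: v) + f (u ++ (b - 1) :: (a + 1) :: v)) = 0}
  add_mem' {f g} hf hg u v a b := by
    have h1 := hf u v a b
    have h2 := hg u v a b
    simp only [Pi.add_apply]
    linarith
  zero_mem' u v a b := by simp
  smul_mem' c f hf u v a b := by
    have h1 := hf u v a b
    simp only [Pi.smul_apply, smul_eq_mul]
    linear_combination c * h1

/-- The operator that appends the letter `a` to the argument. -/
def appendOp (a : ℤ) : Module.End ℤ straightFun where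
  toFun f := ⟨fun w => f.1 (w ++ [a]), fun u v x y => by simpa using f.2 u (v ++ [a]) x y⟩
  map_add' _ _ := rfl
  map_smul' _ _ := rfl

/-- The sum of the values of `f` at the words obtained from `w` by lowering one letter by `r`. -/
def lowerFun (r : ℤ) (f : List ℤ → ℤ) (w : List ℤ) : ℤ :=
  ∑ i ∈ Finset.range w.length, f (w.modify i (· - r))

theorem lowerFun_cons (r : ℤ) (f : List ℤ → ℤ) (a : ℤ) (v : List ℤ) :
    lowerFun r f (a :: v) = f ((a - r) :: v) + lowerFun r (fun w => f (a :: w)) v := by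
  rw [lowerFun, List.length_cons, Finset.sum_range_succ', add_comm]
  rfl

theorem lowerFun_nil (r : ℤ) (f : List ℤ → ℤ) : lowerFun r f [] = 0 := rfl

theorem lowerFun_append (r : ℤ) (f : List ℤ → ℤ) (u v : List ℤ) :
    lowerFun r f (u ++ v) =
      lowerFun r (fun w => f (w ++ v)) u + lowerFun r (fun w => f (u ++ w)) v := by
  induction u generalizing f with
  | nil => simp [lowerFun_nil]
  | cons a u ih =>
    simp only [List.cons_append, lowerFun_cons, ih, add_assoc]

theorem lowerFun_mem {r : ℤ} {f : List ℤ → ℤ} (hf : f ∈ straightFun) :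
    lowerFun r f ∈ straightFun := by
  intro u v a b
  simp only [lowerFun_append, lowerFun_cons]
  have h1 := hf u v (a - r) b
  have h2 := hf u v a (b - r)
  rw [show a - r + 1 = a + 1 - r by ring] at h1
  rw [show b - r - 1 = b - 1 - r by ring] at h2
  have h3 : lowerFun r (fun w => f (w ++ a :: b :: v)) u +
      lowerFun r (fun w => f (w ++ b :: a :: v)) u +
      (lowerFun r (fun w => f (w ++ (a + 1) :: (b - 1) :: v)) u +
        lowerFun r (fun w => f (w ++ (b - 1) :: (a + 1) :: v)) u) = 0 := by
    simp only [lowerFun, ← Finset.sum_add_distrib]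
    exact Finset.sum_eq_zero fun i _ => hf _ _ _ _
  have h4 : lowerFun r (fun w => f (u ++ a :: b :: w)) v +
      lowerFun r (fun w => f (u ++ b :: a :: w)) v +
      (lowerFun r (fun w => f (u ++ (a + 1) :: (b - 1) :: w)) v +
        lowerFun r (fun w => f (u ++ (b - 1) :: (a + 1) :: w)) v) = 0 := by
    simp only [lowerFun, ← Finset.sum_add_distrib]
    exact Finset.sum_eq_zero fun i _ => hf _ _ _ _
  linarith

/-- The operator `lowerFun`. -/
def lowerOp (r : ℤ) : Module.End ℤ straightFun where
  toFun f := ⟨lowerFun r f.1, lowerFun_mem f.2⟩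
  map_add' f g := by
    ext w
    simp [lowerFun, Finset.sum_add_distrib]
  map_smul' c f := by
    ext w
    simp [lowerFun, Finset.mul_sum]

theorem isCliffordFamily_appendOp : IsCliffordFamily appendOp where
  rel a b := by
    ext f w
    have := f.2 w [] a b
    simp only [appendOp, LinearMap.add_apply, Module.End.mul_apply, LinearMap.coe_mk,
      AddHom.coe_mk, LinearMap.zero_apply, Submodule.coe_add, Pi.add_apply, List.append_assoc,
      List.cons_append, List.nil_append, Submodule.coe_zero, Pi.zero_apply]
    linarith
  torsion x hx := by
    ext f w
    have h1 := congrArg (fun y : Module.End ℤ straightFun => (y f).1 w) hx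
    simp only [LinearMap.add_apply, Submodule.coe_add, Pi.add_apply, LinearMap.zero_apply,
      Submodule.coe_zero, Pi.zero_apply] at h1
    change (x f).1 w = 0
    omega

/-- The commutator with the lowering operator. -/
def lowerDeriv (r : ℤ) : Module.End ℤ straightFun →+ Module.End ℤ straightFun where
  toFun x := x * lowerOp r - lowerOp r * x
  map_zero' := by simp
  map_add' x y := by noncomm_ring

theorem lowerDeriv_mul (r : ℤ) (x y : Module.End ℤ straightFun) :
    lowerDeriv r (x * y) = lowerDeriv r x * y + x * lowerDeriv r y := by
  simp only [lowerDeriv, AddMonoidHom.coe_mk, ZeroHom.coe_mk]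
  noncomm_ring

/-- Appending `a` and then lowering a letter of the longer word lowers the new letter or an
old one. -/
theorem lowerDeriv_appendOp (r a : ℤ) : lowerDeriv r (appendOp a) = appendOp (a - r) := by
  change appendOp a * lowerOp r - lowerOp r * appendOp a = _
  rw [sub_eq_iff_eq_add]
  ext f w
  change lowerFun r f.1 (w ++ [a]) = f.1 (w ++ [a - r]) + lowerFun r (fun w => f.1 (w ++ [a])) w
  rw [lowerFun_append, lowerFun_cons, lowerFun_nil]
  ring

theorem map_appendOp_prod_apply (l : List ℤ) (f : straightFun) (w : List ℤ) :
    ((l.map appendOp).prod f).1 w = f.1 (w ++ l) := by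
  induction l generalizing w with
  | nil => simp
  | cons a l ih =>
    rw [List.map_cons, List.prod_cons, Module.End.mul_apply]
    change ((l.map appendOp).prod f).1 (w ++ [a]) = _
    rw [ih]
    simp

/-- Applying an operator to `f` and evaluating at the empty word. The product
`appendOp a * appendOp b * ⋯` is sent to the value of `f` at the word `a, b, …`. -/
def evalNil (f : straightFun) : Module.End ℤ straightFun →+ ℤ where
  toFun x := (x f).1 []
  map_zero' := rfl
  map_add' _ _ := rfl

theorem evalNil_wordProd (f : straightFun) (m : Multiset ℤ) :
    evalNil f (wordProd appendOp m) = f.1 (m.sort (· ≥ ·)) :=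
  map_appendOp_prod_apply _ _ _

theorem evalNil_neg_one_pow_mul (f : straightFun) (e : ℕ) (x : Module.End ℤ straightFun) :
    evalNil f ((-1) ^ e * x) = (-1) ^ e * evalNil f x := by
  rcases neg_one_pow_eq_or (Module.End ℤ straightFun) e with h | h <;>
  rcases e.even_or_odd with he | he
  · rw [he.neg_one_pow, he.neg_one_pow, one_mul, one_mul]
  · rw [he.neg_one_pow, he.neg_one_pow, neg_one_mul, neg_one_mul, map_neg]
  · rw [he.neg_one_pow, he.neg_one_pow, one_mul, one_mul]
  · rw [he.neg_one_pow, he.neg_one_pow, neg_one_mul, neg_one_mul, map_neg]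

theorem evalNil_two_mul (f : straightFun) (x : Module.End ℤ straightFun) :
    evalNil f (2 * x) = 2 * evalNil f x := by
  rw [two_mul, two_mul, map_add]

theorem evalNil_lowerDeriv_wordProd (f : straightFun) (r : ℤ) (m : Multiset ℤ) :
    evalNil f (lowerDeriv r (wordProd appendOp m)) = lowerFun r f.1 (m.sort (· ≥ ·)) := by
  change (((wordProd appendOp m) (lowerOp r f)).1 [] -
    lowerFun r (wordProd appendOp m f).1 [] : ℤ) = _
  rw [lowerFun_nil, sub_zero]
  exact evalNil_wordProd (lowerOp r f) m

/-- The sum of the values of a straight function at the words obtained by lowering one letter of a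
decreasing word by `2 k`, in terms of its values at decreasing words. -/
theorem lowerFun_sort (f : straightFun) (k : ℕ) (p : Multiset ℤ) (s : Finset ℤ)
    (hs : ∀ i ∈ s, ∀ j ∈ s, i % 2 = j % 2) :
    lowerFun (2 * k) f.1 ((p + p + s.val).sort (· ≥ ·)) =
      (p.map fun c : ℤ => (-1) ^ k * (2 * f.1 (((c - (k : ℤ)) ::ₘ (c - (k : ℤ)) ::ₘ
          (p.erase c + p.erase c + s.val)).sort (· ≥ ·)))).sum +
        ∑ i ∈ s, ((-1) ^ (s.filter fun l => i - 2 * k < l ∧ l < i).card *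
            f.1 (((i - 2 * k) ::ₘ (p + p + (s.erase i).val)).sort (· ≥ ·)) +
          ∑ j ∈ s with i - 2 * k < j ∧ j < i, (-1) ^ (s.filter fun l => j < l ∧ l < i).card *
            ((-1) ^ ((j - (i - 2 * k)) / 2).toNat *
              (2 * f.1 ((((i - 2 * k + j) / 2) ::ₘ ((i - 2 * k + j) / 2) ::ₘ
                (p + p + ((s.erase i).erase j).val)).sort (· ≥ ·))))) := by
  rw [← evalNil_lowerDeriv_wordProd, isCliffordFamily_appendOp.deriv_wordProd
    (lowerDeriv_mul _) (lowerDeriv_appendOp _) p s hs, map_add, map_multiset_sum, Multiset.map_map,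
    map_sum]
  simp only [map_add, map_sum, Function.comp_def, evalNil_neg_one_pow_mul, evalNil_two_mul,
    evalNil_wordProd]

end Words

/-! ### The Kostka–Foulkes polynomials at `t = -1` as a function of words -/

section KosWord

/-- The vector `w + δ` of length `n`. -/
def wordVec (n : ℕ) (w : List ℤ) (i : Fin n) : ℤ := w.getD i 0 + stair n i

/-- For a word `w` of length `n`, the value at `t = -1` of the coefficient `kos` at `w + δ`. -/
noncomputable def kosWord (n : ℕ) (nu : YoungDiagram) (w : List ℤ) : ℤ :=
  if w.length = n then (kos Polynomial.X (shifted n nu) (wordVec n w)).eval (-1) else 0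

theorem getD_append_cons_cons (u v : List ℤ) (a b : ℤ) (x : ℕ) :
    (u ++ a :: b :: v).getD x 0 =
      if x = u.length then a else if x = u.length + 1 then b else (u ++ 0 :: 0 :: v).getD x 0 := by
  rcases lt_trichotomy x u.length with h | rfl | h
  · rw [if_neg (by omega), if_neg (by omega), List.getD_append _ _ _ _ h,
      List.getD_append _ _ _ _ h]
  · simp
  · obtain ⟨y, rfl⟩ := Nat.exists_eq_add_of_lt h
    rw [List.getD_append_right _ _ _ _ (by omega), List.getD_append_right _ _ _ _ (by omega),
      if_neg (by omega), show u.length + y + 1 - u.length = y + 1 by omega]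
    rcases y with _ | y
    · simp
    · rw [if_neg (by omega)]
      simp

/-- Adding `δ` to a word turns the exchange of two adjacent exponents into the passage from
`… a, b …` to `… b - 1, a + 1 …`. -/
theorem kosWord_mem (n : ℕ) (nu : YoungDiagram) : kosWord n nu ∈ straightFun := by
  intro u v a b
  by_cases hn : u.length + (v.length + 1 + 1) = n
  · have hlen : ∀ x y : ℤ, (u ++ x :: y :: v).length = n := fun x y => by
      simpa using hn
    simp only [kosWord, hlen, if_true]
    obtain ⟨i, hi⟩ : ∃ i : Fin n, (i : ℕ) = u.length := ⟨⟨u.length, by omega⟩, rfl⟩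
    obtain ⟨j, hj⟩ : ∃ j : Fin n, (j : ℕ) = u.length + 1 := ⟨⟨u.length + 1, by omega⟩, rfl⟩
    have hij : i ≠ j := by intro h; rw [h] at hi; omega
    have hst : stair n i = stair n j + 1 := by
      simp only [stair]
      omega
    have hvec : ∀ x y : ℤ, ∀ l : Fin n, wordVec n (u ++ x :: y :: v) l =
        if l = i then x + stair n i else if l = j then y + stair n j
          else wordVec n (u ++ 0 :: 0 :: v) l := by
      intro x y l
      rw [wordVec, getD_append_cons_cons]
      have h1 : (l : ℕ) = u.length ↔ l = i := by rw [Fin.ext_iff, hi]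
      have h2 : (l : ℕ) = u.length + 1 ↔ l = j := by rw [Fin.ext_iff, hj]
      simp only [h1, h2]
      split_ifs with c1 c2
      · rw [c1]
      · rw [c2]
      · rfl
    have hroot : ∀ l : Fin n, root i j l = if l = i then -1 else if l = j then 1 else 0 := by
      intro l
      simp only [root, Pi.sub_apply, Pi.single_apply]
      split_ifs with c1 c2 c3
      · exact absurd (c2.symm.trans c1) hij
      · simp
      · simp
      · simp
    have e1 : wordVec n (u ++ a :: b :: v) - root i j =
        wordVec n (u ++ (a + 1) :: (b - 1) :: v) := by
      funext l
      rw [Pi.sub_apply, hvec a b, hvec (a + 1) (b - 1), hroot]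
      split_ifs <;> ring
    have e2 : wordVec n (u ++ a :: b :: v) ∘ Equiv.swap i j =
        wordVec n (u ++ (b - 1) :: (a + 1) :: v) := by
      funext l
      rw [Function.comp_apply, hvec (b - 1)]
      split_ifs with c1 c2
      · rw [c1, Equiv.swap_apply_left, hvec, if_neg hij.symm, if_pos rfl, hst]; ring
      · rw [c2, Equiv.swap_apply_right, hvec, if_pos rfl, hst]; ring
      · rw [Equiv.swap_apply_of_ne_of_ne c1 c2, hvec, if_neg c1, if_neg c2]
    have e3 : wordVec n (u ++ (b - 1) :: (a + 1) :: v) - root i j =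
        wordVec n (u ++ b :: a :: v) := by
      funext l
      rw [Pi.sub_apply, hvec (b - 1) (a + 1), hvec b a, hroot]
      split_ifs <;> ring
    have h := congrArg (Polynomial.eval (-1)) (kos_straighten (R := ℤ[X]) Polynomial.X
      (shifted n nu) (wordVec n (u ++ a :: b :: v)) (i := i) (j := j) (by omega))
    rw [e1, e2, e3] at h
    simp only [Polynomial.eval_add, Polynomial.eval_sub, Polynomial.eval_mul, Polynomial.eval_X,
      Polynomial.eval_zero] at h
    linarith
  · have hlen : ∀ x y : ℤ, ¬ (u ++ x :: y :: v).length = n := fun x y => by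
      simpa using hn
    simp only [kosWord, hlen, if_false, add_zero]

/-- The last letter of a decreasing word with a negative letter is negative. -/
theorem kosWord_sort_eq_zero_of_neg {n : ℕ} {nu : YoungDiagram} {m : Multiset ℤ} {c : ℤ}
    (hc : c ∈ m) (h0 : c < 0) : kosWord n nu (m.sort (· ≥ ·)) = 0 := by
  rw [kosWord]
  split_ifs with hlen
  · have hpos : 0 < n := by
      rw [← hlen, Multiset.length_sort]
      exact Multiset.card_pos_iff_exists_mem.2 ⟨c, hc⟩
    rw [kos_eq_zero_of_last_neg (i := ⟨n - 1, by omega⟩), Polynomial.eval_zero]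
    · intro i
      rw [shifted]
      positivity
    · intro j
      rw [Fin.le_def]
      have := j.2
      simp only
      omega
    · obtain ⟨x, hx, rfl⟩ := List.mem_iff_getElem.1 ((Multiset.mem_sort (r := (· ≥ ·))).2 hc)
      have h1 := (Multiset.pairwise_sort m (· ≥ ·)).rel_get_of_le (a := ⟨x, hx⟩)
        (b := ⟨n - 1, by omega⟩) (by rw [Fin.le_def]; simp only; omega)
      simp only [wordVec, stair]
      rw [List.getD_eq_getElem _ _ (by omega)]
      simp only [List.get_eq_getElem] at h1
      omega
  · rfl

theorem lowerFun_kosWord (n : ℕ) (nu : YoungDiagram) (r : ℤ) {w : List ℤ} (hw : w.length = n) :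
    lowerFun r (kosWord n nu) w =
      (∑ i, kos Polynomial.X (shifted n nu) (wordVec n w - Pi.single i r)).eval (-1) := by
  rw [lowerFun, hw, ← Fin.sum_univ_eq_sum_range fun i => kosWord n nu (w.modify i (· - r)),
    Polynomial.eval_finsetSum]
  refine Finset.sum_congr rfl fun i _ => ?_
  rw [kosWord, if_pos (by simpa using hw)]
  congr 2
  funext l
  have hl : (l : ℕ) < w.length := hw ▸ l.2
  simp only [wordVec, Pi.sub_apply, Pi.single_apply]
  rw [List.getD_eq_getElem _ _ hl, List.getD_eq_getElem _ _ (by simpa using hl),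
    List.getElem_modify]
  simp only [Fin.ext_iff, eq_comm (a := (i : ℕ))]
  split_ifs <;> ring

end KosWord

/-! ### Parts of odd multiplicity of the Jordan types in classical Lie algebras -/

section Parity

open scoped Matrix

/-- The rank of a skew-symmetric matrix is even: on a complement of its kernel the alternating form
that it defines is nondegenerate, and a skew-symmetric matrix of odd size is singular. -/
theorem even_rank_of_transpose_eq_neg {ι : Type*} [Fintype ι] [DecidableEq ι] (A : Matrix ι ι ℂ)
    (hA : A.transpose = -A) : Even A.rank := by
  let B : (ι → ℂ) →ₗ[ℂ] (ι → ℂ) →ₗ[ℂ] ℂ := Matrix.toLinearMap₂' ℂ A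
  have hB : ∀ x y : ι → ℂ, B x y = x ⬝ᵥ A.mulVec y := Matrix.toLinearMap₂'_apply' A
  have hskew : ∀ x y : ι → ℂ, B x y = -B y x := by
    intro x y
    rw [hB, hB, Matrix.dotProduct_mulVec, ← Matrix.mulVec_transpose, hA, Matrix.neg_mulVec,
      neg_dotProduct, dotProduct_comm]
  have hker : LinearMap.ker B = LinearMap.ker A.mulVecLin := by
    ext x
    rw [LinearMap.mem_ker, LinearMap.mem_ker, Matrix.mulVecLin_apply]
    constructor
    · intro h
      refine dotProduct_eq_zero_iff.1 fun y => ?_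
      rw [dotProduct_comm, ← hB, hskew, h, LinearMap.zero_apply, neg_zero]
    · intro h
      refine LinearMap.ext fun y => ?_
      rw [hskew, hB, h, dotProduct_zero, neg_zero, LinearMap.zero_apply]
  obtain ⟨W, hW⟩ := Submodule.exists_isCompl (LinearMap.ker A.mulVecLin)
  have hrank : A.rank = Module.finrank ℂ W := by
    have h1 := LinearMap.finrank_range_add_finrank_ker A.mulVecLin
    have h2 := Submodule.finrank_add_eq_of_isCompl hW
    rw [Matrix.rank]
    omega
  have hnd : (B.domRestrict₁₂ W W).SeparatingLeft := by
    intro x hx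
    have hx0 : (x : ι → ℂ) ∈ LinearMap.ker A.mulVecLin := by
      rw [← hker, LinearMap.mem_ker]
      refine LinearMap.ext fun y => ?_
      obtain ⟨u, hu, v, hv, rfl⟩ := Submodule.mem_sup.1
        ((hW.sup_eq_top ▸ Submodule.mem_top : y ∈ LinearMap.ker A.mulVecLin ⊔ W))
      rw [← hker, LinearMap.mem_ker] at hu
      have := hx ⟨v, hv⟩
      rw [LinearMap.domRestrict₁₂_apply] at this
      rw [map_add, hskew, hu, this]
      simp
    have := hW.disjoint.le_bot ⟨hx0, x.2⟩
    exact Subtype.ext ((Submodule.mem_bot ℂ).1 this)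
  rw [hrank]
  by_contra hodd
  rw [Nat.not_even_iff_odd] at hodd
  let b := Module.finBasis ℂ W
  refine (LinearMap.separatingLeft_iff_det_ne_zero b).1 hnd ?_
  set S := LinearMap.toMatrix₂ b b (B.domRestrict₁₂ W W) with hS
  have hST : S.transpose = -S := by
    ext i j
    rw [Matrix.transpose_apply, Matrix.neg_apply, hS, LinearMap.toMatrix₂_apply,
      LinearMap.toMatrix₂_apply, LinearMap.domRestrict₁₂_apply, LinearMap.domRestrict₁₂_apply,
      hskew]
  have h1 := Matrix.det_transpose S
  rw [hST, Matrix.det_neg, Fintype.card_fin, hodd.neg_one_pow, neg_one_mul] at h1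
  exact neg_eq_self.1 h1

theorem countP_lt_rowLens (lam : YoungDiagram) (c : ℕ) :
    lam.rowLens.countP (c < ·) = lam.colLen c := by
  have h : ∀ a N : ℕ, (List.range N).countP (fun r => decide (r < a)) = min a N := by
    intro a N
    induction N with
    | zero => simp
    | succ N ih =>
      rw [List.range_succ, List.countP_append, ih, List.countP_singleton]
      simp only [decide_eq_true_eq]
      split_ifs <;> omega
  rw [YoungDiagram.rowLens, List.countP_map]
  rw [← min_eq_left (lam.colLen_anti 0 c (Nat.zero_le c)), ← h]
  congr 1
  funext r
  simp only [Function.comp_apply, ← YoungDiagram.mem_iff_lt_rowLen,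
    ← YoungDiagram.mem_iff_lt_colLen]

theorem mult_add_colLen (lam : YoungDiagram) (i : ℕ) :
    mult lam (i + 1) + lam.colLen (i + 1) = lam.colLen i := by
  rw [mult, ← countP_lt_rowLens, ← countP_lt_rowLens]
  induction lam.rowLens with
  | nil => rfl
  | cons a l ih =>
    simp only [List.count_cons, List.countP_cons, beq_iff_eq, decide_eq_true_eq]
    split_ifs <;> omega

theorem HasJordanType.rank_eq {ι : Type*} [Fintype ι] [DecidableEq ι] {A : Matrix ι ι ℂ}
    {lam : YoungDiagram} (h : HasJordanType A lam) (j : ℕ) :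
    (A ^ j).rank = (A ^ (j + 1)).rank + lam.colLen j := by
  have h1 := LinearMap.finrank_range_add_finrank_ker (Matrix.toLin' (A ^ j))
  have h2 := LinearMap.finrank_range_add_finrank_ker (Matrix.toLin' (A ^ (j + 1)))
  have h3 := h.2 j
  rw [Matrix.rank, Matrix.rank, ← Matrix.toLin'_apply', ← Matrix.toLin'_apply']
  omega

/-- If the powers of `A` with exponents of the parity of `e` have even rank, then the parts of the
other parity have even multiplicity, since `m_i = rk A ^ (i - 1) - 2 rk A ^ i + rk A ^ (i + 1)`. -/
theorem HasJordanType.mod_two_of_odd_mult {ι : Type*} [Fintype ι] [DecidableEq ι]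
    {A : Matrix ι ι ℂ} {lam : YoungDiagram} (h : HasJordanType A lam) {e : ℕ}
    (he : ∀ j, j % 2 = e % 2 → Even (A ^ j).rank) {i : ℕ} (hi : 1 ≤ i) (hm : Odd (mult lam i)) :
    i % 2 = e % 2 := by
  obtain ⟨i, rfl⟩ := Nat.exists_eq_add_of_le' hi
  by_contra hne
  have h1 := he i (by omega)
  have h2 := he (i + 1 + 1) (by omega)
  have h3 := h.rank_eq i
  have h4 := h.rank_eq (i + 1)
  have h5 := mult_add_colLen lam i
  rw [Nat.even_iff] at h1 h2
  rw [Nat.odd_iff] at hm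
  omega

theorem even_rank_pow_of_mem_so {ι : Type*} [Fintype ι] [DecidableEq ι] {A : Matrix ι ι ℂ}
    (hA : A ∈ LieAlgebra.Orthogonal.so ι ℂ) (j : ℕ) (hj : j % 2 = 1 % 2) : Even (A ^ j).rank := by
  rw [LieAlgebra.Orthogonal.mem_so] at hA
  refine even_rank_of_transpose_eq_neg _ ?_
  rw [Matrix.transpose_pow, hA, (Nat.odd_iff.2 (by omega) : Odd j).neg_pow]

/-- For even `j`, the matrix `J * A ^ j` is skew-symmetric and has the rank of `A ^ j`. -/
theorem even_rank_pow_of_mem_sp {ι : Type*} [Fintype ι] [DecidableEq ι]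
    {A : Matrix (ι ⊕ ι) (ι ⊕ ι) ℂ} (hA : A ∈ LieAlgebra.Symplectic.sp ι ℂ) (j : ℕ)
    (hj : j % 2 = 0 % 2) : Even (A ^ j).rank := by
  have hA' : A.transpose * Matrix.J ι ℂ = Matrix.J ι ℂ * -A := by
    rw [LieAlgebra.Symplectic.sp, mem_skewAdjointMatricesLieSubalgebra,
      mem_skewAdjointMatricesSubmodule] at hA
    exact hA
  rw [← Matrix.rank_mul_eq_right_of_isUnit_det (Matrix.J ι ℂ) (A ^ j) (Matrix.isUnit_det_J ι ℂ)]
  refine even_rank_of_transpose_eq_neg _ ?_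
  have h : A.transpose ^ j * Matrix.J ι ℂ = Matrix.J ι ℂ * (-A) ^ j :=
    (SemiconjBy.pow_right (a := Matrix.J ι ℂ) (x := -A) (y := A.transpose) hA'.symm j).eq.symm
  rw [Matrix.transpose_mul, Matrix.transpose_pow, Matrix.J_transpose, Matrix.mul_neg, h,
    (Nat.even_iff.2 (by omega) : Even j).neg_pow]

theorem IsClassicalJordanType.mod_two_eq {lam : YoungDiagram} (h : IsClassicalJordanType lam)
    {i j : ℕ} (hi : 1 ≤ i) (hj : 1 ≤ j) (hmi : Odd (mult lam i)) (hmj : Odd (mult lam j)) :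
    i % 2 = j % 2 := by
  rcases h with ⟨n, A, hA, h⟩ | ⟨n, A, hA, h⟩ | ⟨n, A, hA, h⟩
  · rw [h.mod_two_of_odd_mult (even_rank_pow_of_mem_so hA) hi hmi,
      h.mod_two_of_odd_mult (even_rank_pow_of_mem_so hA) hj hmj]
  · rw [h.mod_two_of_odd_mult (even_rank_pow_of_mem_sp hA) hi hmi,
      h.mod_two_of_odd_mult (even_rank_pow_of_mem_sp hA) hj hmj]
  · rw [h.mod_two_of_odd_mult (even_rank_pow_of_mem_so hA) hi hmi,
      h.mod_two_of_odd_mult (even_rank_pow_of_mem_so hA) hj hmj]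

end Parity

/-! ### The multiset of the rows of a partition -/

section Rows

variable {n : ℕ}

/-- The multiset of the first `n` rows of a partition, including empty ones. -/
def rows (n : ℕ) (rho : YoungDiagram) : Multiset ℕ := ((List.range n).map rho.rowLen : List ℕ)

theorem rowLen_ofRowLens_of_le {w : List ℕ} {hw : w.SortedGE} {i : ℕ} (h : w.length ≤ i) :
    (YoungDiagram.ofRowLens w hw).rowLen i = 0 := by
  by_contra hne
  have := YoungDiagram.mem_iff_lt_rowLen.2 (Nat.pos_of_ne_zero hne)
  obtain ⟨h1, -⟩ := YoungDiagram.mem_ofRowLens.1 this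
  simp only at h1
  omega

theorem rows_ofRowLens {w : List ℕ} {hw : w.SortedGE} (hn : w.length ≤ n) :
    rows n (YoungDiagram.ofRowLens w hw) =
      (w : Multiset ℕ) + Multiset.replicate (n - w.length) 0 := by
  obtain ⟨m, rfl⟩ := Nat.exists_eq_add_of_le hn
  rw [rows, List.range_add, List.map_append, List.map_map, Nat.add_sub_cancel_left,
    ← Multiset.coe_replicate, Multiset.coe_add]
  congr 2
  · refine List.ext_getElem (by simp) fun i h1 h2 => ?_
    rw [List.getElem_map, List.getElem_range]
    exact YoungDiagram.rowLen_ofRowLens (hw := hw) ⟨i, h2⟩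
  · rw [List.eq_replicate_iff]
    refine ⟨by simp, fun b hb => ?_⟩
    obtain ⟨i, -, rfl⟩ := List.mem_map.1 hb
    exact rowLen_ofRowLens_of_le (Nat.le_add_right _ _)

theorem rows_eq {lam : YoungDiagram} (hn : lam.colLen 0 ≤ n) :
    rows n lam = (lam.rowLens : Multiset ℕ) + Multiset.replicate (n - lam.colLen 0) 0 := by
  rw [← YoungDiagram.length_rowLens] at hn ⊢
  rw [← rows_ofRowLens (hw := lam.rowLens_sorted) hn, YoungDiagram.ofRowLens_to_rowLens_eq_self]

theorem card_sub_add {α : Type*} [DecidableEq α] {M A B : Multiset α} (hA : A ≤ M)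
    (hAB : A.card = B.card) : (M - A + B).card = M.card := by
  rw [Multiset.card_add, ← hAB, ← Multiset.card_add, Multiset.sub_add_cancel hA]

theorem rows_replaceParts {lam : YoungDiagram} (hn : lam.colLen 0 ≤ n) {A B : Multiset ℕ}
    (hA : A ≤ lam.rowLens) (hAB : A.card = B.card) :
    rows n (replaceParts lam A B) + A = rows n lam + B := by
  have hcard := card_sub_add hA hAB
  rw [Multiset.coe_card, YoungDiagram.length_rowLens] at hcard
  rw [replaceParts, rows_ofRowLens (by rw [Multiset.length_sort, hcard]; exact hn),
    Multiset.length_sort, hcard, rows_eq hn, Multiset.sort_eq, add_right_comm,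
    add_right_comm _ B, Multiset.sub_add_cancel hA, add_right_comm]

theorem colLen_replaceParts_le {lam : YoungDiagram} {A B : Multiset ℕ}
    (hA : A ≤ lam.rowLens) (hAB : A.card = B.card) :
    (replaceParts lam A B).colLen 0 ≤ lam.colLen 0 := by
  have hcard := card_sub_add hA hAB
  rw [Multiset.coe_card, YoungDiagram.length_rowLens] at hcard
  by_contra! h
  have h1 := YoungDiagram.mem_iff_lt_rowLen.1 (YoungDiagram.mem_iff_lt_colLen.2 h)
  rw [replaceParts, rowLen_ofRowLens_of_le (by rw [Multiset.length_sort, hcard])] at h1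
  exact lt_irrefl _ h1

theorem card_eq_sum_rows {lam : YoungDiagram} (hn : lam.colLen 0 ≤ n) :
    lam.card = (rows n lam).sum := by
  rw [card_eq_sum_rowLen hn, rows, Multiset.sum_coe, Fin.sum_univ_eq_sum_range lam.rowLen,
    ← List.toFinset_range, List.sum_toFinset _ List.nodup_range]

theorem countP_lt_rows {lam : YoungDiagram} (hn : lam.colLen 0 ≤ n) (c : ℕ) :
    (rows n lam).countP (c < ·) = lam.colLen c := by
  rw [rows_eq hn, Multiset.countP_add, Multiset.coe_countP, countP_lt_rowLens,
    Multiset.countP_eq_zero.2, add_zero]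
  intro a ha
  rw [Multiset.eq_of_mem_replicate ha]
  exact Nat.not_lt_zero c

theorem count_rows {lam : YoungDiagram} (hn : lam.colLen 0 ≤ n) {i : ℕ} (hi : i ≠ 0) :
    (rows n lam).count i = mult lam i := by
  rw [rows_eq hn, Multiset.count_add, Multiset.coe_count, Multiset.count_replicate,
    if_neg hi.symm, add_zero, mult]

theorem sort_map_rows (n : ℕ) (lam : YoungDiagram) :
    ((rows n lam).map ((↑) : ℕ → ℤ)).sort (· ≥ ·) =
      (List.range n).map fun i => (lam.rowLen i : ℤ) := by
  rw [rows, Multiset.map_coe, List.map_map]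
  refine List.Perm.eq_of_pairwise' (r := (· ≥ ·)) (Multiset.pairwise_sort _ _) ?_
    (Multiset.coe_eq_coe.1 (Multiset.sort_eq _ _))
  rw [List.pairwise_map]
  refine List.pairwise_lt_range.imp fun {a b} h => ?_
  exact_mod_cast rowLen_antitone lam h.le

theorem length_sort_map_rows (n : ℕ) (lam : YoungDiagram) :
    (((rows n lam).map ((↑) : ℕ → ℤ)).sort (· ≥ ·)).length = n := by
  rw [sort_map_rows, List.length_map, List.length_range]

theorem wordVec_sort_map_rows (n : ℕ) (lam : YoungDiagram) :
    wordVec n (((rows n lam).map ((↑) : ℕ → ℤ)).sort (· ≥ ·)) = shifted n lam := by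
  funext i
  rw [sort_map_rows, wordVec, List.getD_eq_getElem _ _ (by simp), List.getElem_map,
    List.getElem_range, shifted, stair]

theorem kosWord_rows {nu lam : YoungDiagram} (h : lam.card = nu.card) (hn : nu.card ≤ n) :
    kosWord n nu (((rows n lam).map ((↑) : ℕ → ℤ)).sort (· ≥ ·)) =
      (kostkaFoulkes nu lam).eval (-1) := by
  rw [kosWord, if_pos (length_sort_map_rows n lam), wordVec_sort_map_rows,
    kostkaFoulkes_eq_kos h hn]

/-- Moving one row from length `i` to length `j < i` shortens by one exactly the columns with
numbers from `j` to `i - 1`, and the removed cells lie at the feet of these columns. -/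
theorem height_eq_card_filter {lam rho : YoungDiagram} (hlam : lam.colLen 0 ≤ n)
    (hrho : rho.colLen 0 ≤ n) {i j : ℕ} (hij : j < i)
    (h : rows n rho + {i} = rows n lam + {j}) :
    height lam rho = ((rows n lam).filter fun l => j < l ∧ l < i).card := by
  have hcol : ∀ c, rho.colLen c + (if c < i then 1 else 0) =
      lam.colLen c + if c < j then 1 else 0 := by
    intro c
    have := congrArg (Multiset.countP (c < ·)) h
    simpa only [Multiset.countP_add, countP_lt_rows hlam, countP_lt_rows hrho,
      ← Multiset.cons_zero, Multiset.countP_cons, Multiset.countP_zero, zero_add] using this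
  have hS : {r | rho.rowLen r < lam.rowLen r} =
      (fun c => lam.colLen c - 1) '' Set.Ico j i := by
    ext r
    simp only [Set.mem_ofPred_eq, Set.mem_image, Set.mem_Ico]
    constructor
    · intro hr
      have h1 := YoungDiagram.mem_iff_lt_colLen.1 (YoungDiagram.mem_iff_lt_rowLen.2 hr)
      have h2 : ¬ r < rho.colLen (rho.rowLen r) := fun h2 =>
        lt_irrefl _ (YoungDiagram.mem_iff_lt_rowLen.1 (YoungDiagram.mem_iff_lt_colLen.2 h2))
      have h3 := hcol (rho.rowLen r)
      refine ⟨rho.rowLen r, ?_, ?_⟩ <;> split_ifs at h3 <;> omega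
    · rintro ⟨c, ⟨h1, h2⟩, rfl⟩
      have h3 := hcol c
      rw [if_pos h2, if_neg (by omega)] at h3
      have h4 := YoungDiagram.mem_iff_lt_rowLen.1
        (YoungDiagram.mem_iff_lt_colLen.2 (show lam.colLen c - 1 < lam.colLen c by omega))
      have h5 : ¬ c < rho.rowLen (lam.colLen c - 1) := fun h5 => by
        have := YoungDiagram.mem_iff_lt_colLen.1 (YoungDiagram.mem_iff_lt_rowLen.2 h5)
        omega
      omega
  have hle : ∀ c, j ≤ c → lam.colLen c ≤ lam.colLen j := fun c hc => lam.colLen_anti j c hc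
  have hge : ∀ c, c < i → lam.colLen (i - 1) ≤ lam.colLen c := fun c hc =>
    lam.colLen_anti c (i - 1) (by omega)
  have hmax : IsGreatest {r | rho.rowLen r < lam.rowLen r} (lam.colLen j - 1) := by
    rw [hS]
    refine ⟨⟨j, ⟨le_rfl, hij⟩, rfl⟩, ?_⟩
    rintro _ ⟨c, ⟨h1, h2⟩, rfl⟩
    have := hle c h1
    simp only
    omega
  have hmin : IsLeast {r | rho.rowLen r < lam.rowLen r} (lam.colLen (i - 1) - 1) := by
    rw [hS]
    refine ⟨⟨i - 1, ⟨by omega, by omega⟩, rfl⟩, ?_⟩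
    rintro _ ⟨c, ⟨h1, h2⟩, rfl⟩
    have := hge c h2
    simp only
    omega
  have hpos := hcol (i - 1)
  rw [if_pos (by omega), if_neg (by omega)] at hpos
  have hcount : lam.colLen j =
      ((rows n lam).filter fun l => j < l ∧ l < i).card + lam.colLen (i - 1) := by
    rw [← countP_lt_rows hlam, ← countP_lt_rows hlam, ← Multiset.countP_eq_card_filter]
    induction rows n lam using Multiset.induction_on with
    | empty => rfl
    | cons a m ih =>
      simp only [Multiset.countP_cons]
      split_ifs <;> omega
  rw [height, hmax.csSup_eq, hmin.csInf_eq]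
  omega

end Rows

/-! ### Signs -/

section Signs

variable {n : ℕ}

/-- The sum of `min a b` over the pairs of entries of a list. It does not depend on the order, and
it is `b(lam)` for the list of the parts of `lam`. -/
def pairMin : List ℕ → ℕ
  | [] => 0
  | a :: l => (l.map (min a)).sum + pairMin l

theorem pairMin_perm {l l' : List ℕ} (h : l.Perm l') : pairMin l = pairMin l' := by
  induction h with
  | nil => rfl
  | cons a h ih => rw [pairMin, pairMin, ih, (h.map _).sum_eq]
  | swap a b l =>
    simp only [pairMin, List.map_cons, List.sum_cons, min_comm a b]
    omega
  | trans _ _ ih1 ih2 => exact ih1.trans ih2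

theorem pairMin_eq_sum {f : ℕ → ℕ} (hf : Antitone f) (n : ℕ) :
    pairMin ((List.range n).map f) = ∑ i ∈ Finset.range n, i * f i := by
  induction n with
  | zero => rfl
  | succ n ih =>
    have h : ∀ (l : List ℕ), (∀ x ∈ l, f n ≤ x) →
        pairMin (l ++ [f n]) = pairMin l + l.length * f n := by
      intro l hl
      induction l with
      | nil => simp [pairMin]
      | cons a l ih =>
        have h1 := ih fun x hx => hl x (List.mem_cons_of_mem _ hx)
        have h2 := hl a (by simp)
        simp only [pairMin, List.cons_append, h1, List.map_append, List.sum_append, List.map_cons,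
          List.map_nil, List.sum_cons, List.sum_nil, min_eq_right h2, List.length_cons]
        ring
    rw [List.range_succ, List.map_append, List.map_cons, List.map_nil, h, ih,
      Finset.sum_range_succ, List.length_map, List.length_range]
    intro x hx
    obtain ⟨i, hi, rfl⟩ := List.mem_map.1 hx
    exact hf (List.mem_range.1 hi).le

theorem sg_eq_pairMin {rho : YoungDiagram} (hn : rho.colLen 0 ≤ n) {l : List ℕ}
    (h : rows n rho = l) : sg rho = (-1) ^ pairMin l := by
  rw [← pairMin_perm (Multiset.coe_eq_coe.1 h), pairMin_eq_sum (rowLen_antitone rho), sg,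
    weightedSize]
  congr 1
  refine Finset.sum_subset (Finset.range_subset_range.2 hn) fun i _ hi => ?_
  rw [rowLen_eq_zero_of_colLen_le (by simpa using hi), mul_zero]

theorem neg_one_pow_pairMin_cons_cons (c : ℕ) (l : List ℕ) :
    (-1 : ℤ) ^ pairMin (c :: c :: l) = (-1) ^ c * (-1) ^ pairMin l := by
  simp only [pairMin, List.map_cons, List.sum_cons, min_self]
  rw [show c + (l.map (min c)).sum + ((l.map (min c)).sum + pairMin l) =
    c + pairMin l + ((l.map (min c)).sum + (l.map (min c)).sum) by omega, pow_add,
    (Even.add_self _).neg_one_pow, mul_one, pow_add]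

/-- A pair `a, a` contributes `a` to `pairMin`, up to the minima with the other rows, each of which
occurs twice. -/
theorem sg_of_rows_eq_pair {lam rho : YoungDiagram} (hlam : lam.colLen 0 ≤ n)
    (hrho : rho.colLen 0 ≤ n) {a b : ℕ} {M : Multiset ℕ} (h1 : rows n lam = a ::ₘ a ::ₘ M)
    (h2 : rows n rho = b ::ₘ b ::ₘ M) : sg rho = (-1) ^ (a + b) * sg lam := by
  induction M using Quotient.inductionOn with
  | h l =>
    rw [sg_eq_pairMin hlam h1, sg_eq_pairMin hrho h2, neg_one_pow_pairMin_cons_cons,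
      neg_one_pow_pairMin_cons_cons, pow_add]
    have := (Even.add_self a).neg_one_pow (α := ℤ)
    rw [pow_add] at this
    linear_combination (-(-1) ^ b * (-1) ^ pairMin l) * this

/-- If all entries have the parity of `e`, then so do all minima. -/
theorem pairMin_mod_two {e : ℕ} {l : List ℕ} (h : ∀ x ∈ l, x % 2 = e % 2) :
    pairMin l % 2 = (l.length.choose 2 * e) % 2 := by
  have hmin : ∀ a, a % 2 = e % 2 → ∀ l : List ℕ, (∀ x ∈ l, x % 2 = e % 2) →
      (l.map (min a)).sum % 2 = (l.length * e) % 2 := by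
    intro a ha l hl
    induction l with
    | nil => simp
    | cons b l ih =>
      have h2 := ih fun x hx => hl x (List.mem_cons_of_mem _ hx)
      have h3 : min a b % 2 = e % 2 := by
        rcases min_choice a b with h3 | h3 <;> rw [h3]
        exacts [ha, hl b (by simp)]
      rw [List.map_cons, List.sum_cons, List.length_cons, add_mul, one_mul]
      omega
  induction l with
  | nil => simp [pairMin]
  | cons a l ih =>
    have hl : ∀ x ∈ l, x % 2 = e % 2 := fun x hx => h x (List.mem_cons_of_mem _ hx)
    have h1 := hmin a (h a (by simp)) l hl
    have h2 := ih hl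
    have h3 : (l.length + 1).choose 2 = l.length + l.length.choose 2 := by
      rw [Nat.choose_succ_succ' l.length 1, Nat.choose_one_right]
    rw [pairMin, List.length_cons, h3, add_mul]
    omega

/-- Replacing a part of odd multiplicity by another number of the same parity does not change the
sign, when all parts of odd multiplicity have that parity. -/
theorem sg_of_rows_eq_single {lam rho : YoungDiagram} (hlam : lam.colLen 0 ≤ n)
    (hrho : rho.colLen 0 ≤ n) {a b : ℕ} (p : Multiset ℕ) {M : Multiset ℕ}
    (h1 : rows n lam = p + p + a ::ₘ M) (h2 : rows n rho = p + p + b ::ₘ M)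
    (hM : ∀ x ∈ M, x % 2 = a % 2) (hab : b % 2 = a % 2) : sg rho = sg lam := by
  induction M using Quotient.inductionOn with
  | h l =>
    induction p using Quotient.inductionOn with
    | h p =>
      have key : ∀ l : List ℕ, ∃ l' : List ℕ, ((p : Multiset ℕ) + p + l = l') ∧
          (-1 : ℤ) ^ pairMin l' = (-1) ^ p.sum * (-1) ^ pairMin l := by
        intro l
        clear h1 h2
        induction p with
        | nil => exact ⟨l, by simp, by simp⟩
        | cons x p ih =>
          obtain ⟨l', h3, h4⟩ := ih
          refine ⟨x :: x :: l', ?_, ?_⟩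
          · rw [← Multiset.cons_coe, ← Multiset.cons_coe, ← Multiset.cons_coe, ← h3]
            simp only [Multiset.cons_add, Multiset.add_cons]
          · rw [neg_one_pow_pairMin_cons_cons, h4, List.sum_cons, pow_add, mul_assoc]
      obtain ⟨l1, h3, h4⟩ := key (a :: l)
      obtain ⟨l2, h5, h6⟩ := key (b :: l)
      rw [sg_eq_pairMin hlam (h1.trans h3), sg_eq_pairMin hrho (h2.trans h5), h4, h6]
      congr 1
      have h7 : ∀ c, c % 2 = a % 2 →
          pairMin (c :: l) % 2 = ((l.length + 1).choose 2 * a) % 2 := by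
        intro c hc
        refine pairMin_mod_two (l := c :: l) fun x hx => ?_
        rcases List.mem_cons.1 hx with rfl | hx
        · exact hc
        · exact hM x hx
      rw [neg_one_pow_eq_pow_mod_two, h7 b hab, neg_one_pow_eq_pow_mod_two (pairMin _), h7 a rfl]

end Signs

/-! ### The values at decreasing words with natural letters -/

section Values

variable {n : ℕ}

/-- The value of `kosWord` at the decreasing word with the given letters. -/
noncomputable def sortVal (n : ℕ) (nu : YoungDiagram) (M : Multiset ℕ) : ℤ :=
  kosWord n nu ((M.map ((↑) : ℕ → ℤ)).sort (· ≥ ·))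

/-- The form that `lowerFun_sort` takes for natural letters: the words with a negative letter drop
out. -/
theorem lowerFun_kosWord_sort (nu : YoungDiagram) (k : ℕ) (p : Multiset ℕ) (s : Finset ℕ)
    (hs : ∀ i ∈ s, ∀ j ∈ s, i % 2 = j % 2) :
    lowerFun (2 * k) (kosWord n nu) (((p + p + s.val).map ((↑) : ℕ → ℤ)).sort (· ≥ ·)) =
      ∑ c ∈ p.toFinset with k ≤ c, (p.count c : ℤ) * ((-1) ^ k * (2 * sortVal n nu
        ((c - k) ::ₘ (c - k) ::ₘ (p.erase c + p.erase c + s.val)))) +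
      ∑ i ∈ s with 2 * k ≤ i, (-1) ^ (s.filter fun l => i - 2 * k < l ∧ l < i).card *
        sortVal n nu ((i - 2 * k) ::ₘ (p + p + (s.erase i).val)) +
      ∑ i ∈ s, ∑ j ∈ s with j < i ∧ i - j < 2 * k ∧ 2 * k ≤ i + j,
        (-1) ^ (s.filter fun l => j < l ∧ l < i).card * ((-1) ^ (j + ((i + j) / 2 - k)) *
          (2 * sortVal n nu (((i + j) / 2 - k) ::ₘ ((i + j) / 2 - k) ::ₘ
            (p + p + ((s.erase i).erase j).val)))) := by
  obtain ⟨e, he⟩ : ∃ e : ℕ ↪ ℤ, ∀ i, e i = i := ⟨Nat.castEmbedding, fun _ => rfl⟩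
  have hmap : ∀ (p : Multiset ℕ) (s : Finset ℕ), (p + p + s.val).map ((↑) : ℕ → ℤ) =
      p.map (↑) + p.map (↑) + (s.map e).val := fun p s => by
    rw [Multiset.map_add, Multiset.map_add, Finset.map_val]
    congr 2
    exact (funext he).symm
  have hfilter : ∀ (P : ℤ → Prop) (Q : ℕ → Prop) [DecidablePred P] [DecidablePred Q],
      (∀ l : ℕ, P l ↔ Q l) → ((s.map e).filter P).card = (s.filter Q).card := by
    intro P Q _ _ h
    rw [Finset.filter_map, Finset.card_map]
    congr 1
    exact Finset.filter_congr fun l _ => by rw [Function.comp_apply, he, h]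
  have key := lowerFun_sort ⟨kosWord n nu, kosWord_mem n nu⟩ k (p.map (↑)) (s.map e) (by
    intro i hi j hj
    obtain ⟨a, ha, rfl⟩ := Finset.mem_map.1 hi
    obtain ⟨b, hb, rfl⟩ := Finset.mem_map.1 hj
    have := hs a ha b hb
    rw [he, he]
    omega)
  dsimp only at key
  rw [hmap, key, Finset.sum_add_distrib, ← add_assoc]
  congr 1
  · congr 1
    · rw [Multiset.map_map, Finset.sum_multiset_map_count, Finset.sum_filter]
      refine Finset.sum_congr rfl fun c _ => ?_
      rw [nsmul_eq_mul, Function.comp_apply]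
      split_ifs with hc
      · rw [sortVal, Multiset.map_cons, Multiset.map_cons, hmap,
          Multiset.map_erase _ Nat.cast_injective, Nat.cast_sub hc]
      · rw [kosWord_sort_eq_zero_of_neg (Multiset.mem_cons_self _ _) (by omega), mul_zero,
          mul_zero, mul_zero]
    · rw [Finset.sum_map, Finset.sum_filter]
      refine Finset.sum_congr rfl fun i _ => ?_
      simp only [he]
      split_ifs with hi
      · rw [sortVal, Multiset.map_cons, hmap, Finset.map_erase, he,
          hfilter _ (fun l => i - 2 * k < l ∧ l < i) (by intro l; omega), Nat.cast_sub hi,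
          Nat.cast_mul, Nat.cast_ofNat]
      · rw [kosWord_sort_eq_zero_of_neg (Multiset.mem_cons_self _ _) (by omega), mul_zero]
  · rw [Finset.sum_map]
    refine Finset.sum_congr rfl fun i hi => ?_
    rw [Finset.filter_map, Finset.sum_map, Finset.sum_filter, Finset.sum_filter]
    refine Finset.sum_congr rfl fun j hj => ?_
    have hpar := hs i hi j hj
    simp only [he, Function.comp_apply]
    by_cases h1 : j < i ∧ i - j < 2 * k
    · rw [if_pos (by omega)]
      by_cases h2 : 2 * k ≤ i + j
      · rw [if_pos ⟨h1.1, h1.2, h2⟩, hfilter _ (fun l => j < l ∧ l < i) (by intro l; omega),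
          sortVal, Multiset.map_cons, Multiset.map_cons, hmap, Finset.map_erase, Finset.map_erase,
          he, he, neg_one_pow_eq_pow_mod_two (((j : ℤ) - (i - 2 * k)) / 2).toNat,
          neg_one_pow_eq_pow_mod_two (j + _),
          show (((j : ℤ) - (i - 2 * k)) / 2).toNat % 2 = (j + ((i + j) / 2 - k)) % 2 by omega,
          show ((i : ℤ) - 2 * k + j) / 2 = (((i + j) / 2 - k : ℕ) : ℤ) by omega]
      · rw [if_neg (fun h => h2 h.2.2),
          kosWord_sort_eq_zero_of_neg (Multiset.mem_cons_self _ _) (by omega), mul_zero, mul_zero,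
          mul_zero]
    · rw [if_neg (by omega), if_neg (by omega)]

theorem sortVal_rows {nu rho : YoungDiagram} (h : rho.card = nu.card) (hn : nu.card ≤ n)
    {M : Multiset ℕ} (hM : rows n rho = M) : sortVal n nu M = (kostkaFoulkes nu rho).eval (-1) := by
  rw [← hM, sortVal, kosWord_rows h hn]

theorem le_rowLens_of_rows_eq {lam : YoungDiagram} (hn : lam.colLen 0 ≤ n) {A M : Multiset ℕ}
    (hM : rows n lam = A + M) (h0 : 0 ∉ A) : A ≤ lam.rowLens := by
  rw [Multiset.le_iff_count]
  intro a
  by_cases ha : a = 0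
  · rw [ha, Multiset.count_eq_zero_of_notMem h0]
    exact Nat.zero_le _
  · rw [Multiset.coe_count, ← mult, ← count_rows hn ha, hM, Multiset.count_add]
    exact Nat.le_add_right _ _

theorem rows_replaceParts_of_eq {lam : YoungDiagram} (hn : lam.colLen 0 ≤ n) {A B M : Multiset ℕ}
    (hM : rows n lam = A + M) (h0 : 0 ∉ A) (hAB : A.card = B.card) :
    (replaceParts lam A B).colLen 0 ≤ n ∧ rows n (replaceParts lam A B) = B + M := by
  have hA := le_rowLens_of_rows_eq hn hM h0
  refine ⟨(colLen_replaceParts_le hA hAB).trans hn, ?_⟩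
  have h := rows_replaceParts hn hA hAB
  rw [hM, add_assoc, add_comm A, add_comm M] at h
  exact add_right_cancel h

theorem card_replaceParts_of_eq {lam : YoungDiagram} (hn : lam.colLen 0 ≤ n) {A B M : Multiset ℕ}
    (hM : rows n lam = A + M) (h0 : 0 ∉ A) (hAB : A.card = B.card) :
    (replaceParts lam A B).card + A.sum = lam.card + B.sum := by
  obtain ⟨h1, h2⟩ := rows_replaceParts_of_eq hn hM h0 hAB
  rw [card_eq_sum_rows h1, card_eq_sum_rows hn, h2, hM, Multiset.sum_add, Multiset.sum_add]
  omega

/-- The sign of the height of the skew shape left by shortening a row. -/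
theorem neg_one_pow_height {lam : YoungDiagram} (hn : lam.colLen 0 ≤ n) {p : Multiset ℕ}
    {s : Finset ℕ} (hps : rows n lam = p + p + s.val) {i j : ℕ} (hi : i ∈ s) (hij : j < i) :
    (-1 : ℤ) ^ height lam (replaceParts lam {i} {j}) =
      (-1) ^ (s.filter fun l => j < l ∧ l < i).card := by
  have hM : rows n lam = {i} + (p + p + (s.erase i).val) := by
    rw [hps, Finset.erase_val, Multiset.singleton_add, ← Multiset.add_cons,
      Multiset.cons_erase hi]
  obtain ⟨h1, h2⟩ := rows_replaceParts_of_eq hn hM (B := {j})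
    (by rw [Multiset.mem_singleton]; omega) rfl
  rw [height_eq_card_filter hn h1 hij (by rw [h2, hM]; abel), hps, Multiset.filter_add,
    Multiset.filter_add, Multiset.card_add, Multiset.card_add, pow_add,
    (Even.add_self _).neg_one_pow, one_mul]
  rfl

end Values

/-! ### The recursion -/

section Recursion

variable {n : ℕ}

open Classical in
/-- The sum over border strips is obtained by lowering one row of `lam` by `r` in all ways. -/
theorem sum_isBorderStrip_kostkaFoulkes {lam nu : YoungDiagram} {r : ℕ} (hr : 1 ≤ r)
    (hnu : nu.card + r = lam.card) (hn : lam.card ≤ n) :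
    ∑ mu ∈ partitionsOf lam.card with IsBorderStrip mu nu,
        (-1) ^ height mu nu * (kostkaFoulkes mu lam).eval (-1) =
      lowerFun r (kosWord n nu) (((rows n lam).map ((↑) : ℕ → ℤ)).sort (· ≥ ·)) := by
  rw [lowerFun_kosWord _ _ _ (length_sort_map_rows n lam), wordVec_sort_map_rows,
    ← sum_kos_add_single, ← sum_isBorderStrip hr hnu hn, Polynomial.eval_finsetSum]
  refine Finset.sum_congr rfl fun mu hmu => ?_
  have hmu := mem_partitionsOf.1 (Finset.mem_filter.1 hmu).1
  rw [kostkaFoulkes_eq_kos hmu.symm (hmu.trans_le hn), Polynomial.eval_mul, Polynomial.eval_pow,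
    Polynomial.eval_neg, Polynomial.eval_one]

theorem mem_partSet_iff {lam : YoungDiagram} {i : ℕ} : i ∈ partSet lam ↔ 1 ≤ mult lam i := by
  rw [partSet, List.mem_toFinset, mult, Nat.one_le_iff_ne_zero, Nat.ne_zero_iff_zero_lt,
    List.count_pos_iff]

theorem mult_zero (lam : YoungDiagram) : mult lam 0 = 0 :=
  List.count_eq_zero.2 fun h => lt_irrefl _ (lam.pos_of_mem_rowLens 0 h)

/-- With an even number of empty rows, the rows form pairs of equal rows together with the parts of
odd multiplicity. -/
theorem exists_rows_eq_pairs {lam : YoungDiagram} (hn : lam.colLen 0 ≤ n)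
    (heven : Even (n - lam.colLen 0)) :
    ∃ p : Multiset ℕ, (∀ c ≠ 0, p.count c = mult lam c / 2) ∧
      rows n lam = p + p + ((partSet lam).filter fun i => Odd (mult lam i)).val := by
  obtain ⟨p, hp⟩ : ∃ p : Multiset ℕ, ∀ a, p.count a = (rows n lam).count a / 2 := by
    refine ⟨∑ x ∈ (rows n lam).toFinset, Multiset.replicate ((rows n lam).count x / 2) x,
      fun a => ?_⟩
    simp only [Multiset.count_sum', Multiset.count_replicate, Finset.sum_ite_eq',
      Multiset.mem_toFinset]
    split_ifs with h
    · rfl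
    · rw [Multiset.count_eq_zero_of_notMem h, Nat.zero_div]
  refine ⟨p, fun c hc => by rw [hp, count_rows hn hc], Multiset.ext.2 fun a => ?_⟩
  rw [Multiset.count_add, Multiset.count_add, hp, Multiset.count_eq_of_nodup (Finset.nodup _)]
  simp only [Finset.mem_val, Finset.mem_filter, mem_partSet_iff, Nat.odd_iff]
  by_cases ha : a = 0
  · have h0 : (rows n lam).count 0 = n - lam.colLen 0 := by
      rw [rows_eq hn, Multiset.count_add, Multiset.coe_count, ← mult, mult_zero,
        Multiset.count_replicate_self, zero_add]
    rw [ha, h0, mult_zero, if_neg (by omega)]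
    rw [Nat.even_iff] at heven
    omega
  · rw [count_rows hn ha]
    split_ifs <;> omega

variable {lam nu : YoungDiagram} {k : ℕ} {p : Multiset ℕ} {s : Finset ℕ}

/-- A summand for a pair of equal parts: replacing `c, c` by `c - k, c - k` multiplies `sg` by
`(-1) ^ k`. -/
theorem sg_mul_pair (hn : lam.colLen 0 ≤ n) (hnu : nu.card + 2 * k = lam.card)
    (hnun : nu.card ≤ n) (hps : rows n lam = p + p + s.val) {c : ℕ} (hc : c ∈ p) (hc0 : c ≠ 0)
    (hkc : k ≤ c) :
    sg lam * ((-1) ^ k * sortVal n nu ((c - k) ::ₘ (c - k) ::ₘ (p.erase c + p.erase c + s.val))) =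
      sg (replaceParts lam {c, c} {c - k, c - k}) *
        (kostkaFoulkes nu (replaceParts lam {c, c} {c - k, c - k})).eval (-1) := by
  have hM : rows n lam = {c, c} + (p.erase c + p.erase c + s.val) := by
    rw [hps]
    nth_rewrite 1 2 [← Multiset.cons_erase hc]
    simp only [Multiset.insert_eq_cons, Multiset.cons_add, Multiset.add_cons,
      Multiset.singleton_add]
  have hins : ∀ (a : ℕ) (M : Multiset ℕ), ({a, a} : Multiset ℕ) + M = a ::ₘ a ::ₘ M := by
    intro a M
    simp only [Multiset.insert_eq_cons, Multiset.cons_add, Multiset.singleton_add]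
  have h0 : 0 ∉ ({c, c} : Multiset ℕ) := by simpa using hc0.symm
  obtain ⟨h1, h2⟩ := rows_replaceParts_of_eq hn hM h0 (B := {c - k, c - k}) rfl
  have h3 := card_replaceParts_of_eq hn hM h0 (B := {c - k, c - k}) rfl
  simp only [Multiset.insert_eq_cons, Multiset.sum_cons, Multiset.sum_singleton] at h3
  rw [← sortVal_rows (n := n) (by simp only [Multiset.insert_eq_cons]; omega) hnun h2,
    sg_of_rows_eq_pair hn h1 (hM.trans (hins _ _)) (h2.trans (hins _ _)),
    show c + (c - k) = k + ((c - k) + (c - k)) by omega, pow_add,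
    (Even.add_self _).neg_one_pow, hins]
  ring

/-- A summand for a part of odd multiplicity that is lowered by `2 k`, which does not change
`sg`. -/
theorem sg_mul_single (hn : lam.colLen 0 ≤ n) (hnu : nu.card + 2 * k = lam.card)
    (hnun : nu.card ≤ n) (hk : 1 ≤ k) (hps : rows n lam = p + p + s.val)
    (hs : ∀ i ∈ s, ∀ j ∈ s, i % 2 = j % 2) {i : ℕ} (hi : i ∈ s) (hki : 2 * k ≤ i) :
    sg lam * ((-1) ^ (s.filter fun l => i - 2 * k < l ∧ l < i).card *
        sortVal n nu ((i - 2 * k) ::ₘ (p + p + (s.erase i).val))) =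
      sg (replaceParts lam {i} {i - 2 * k}) * (-1) ^ height lam (replaceParts lam {i} {i - 2 * k}) *
        (kostkaFoulkes nu (replaceParts lam {i} {i - 2 * k})).eval (-1) := by
  have hM : rows n lam = {i} + (p + p + (s.erase i).val) := by
    rw [hps, Finset.erase_val, Multiset.singleton_add, ← Multiset.add_cons,
      Multiset.cons_erase hi]
  have h0 : 0 ∉ ({i} : Multiset ℕ) := by
    rw [Multiset.mem_singleton]
    omega
  obtain ⟨h1, h2⟩ := rows_replaceParts_of_eq hn hM h0 (B := {i - 2 * k}) rfl
  have h3 := card_replaceParts_of_eq hn hM h0 (B := {i - 2 * k}) rfl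
  simp only [Multiset.sum_singleton] at h3
  rw [← sortVal_rows (n := n) (by omega) hnun h2, neg_one_pow_height hn hps hi (by omega),
    sg_of_rows_eq_single hn h1 p (M := (s.erase i).val) (a := i) (b := i - 2 * k)
      (by rw [hM, Multiset.singleton_add, Multiset.add_cons])
      (by rw [h2, Multiset.singleton_add, Multiset.add_cons])
      (fun x hx => hs x (Finset.mem_of_mem_erase hx) i hi) (by omega), mul_assoc,
    Multiset.singleton_add]

/-- A summand for two parts of odd multiplicity. Replacing `i` by `j` does not change the sign of
`lam`, and the two parts are then treated as a pair `j, j`. -/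
theorem sg_mul_double (hn : lam.colLen 0 ≤ n) (hnu : nu.card + 2 * k = lam.card)
    (hnun : nu.card ≤ n) (hps : rows n lam = p + p + s.val)
    (hs : ∀ i ∈ s, ∀ j ∈ s, i % 2 = j % 2) {i j : ℕ} (hi : i ∈ s) (hj : j ∈ s) (hj0 : j ≠ 0)
    (hji : j < i) (hkij : 2 * k ≤ i + j) :
    sg lam * ((-1) ^ (s.filter fun l => j < l ∧ l < i).card * ((-1) ^ (j + ((i + j) / 2 - k)) *
        (2 * sortVal n nu (((i + j) / 2 - k) ::ₘ ((i + j) / 2 - k) ::ₘ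
          (p + p + ((s.erase i).erase j).val))))) =
      sg (replaceParts lam {i, j} {(i + j) / 2 - k, (i + j) / 2 - k}) *
        (-1) ^ height lam (replaceParts lam {i} {j}) * 2 *
        (kostkaFoulkes nu
          (replaceParts lam {i, j} {(i + j) / 2 - k, (i + j) / 2 - k})).eval (-1) := by
  set h := (i + j) / 2 - k with hh
  have hpar := hs i hi j hj
  have hji' : j ∈ s.erase i := Finset.mem_erase.2 ⟨hji.ne, hj⟩
  have hM1 : rows n lam = {i} + (p + p + (s.erase i).val) := by
    rw [hps, Finset.erase_val, Multiset.singleton_add, ← Multiset.add_cons,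
      Multiset.cons_erase hi]
  have hj' : (s.erase i).val = j ::ₘ ((s.erase i).erase j).val := by
    rw [Finset.erase_val _ j, Multiset.cons_erase hji']
  have hM : rows n lam = {i, j} + (p + p + ((s.erase i).erase j).val) := by
    rw [hM1, hj', Multiset.insert_eq_cons, Multiset.cons_add, Multiset.add_cons,
      Multiset.singleton_add, Multiset.singleton_add]
  have hi0 : i ≠ 0 := by omega
  obtain ⟨h1, h2⟩ := rows_replaceParts_of_eq hn hM1 (B := {j}) (by simpa using hi0.symm) rfl
  have h0 : 0 ∉ ({i, j} : Multiset ℕ) := by simpa using ⟨hi0.symm, hj0.symm⟩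
  obtain ⟨h3, h4⟩ := rows_replaceParts_of_eq hn hM h0 (B := {h, h}) rfl
  have h5 := card_replaceParts_of_eq hn hM h0 (B := {h, h}) rfl
  simp only [Multiset.insert_eq_cons, Multiset.sum_cons, Multiset.sum_singleton] at h5
  have h6 : sg (replaceParts lam {i} {j}) = sg lam :=
    sg_of_rows_eq_single hn h1 p (M := (s.erase i).val) (a := i) (b := j)
      (by rw [hM1, Multiset.singleton_add, Multiset.add_cons])
      (by rw [h2, Multiset.singleton_add, Multiset.add_cons])
      (fun x hx => hs x (Finset.mem_of_mem_erase hx) i hi) hpar.symm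
  rw [← sortVal_rows (n := n) (by simp only [Multiset.insert_eq_cons]; omega) hnun h4,
    neg_one_pow_height hn hps hi hji,
    sg_of_rows_eq_pair h1 h3 (a := j) (b := h) (M := p + p + ((s.erase i).erase j).val)
      (by rw [h2, hj']; simp only [Multiset.add_cons, Multiset.singleton_add])
      (by rw [h4]; simp only [Multiset.insert_eq_cons, Multiset.cons_add, Multiset.singleton_add]),
    h6]
  simp only [Multiset.insert_eq_cons, Multiset.cons_add, Multiset.singleton_add]
  ring

end Recursion
end HallLittlewood

open HallLittlewood Classical in
theorem mainTheorem6 (lam : YoungDiagram) (hlam : IsClassicalJordanType lam)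
    (k : ℕ) (hk : 1 ≤ k) (nu : YoungDiagram) (hnu : nu.card + 2 * k = lam.card) :
    sg lam * ∑ mu ∈ partitionsOf lam.card with IsBorderStrip mu nu,
        (-1) ^ height mu nu * (kostkaFoulkes mu lam).eval (-1) =
      (∑ i ∈ partSet lam with k ≤ i ∧ 2 ≤ mult lam i,
        sg (replaceParts lam {i, i} {i - k, i - k}) * (2 * (mult lam i / 2 : ℕ)) *
          (kostkaFoulkes nu (replaceParts lam {i, i} {i - k, i - k})).eval (-1)) +
      (∑ i ∈ partSet lam with 2 * k ≤ i ∧ Odd (mult lam i),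
        sg (replaceParts lam {i} {i - 2 * k}) *
          (-1) ^ height lam (replaceParts lam {i} {i - 2 * k}) *
          (kostkaFoulkes nu (replaceParts lam {i} {i - 2 * k})).eval (-1)) +
      ∑ p ∈ partSet lam ×ˢ partSet lam with
          p.2 < p.1 ∧ p.1 - p.2 < 2 * k ∧ 2 * k ≤ p.1 + p.2 ∧
            Odd (mult lam p.1) ∧ Odd (mult lam p.2),
        sg (replaceParts lam {p.1, p.2} {(p.1 + p.2) / 2 - k, (p.1 + p.2) / 2 - k}) *
          (-1) ^ height lam (replaceParts lam {p.1} {p.2}) * 2 *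
          (kostkaFoulkes nu
            (replaceParts lam {p.1, p.2} {(p.1 + p.2) / 2 - k, (p.1 + p.2) / 2 - k})).eval (-1) := by
  -- The number of variables is large enough, and the number of empty rows is even.
  obtain ⟨n, hn⟩ : ∃ n, n = lam.colLen 0 + 2 * lam.card := ⟨_, rfl⟩
  have hcol : lam.colLen 0 ≤ n := by omega
  have hnun : nu.card ≤ n := by omega
  obtain ⟨p, hp, hps⟩ := exists_rows_eq_pairs hcol
    (by rw [hn, Nat.add_sub_cancel_left]; exact even_two_mul _)
  set s := (partSet lam).filter fun i => Odd (mult lam i) with hsdef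
  clear_value s
  have hpos : ∀ i ∈ partSet lam, i ≠ 0 := by
    rintro i hi rfl
    have := mem_partSet_iff.1 hi
    rw [mult_zero] at this
    omega
  have hmem : ∀ i, i ∈ s ↔ i ∈ partSet lam ∧ Odd (mult lam i) := fun i => by
    rw [hsdef, Finset.mem_filter]
  have hs : ∀ i ∈ s, ∀ j ∈ s, i % 2 = j % 2 := by
    intro i hi j hj
    rw [hmem] at hi hj
    exact hlam.mod_two_eq (Nat.one_le_iff_ne_zero.2 (hpos i hi.1))
      (Nat.one_le_iff_ne_zero.2 (hpos j hj.1)) hi.2 hj.2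
  rw [sum_isBorderStrip_kostkaFoulkes (n := n) (r := 2 * k) (by omega) hnu (by omega), hps,
    Nat.cast_mul, Nat.cast_ofNat, lowerFun_kosWord_sort nu k p s hs, mul_add, mul_add]
  congr 1
  · congr 1
    · have hset : (p.toFinset.filter fun c => k ≤ c) =
          (partSet lam).filter fun i => k ≤ i ∧ 2 ≤ mult lam i := by
        ext c
        rw [Finset.mem_filter, Finset.mem_filter, Multiset.mem_toFinset, mem_partSet_iff,
          ← Multiset.one_le_count_iff_mem]
        by_cases hc : c = 0
        · omega
        · rw [hp c hc]
          omega
      rw [hset, Finset.mul_sum]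
      refine Finset.sum_congr rfl fun c hc => ?_
      rw [← hset, Finset.mem_filter, Multiset.mem_toFinset] at hc
      have hc0 : c ≠ 0 := by omega
      have := sg_mul_pair hcol hnu hnun hps hc.1 hc0 hc.2
      rw [hp c hc0]
      linear_combination (2 * (mult lam c / 2 : ℕ) : ℤ) * this
    · rw [Finset.mul_sum, hsdef, Finset.filter_filter]
      refine Finset.sum_congr (Finset.filter_congr fun i _ => and_comm) fun i hi => ?_
      rw [← hsdef]
      rw [Finset.mem_filter] at hi
      exact sg_mul_single hcol hnu hnun hk hps hs ((hmem i).2 ⟨hi.1, hi.2.2⟩) hi.2.1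
  · have hset : ((partSet lam ×ˢ partSet lam).filter fun q => q.2 < q.1 ∧ q.1 - q.2 < 2 * k ∧
        2 * k ≤ q.1 + q.2 ∧ Odd (mult lam q.1) ∧ Odd (mult lam q.2)) =
        (s ×ˢ s).filter fun q => q.2 < q.1 ∧ q.1 - q.2 < 2 * k ∧ 2 * k ≤ q.1 + q.2 := by
      ext q
      simp only [hmem, Finset.mem_filter, Finset.mem_product]
      tauto
    rw [hset, Finset.sum_filter, Finset.sum_product, Finset.mul_sum]
    refine Finset.sum_congr rfl fun i hi => ?_
    rw [Finset.mul_sum, ← Finset.sum_filter]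
    refine Finset.sum_congr rfl fun j hj => ?_
    rw [Finset.mem_filter] at hj
    exact sg_mul_double hcol hnu hnun hps hs hi hj.1 (hpos j ((hmem j).1 hj.1).1) hj.2.1
      hj.2.2.2
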